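/- **Setting.** Let $T>0$, $n,m,l\ge 0$, let $U\subseteq\mathbb R^m$ be the closure of a connected open set and $A\subseteq\mathbb R^l$ compact. Consider the impulsive Cauchy problem $$\dot x=\tilde f(x,u,a)+\sum_{i=1}^m\tilde g_i(x,u)\,\dot u^i\quad\text{on }[0,T],\qquad x(0)=x_0 .\tag{1}$$ Put $\widehat U=\{sz: z\in U,\ 0\le s\le 1\}$ (so $\widehat U=U$ if $U$ is star-shaped about $0$). Assume: * $\tilde f(\cdot,\cdot,a)$ is locally Lipschitz on $\mathbb R^n\times U$, locally uniformly in $a\in A$; $\tilde f(x,u,\cdot)$ is continuous on $A$ for every $(x,u)\in\mathbb R^n\times U$; and $|\tilde f(x,u,a)|\le M_0(1+|(x,u)|)$ on $\mathbb R^n\times U\times A$ for some $M_0>0$; * each $\tilde g_i$ is of class $C^2$ in a neighbourhood of every point of $\mathbb R^n\times\widehat U$, and $|\tilde g_i(x,z)|\le M_0(1+|(x,z)|)$ on $\mathbb R^n\times\widehat U$ for some $M_0>0$; * the fields $g_i=(\tilde g_i,\mathbf e_i)$ commute: $[g_i,g_j]=0$ on $\mathbb R^n\times\widehat U$ for all $i,j$.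 Ordinary controls are $a\in L^1(0,T;A)$. For $u\in C^1([0,T];U)$ a *classical solution* of (1) is a continuous $x$ satisfying the integrated form of (1) on $[0,T]$, with integrable right-hand side. Let $L^1_{[0,T]}(0,T;U)$ be the set of integrable maps defined at every point of $[0,T]$ with values in $U$. For $I\subseteq[0,T]$, convergence in $L^1_I$ means convergence in $L^1(0,T)$ together with pointwise convergence at every point of $I$. For $u\in L^1_{[0,T]}(0,T;U)$ and $\tau\in[0,T]$, an *approximation at $\tau$* of $(x_0,u,a)$ is a sequence $w_k\in C^1([0,T];U)$ with $w_k\to u$ in $L^1_{\{0,\tau\}}$, together with classical solutions $y_k$ of (1) for $(x_0,w_k,a)$, such that $(w_k)$ and $(y_k)$ have uniformly bounded values. An integrable map $x$, defined at every point of $[0,T]$, is a *generalized solution* of (1) for $(x_0,u,a)$ if for every $\tau\in[0,T]$ there is an approximation $(w_k,y_k)$ at $\tau$ with $y_k\to x$ in $L^1_{\{0,\tau\}}$. **Theorem (Robustness of the impulsive system).** **(A) Controls of class $C^1$.** For all $x_0\in\mathbb R^n$, $u\in C^1([0,T];U)$, $a\in L^1(0,T;A)$ there is a unique classical solution $x(x_0,u,a)$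 on $[0,T]$, and: 1. for each $x_0$ and $u\in C^1([0,T];U)$ the map $a\mapsto x(x_0,u,a)$ is continuous from $L^1(0,T;A)$ to $L^1(0,T;\mathbb R^n)$; 2. let $r>0$, let $\mathcal W\subset C^1([0,T];U)$ be a set of controls with uniformly bounded values, and let $K'\subset\mathbb R^n$ be a bounded set such that the trajectories $x(x_0,u,a)$ have values in $K'$ for all $x_0\in B_r(0)$, $u\in\mathcal W$, $a\in L^1(0,T;A)$. Then there is $M>0$ such that for all $x_0,\hat x_0\in B_r(0)$, $u,\hat u\in\mathcal W$, $a\in L^1(0,T;A)$ and $\tau\in[0,T]$, writing $x=x(x_0,u,a)$ and $\hat x=x(\hat x_0,\hat u,a)$, $$|x(\tau)-\hat x(\tau)|+\int_0^T|x-\hat x|\,dt\le M\Big[|x_0-\hat x_0|+|u(0)-\hat u(0)|+|u(\tau)-\hat u(\tau)|+\int_0^T|u-\hat u|\,dt\Big].$$ **(B) Controls in $L^1_{[0,T]}(0,T;U)$.** For $x_0\in\mathbb R^n$, $u\in L^1_{[0,T]}(0,T;U)$, $a\in L^1(0,T;A)$ there is at most one generalized solution $x(x_0,u,a)$ (uniqueness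 at every point of $[0,T]$). It exists whenever $(x_0,u,a)$ has an approximation at every $\tau\in[0,T]$, and then $y_k\to x(x_0,u,a)$ in $L^1_{\{0,\tau\}}$ for every $\tau$ and every approximation $(w_k,y_k)$ at $\tau$. In particular it exists if $u$ takes its values in a bounded set $V\subseteq U$ which is the closure of a connected open set and the classical solutions of (1) for $(x_0,w,a)$, $w\in C^1([0,T];V)$, are uniformly bounded. Moreover, assertions 1 and 2 hold with $C^1([0,T];U)$ replaced by $L^1_{[0,T]}(0,T;U)$ and classical solutions by generalized solutions: for each $x_0$ and $u$, the map $a\mapsto x(x_0,u,a)$ is continuous, for the $L^1$ norms, on the set of those $a\in L^1(0,T;A)$ for which the solution exists; and in 2 the hypothesis on $K'$ and the estimate concern all triples for which the solution exists. -/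

import Mathlib

open MeasureTheory Set Filter Topology
open scoped NNReal

/-- `E d` is `ℝ^d` with its Euclidean norm. -/
abbrev E (d : ℕ) : Type := EuclideanSpace ℝ (Fin d)

/-- The augmented vector field `g_i = (g̃_i, e_i)` on `ℝ^n × ℝ^m`. -/
noncomputable def augmentedField {n m : ℕ} (g : Fin m → E n → E m → E n) (i : Fin m) :
    E n × E m → E n × E m :=
  fun p => (g i p.1 p.2, EuclideanSpace.single i (1 : ℝ))

/-- The union of the segments `[0, z]`, `z ∈ U`. It equals `U` when `U` is star-shaped about `0`. -/
def starHull {m : ℕ} (U : Set (E m)) : Set (E m) :=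
  {w | ∃ z ∈ U, ∃ s ∈ Icc (0 : ℝ) 1, w = s • z}

/-- Standing assumptions on the drift `f`, the fields `g_i` and the control sets `U`, `A`. -/
structure StandingAssumptions {n m l : ℕ} (f : E n → E m → E l → E n)
    (g : Fin m → E n → E m → E n) (U : Set (E m)) (A : Set (E l)) : Prop where
  /-- `U` is the closure of a connected open set. -/
  control_set : ∃ Ω : Set (E m), IsOpen Ω ∧ IsConnected Ω ∧ U = closure Ω
  compact_A : IsCompact A
  /-- `f(·,·,a)` is locally Lipschitz on `ℝ^n × U`, locally uniformly with respect to `a ∈ A`. -/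
  f_locally_lipschitz : ∀ x : E n, ∀ u ∈ U, ∃ K : ℝ≥0, ∃ s ∈ 𝓝[univ ×ˢ U] ((x, u) : E n × E m),
    ∀ a ∈ A, LipschitzOnWith K (fun p : E n × E m => f p.1 p.2 a) s
  f_continuous : ∀ x : E n, ∀ u ∈ U, ContinuousOn (fun a => f x u a) A
  f_growth : ∃ M : ℝ, 0 < M ∧ ∀ x : E n, ∀ u ∈ U, ∀ a ∈ A, ‖f x u a‖ ≤ M * (1 + ‖(x, u)‖)
  /-- The `g_i` are twice continuously differentiable around each point. -/
  g_smooth : ∀ i, ∀ x : E n, ∀ z ∈ starHull U,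
    ContDiffAt ℝ 2 (fun p : E n × E m => g i p.1 p.2) (x, z)
  g_growth : ∃ M : ℝ, 0 < M ∧ ∀ i, ∀ x : E n, ∀ z ∈ starHull U,
    ‖g i x z‖ ≤ M * (1 + ‖(x, z)‖)
  /-- The augmented fields commute. -/
  g_commute : ∀ i j, ∀ x : E n, ∀ z ∈ starHull U,
    VectorField.lieBracket ℝ (augmentedField g i) (augmentedField g j) (x, z) = 0

/-- `a ∈ L^1(0,T;A)`. -/
def IsL1Control {l : ℕ} (T : ℝ) (A : Set (E l)) (a : ℝ → E l) : Prop :=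
  IntegrableOn a (Icc 0 T) ∧ ∀ᵐ t ∂(volume.restrict (Icc 0 T)), a t ∈ A

/-- `u ∈ C^1([0,T];U)`. -/
def IsC1Control {m : ℕ} (T : ℝ) (U : Set (E m)) (u : ℝ → E m) : Prop :=
  ContDiffOn ℝ 1 u (Icc 0 T) ∧ ∀ t ∈ Icc 0 T, u t ∈ U

/-- `u ∈ L^1_{[0,T]}(0,T;U)`: an integrable map, with values specified at every point of `[0,T]`. -/
def IsPointwiseL1Control {m : ℕ} (T : ℝ) (U : Set (E m)) (u : ℝ → E m) : Prop :=
  IntegrableOn u (Icc 0 T) ∧ ∀ t ∈ Icc 0 T, u t ∈ U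

/-- The right-hand side `f̃(x,u,a) + ∑ g̃_i(x,u) u̇^i` at time `t`. -/
noncomputable def velocity {n m l : ℕ} (T : ℝ) (f : E n → E m → E l → E n)
    (g : Fin m → E n → E m → E n) (u : ℝ → E m) (a : ℝ → E l) (x : ℝ → E n) (t : ℝ) : E n :=
  f (x t) (u t) (a t) + ∑ i, (derivWithin u (Icc 0 T) t) i • g i (x t) (u t)

/-- Carathéodory solution on `[0,T]`, for a control `u` of class `C^1` (so that `z = u`). -/
structure IsClassicalSolution {n m l : ℕ} (T : ℝ) (f : E n → E m → E l → E n)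
    (g : Fin m → E n → E m → E n) (x₀ : E n) (u : ℝ → E m) (a : ℝ → E l) (x : ℝ → E n) :
    Prop where
  continuousOn : ContinuousOn x (Icc 0 T)
  integrable : IntervalIntegrable (velocity T f g u a x) volume 0 T
  integral_eq : ∀ t ∈ Icc 0 T, x t = x₀ + ∫ s in (0 : ℝ)..t, velocity T f g u a x s

/-- Convergence in `L^1_I`: in `L^1(0,T)` and pointwise at every point of `I`. -/
def ConvergesL1On {d : ℕ} (T : ℝ) (I : Set ℝ) (y : ℕ → ℝ → E d) (y' : ℝ → E d) : Prop :=
  Tendsto (fun k => ∫ t in Icc 0 T, ‖y k t - y' t‖) atTop (𝓝 0) ∧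
    ∀ t ∈ I, Tendsto (fun k => y k t) atTop (𝓝 (y' t))

/-- `w k` are `C^1` controls converging to `u` in `L^1_I`, and `y k` are their trajectories; both
sequences have uniformly bounded values. -/
structure IsApproximation {n m l : ℕ} (T : ℝ) (f : E n → E m → E l → E n)
    (g : Fin m → E n → E m → E n) (U : Set (E m)) (I : Set ℝ) (x₀ : E n) (u : ℝ → E m)
    (a : ℝ → E l) (w : ℕ → ℝ → E m) (y : ℕ → ℝ → E n) : Prop where
  control : ∀ k, IsC1Control T U (w k)
  solution : ∀ k, IsClassicalSolution T f g x₀ (w k) a (y k)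
  bounded : ∃ R : ℝ, ∀ k, ∀ t ∈ Icc 0 T, ‖w k t‖ ≤ R ∧ ‖y k t‖ ≤ R
  converges : ConvergesL1On T I w u

/-- `(x, u)` is a generalized solution pointwise defined on `I`. -/
def IsGeneralizedSolutionOn {n m l : ℕ} (T : ℝ) (f : E n → E m → E l → E n)
    (g : Fin m → E n → E m → E n) (U : Set (E m)) (I : Set ℝ) (x₀ : E n) (u : ℝ → E m)
    (a : ℝ → E l) (x : ℝ → E n) : Prop :=
  IntegrableOn x (Icc 0 T) ∧ ∃ (w : ℕ → ℝ → E m) (y : ℕ → ℝ → E n),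
    IsApproximation T f g U I x₀ u a w y ∧ ConvergesL1On T I y x

/-- `(x, u)` is a generalized solution pointwise defined everywhere: the value at each `τ` is
determined through approximations (which may depend on `τ`) that converge at `0` and at `τ`. -/
def IsGeneralizedSolution {n m l : ℕ} (T : ℝ) (f : E n → E m → E l → E n)
    (g : Fin m → E n → E m → E n) (U : Set (E m)) (x₀ : E n) (u : ℝ → E m)
    (a : ℝ → E l) (x : ℝ → E n) : Prop :=
  ∀ τ ∈ Icc 0 T, IsGeneralizedSolutionOn T f g U {0, τ} x₀ u a x

/-- `V` is a bounded part of `U`, the closure of a connected open set, and the trajectories issuing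
from `x₀` for the ordinary control `a` and `C^1` controls with values in `V` are uniformly bounded. -/
def BoundedTrajectories {n m l : ℕ} (T : ℝ) (f : E n → E m → E l → E n)
    (g : Fin m → E n → E m → E n) (U : Set (E m)) (x₀ : E n) (a : ℝ → E l) (V : Set (E m)) :
    Prop :=
  V ⊆ U ∧ Bornology.IsBounded V ∧
    (∃ Ω : Set (E m), IsOpen Ω ∧ IsConnected Ω ∧ V = closure Ω) ∧
    ∃ N : ℝ, ∀ w y, IsC1Control T V w → IsClassicalSolution T f g x₀ w a y →
      ∀ t ∈ Icc 0 T, ‖y t‖ ≤ N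

/-- Uniqueness on `[0,T]` of the trajectories for a notion of solution
`Sol x₀ u a x` and a class `𝒰` of controls. -/
def UniqueTrajectories {n m l : ℕ} (T : ℝ) (A : Set (E l)) (𝒰 : Set (ℝ → E m))
    (Sol : E n → (ℝ → E m) → (ℝ → E l) → (ℝ → E n) → Prop) : Prop :=
  ∀ x₀ : E n, ∀ u ∈ 𝒰, ∀ a, IsL1Control T A a → ∀ x y, Sol x₀ u a x → Sol x₀ u a y →
    EqOn x y (Icc 0 T)

/-- Continuity, from `L^1(0,T;A)` to `L^1(0,T;ℝ^n)`, of the trajectory map `a ↦ x(x₀,u,a)`. -/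
def ContinuousInOrdinaryControl {n m l : ℕ} (T : ℝ) (A : Set (E l)) (𝒰 : Set (ℝ → E m))
    (Sol : E n → (ℝ → E m) → (ℝ → E l) → (ℝ → E n) → Prop) : Prop :=
  ∀ x₀ : E n, ∀ u ∈ 𝒰, ∀ a x, IsL1Control T A a → Sol x₀ u a x →
    ∀ ε > 0, ∃ δ > 0, ∀ b y, IsL1Control T A b → Sol x₀ u b y →
      ∫ t in Icc 0 T, ‖b t - a t‖ < δ → ∫ t in Icc 0 T, ‖y t - x t‖ < ε

/-- The Lipschitz-type estimate: on a uniformly bounded set `𝒲` of controls and for initial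
states in `B_r(0)`, when all trajectories stay in a bounded set `K'`. -/
def LipschitzEstimate {n m l : ℕ} (T : ℝ) (A : Set (E l)) (𝒰 : Set (ℝ → E m))
    (Sol : E n → (ℝ → E m) → (ℝ → E l) → (ℝ → E n) → Prop) : Prop :=
  ∀ r > 0, ∀ 𝒲 ⊆ 𝒰, (∃ R : ℝ, ∀ u ∈ 𝒲, ∀ t ∈ Icc 0 T, ‖u t‖ ≤ R) →
    ∀ K' : Set (E n), Bornology.IsBounded K' →
    (∀ x₀ ∈ Metric.ball (0 : E n) r, ∀ u ∈ 𝒲, ∀ a x, IsL1Control T A a → Sol x₀ u a x →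
      ∀ t ∈ Icc 0 T, x t ∈ K') →
    ∃ M > 0, ∀ x₀ ∈ Metric.ball (0 : E n) r, ∀ x₀' ∈ Metric.ball (0 : E n) r,
      ∀ u ∈ 𝒲, ∀ u' ∈ 𝒲, ∀ a, IsL1Control T A a → ∀ x x', Sol x₀ u a x → Sol x₀' u' a x' →
        ∀ τ ∈ Icc 0 T,
          ‖x τ - x' τ‖ + ∫ t in Icc 0 T, ‖x t - x' t‖ ≤
            M * (‖x₀ - x₀'‖ + ‖u 0 - u' 0‖ + ‖u τ - u' τ‖ + ∫ t in Icc 0 T, ‖u t - u' t‖)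

/-!
The derivative of the impulsive control disappears after a change of the state variable. For a state
`x` and a control value `z`, let `φ(x, z)` be the state reached from `x` when the control moves from
`z` to `0` along a segment and the drift is switched off (`radialCoordinate`). This needs the fields
on the segments `[0, z]` only, whence the star hull of `U` in the assumptions; no convexity of `U`
and no global straightening of the fields is involved.

Since the augmented fields commute, the variation of a radial curve in the direction `(g_j, e_j)` is
known explicitly: it is `1 - s` times the field along the curve, and vanishes at the end
(`hasDerivWithinAt_radial_variation`). Hence `φ` is constant along the fields, and
`D φ(x, z) (v, w) = D_x φ(x, z) (v - ∑ w_i g_i(x, z))`. As `U` may have no regular boundary, this is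
stated as a Taylor estimate with quadratic remainder between arbitrary points of `U`
(`radialCoordinate_estimates`), where it is also recorded that `φ(·, z)` is bi-Lipschitz on bounded
sets. Along a classical solution, `φ(x, u)` is therefore the integral of
`D_x φ(x, u) f(x, u, a)`, in which the derivative of `u` does not occur
(`IsClassicalSolution.radialCoordinate_eq`).

This integrated equation makes sense for discontinuous `x` and `u` (`IsTransformedSolution`), and
Grönwall's inequality for the difference of two radial coordinates bounds `x - x'` at `τ` and in `L^1`
by exactly the quantities in the Lipschitz estimate (`exists_transformed_estimate`). A change
of the ordinary control `a` costs an arbitrarily small constant plus a multiple of the `L^1` distance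
of the controls, because the drift is uniformly continuous in `a` on compact sets. In the continuity
statement only one of the solutions is known to be bounded; an exit-time argument bounds the other
one (`exists_delta_classical`).

For a discontinuous control, the estimate shows that any two approximations have the same asymptotic
behaviour at the points where both sequences of controls converge (`IsApproximation.tendsto_sub`).
Uniqueness, existence and convergence of all approximations follow, and generalized solutions
inherit the integrated equation, hence the estimates. For a control with values in the bounded
closure `V` of a connected open set, approximations are provided by the density of `C^1` controls
with values in `V` (`IsPointwiseL1Control.exists_isC1Control`): a control with finitely many values is
the composition of a smooth curve in the open set with an integer-valued function, and the latter is
mollified, with a correction near the two points where convergence is prescribed.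
-/

/-! ### Ordinary differential equations -/

/-- Grönwall's inequality in integral form. -/
theorem le_mul_exp_of_le_add_integral {T c L : ℝ} (hL : 0 ≤ L) {D : ℝ → ℝ}
    (hD : ContinuousOn D (Icc 0 T)) (hD0 : ∀ t ∈ Icc 0 T, 0 ≤ D t)
    (h : ∀ t ∈ Icc 0 T, D t ≤ c + L * ∫ s in (0 : ℝ)..t, D s) :
    ∀ t ∈ Icc 0 T, D t ≤ c * Real.exp (L * t) := by
  intro t ht
  have hT : 0 ≤ T := ht.1.trans ht.2
  have hc : 0 ≤ c := by
    have h0 := h 0 ⟨le_rfl, hT⟩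
    simp only [intervalIntegral.integral_same, mul_zero, add_zero] at h0
    exact (hD0 0 ⟨le_rfl, hT⟩).trans h0
  have hint : ∀ s ∈ Icc 0 T, 0 ≤ ∫ r in (0 : ℝ)..s, D r := fun s hs =>
    intervalIntegral.integral_nonneg hs.1 fun r hr => hD0 r ⟨hr.1, hr.2.trans hs.2⟩
  have hii : IntervalIntegrable D volume 0 T := hD.intervalIntegrable_of_Icc hT
  have hder : ∀ s ∈ Ico 0 T, HasDerivWithinAt (fun s => c + L * ∫ r in (0 : ℝ)..s, D r)
      (L * D s) (Ici s) s := by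
    intro s hs
    have hs' : s ∈ Icc 0 T := Ico_subset_Icc_self hs
    have := intervalIntegral.integral_hasDerivWithinAt_right (a := 0) (b := s)
      (f := D) (s := Ici s) (t := Ioi s)
      (hii.mono_set (by rw [uIcc_of_le hs.1, uIcc_of_le hT]; exact Icc_subset_Icc_right hs'.2))
      ?_ ?_
    · exact (this.const_mul L).const_add c
    · refine ⟨Ioc s T, Ioc_mem_nhdsGT hs.2, ?_⟩
      exact (hD.mono (fun r hr => ⟨hs.1.trans hr.1.le, hr.2⟩)).aestronglyMeasurable
        measurableSet_Ioc
    · have : ContinuousWithinAt D (Icc s T) s := (hD s hs').mono (Icc_subset_Icc_left hs.1)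
      exact (this.mono_of_mem_nhdsWithin (Icc_mem_nhdsGE hs.2)).mono Ioi_subset_Ici_self
  have hcont : ContinuousOn (fun s => c + L * ∫ r in (0 : ℝ)..s, D r) (Icc 0 T) := by
    have := intervalIntegral.continuousOn_primitive_interval (μ := volume) (f := D)
      (a := 0) (b := T) (by rw [uIcc_of_le hT]; exact hD.integrableOn_Icc)
    rw [uIcc_of_le hT] at this
    exact continuousOn_const.add (continuousOn_const.mul this)
  have key := norm_le_gronwallBound_of_norm_deriv_right_le (δ := c) (K := L) (ε := 0)
    hcont hder (by simp [abs_of_nonneg hc]) (fun s hs => by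
      have hs' : s ∈ Icc 0 T := Ico_subset_Icc_self hs
      rw [add_zero, norm_mul, Real.norm_of_nonneg hL, Real.norm_of_nonneg (hD0 s hs')]
      exact mul_le_mul_of_nonneg_left ((h s hs').trans (le_abs_self _)) hL) t ht
  rw [gronwallBound_ε0, sub_zero] at key
  exact (h t ht).trans ((le_abs_self _).trans key)

/-- Global existence for a Carathéodory differential equation whose right-hand side is Lipschitz in
the state, uniformly in time. The Picard operator is a contraction of the weighted unknown
`t ↦ exp (-(K + 1) t) x(t)`. -/
theorem exists_caratheodory_solution {F : Type*} [NormedAddCommGroup F] [NormedSpace ℝ F]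
    [CompleteSpace F] {T : ℝ} (hT : 0 ≤ T) (K : ℝ≥0) (b : ℝ → F → F)
    (hint : ∀ x : ℝ → F, Continuous x →
      IntervalIntegrable (fun t => b t (x t)) volume 0 T)
    (hlip : ∀ᵐ t, t ∈ Icc 0 T → ∀ x y, ‖b t x - b t y‖ ≤ K * ‖x - y‖) (x₀ : F) :
    ∃ x : ℝ → F, Continuous x ∧ ∀ t ∈ Icc 0 T, x t = x₀ + ∫ s in (0 : ℝ)..t, b s (x s) := by
  set c : ℝ := K + 1 with hc
  have hcpos : 0 < c := by positivity
  let ext : C(Icc (0 : ℝ) T, F) → ℝ → F := fun y s => Real.exp (c * s) • y (projIcc 0 T hT s)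
  have hext : ∀ y, Continuous (ext y) := fun y =>
    (by fun_prop : Continuous fun s : ℝ => Real.exp (c * s)).smul
      (y.continuous.comp continuous_projIcc)
  have hcontI : ∀ y, ContinuousOn (fun t => x₀ + ∫ s in (0 : ℝ)..t, b s (ext y s)) (Icc 0 T) := by
    intro y
    have := intervalIntegral.continuousOn_primitive_interval' (μ := volume)
      (f := fun s => b s (ext y s)) (a := 0) (b₁ := 0) (b₂ := T) (hint _ (hext y)) left_mem_uIcc
    rw [uIcc_of_le hT] at this
    exact continuousOn_const.add this
  let Γ : C(Icc (0 : ℝ) T, F) → C(Icc (0 : ℝ) T, F) := fun y =>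
    ⟨fun t => Real.exp (-(c * t)) • (x₀ + ∫ s in (0 : ℝ)..t, b s (ext y s)),
      (by fun_prop : Continuous fun t : Icc (0 : ℝ) T => Real.exp (-(c * t))).smul
        (hcontI y).domRestrict⟩
  have hΓ : ContractingWith (K / (K + 1)) Γ := by
    refine ⟨(div_lt_one (by positivity)).2 (lt_add_one K), ?_⟩
    refine LipschitzWith.of_dist_le_mul fun y z => ?_
    rw [ContinuousMap.dist_le (by positivity)]
    rintro ⟨t, ht⟩
    have hsub : ∀ y, IntervalIntegrable (fun s => b s (ext y s)) volume 0 t := fun y =>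
      (hint _ (hext y)).mono_set
        (by rw [uIcc_of_le ht.1, uIcc_of_le hT]; exact Icc_subset_Icc_right ht.2)
    have h1 : ‖(∫ s in (0 : ℝ)..t, b s (ext y s)) - ∫ s in (0 : ℝ)..t, b s (ext z s)‖
        ≤ ∫ s in (0 : ℝ)..t, K * dist y z * Real.exp (c * s) := by
      rw [← intervalIntegral.integral_sub (hsub y) (hsub z)]
      refine intervalIntegral.norm_integral_le_of_norm_le ht.1 ?_
        (Continuous.intervalIntegrable (by fun_prop) _ _)
      filter_upwards [hlip] with s hs hs'
      have hsI : s ∈ Icc 0 T := ⟨hs'.1.le, hs'.2.trans ht.2⟩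
      refine (hs hsI _ _).trans ?_
      rw [← smul_sub, norm_smul, Real.norm_of_nonneg (Real.exp_pos _).le]
      have : ‖y (projIcc 0 T hT s) - z (projIcc 0 T hT s)‖ ≤ dist y z := by
        rw [← dist_eq_norm]; exact ContinuousMap.dist_apply_le_dist _
      calc (K : ℝ) * (Real.exp (c * s) * _) ≤ K * (Real.exp (c * s) * dist y z) := by gcongr
        _ = _ := by ring
    have h2 : ∫ s in (0 : ℝ)..t, K * dist y z * Real.exp (c * s)
        = K * dist y z * ((Real.exp (c * t) - 1) / c) := by
      rw [intervalIntegral.integral_const_mul]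
      congr 1
      rw [intervalIntegral.integral_comp_mul_left (fun s => Real.exp s) hcpos.ne']
      simp [integral_exp, div_eq_inv_mul]
    have h3 : dist (Γ y ⟨t, ht⟩) (Γ z ⟨t, ht⟩)
        = Real.exp (-(c * t)) *
          ‖(∫ s in (0 : ℝ)..t, b s (ext y s)) - ∫ s in (0 : ℝ)..t, b s (ext z s)‖ := by
      simp only [Γ, ContinuousMap.coe_mk, dist_eq_norm]
      rw [← smul_sub, norm_smul, Real.norm_of_nonneg (Real.exp_pos _).le, add_sub_add_left_eq_sub]
    rw [h3]
    have h4 : Real.exp (-(c * t)) * Real.exp (c * t) = 1 := by rw [← Real.exp_add]; simp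
    have h5 : 0 ≤ K * dist y z / c := by positivity
    calc Real.exp (-(c * t)) * _
        ≤ Real.exp (-(c * t)) * (K * dist y z * ((Real.exp (c * t) - 1) / c)) := by
          rw [← h2]; gcongr
      _ = K * dist y z / c * (Real.exp (-(c * t)) * Real.exp (c * t) - Real.exp (-(c * t))) := by
          ring
      _ ≤ K * dist y z / c * 1 := by
          gcongr
          rw [h4]
          linarith [Real.exp_pos (-(c * t))]
      _ = ((K / (K + 1) : ℝ≥0) : ℝ) * dist y z := by
          push_cast
          rw [hc]
          ring
  have : Nonempty (Icc (0 : ℝ) T) := ⟨⟨0, le_rfl, hT⟩⟩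
  set y := hΓ.fixedPoint Γ
  have hy : Γ y = y := hΓ.fixedPoint_isFixedPt
  refine ⟨ext y, hext y, fun t ht => ?_⟩
  have h1 : ext y t = Real.exp (c * t) • y ⟨t, ht⟩ := by simp [ext, projIcc_of_mem hT ht]
  rw [h1]
  conv_lhs => rw [← hy]
  simp only [Γ, ContinuousMap.coe_mk]
  rw [smul_smul, ← Real.exp_add]
  simp

/-- Forward solutions, on `[0,1]`, of an autonomous equation with a Lipschitz right-hand side. -/
theorem exists_hasDerivAt_of_lipschitz {F : Type*} [NormedAddCommGroup F] [NormedSpace ℝ F]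
    [CompleteSpace F] (K : ℝ≥0) (b : ℝ → F → F) (hb : Continuous (Function.uncurry b))
    (hlip : ∀ t, LipschitzWith K (b t)) (x₀ : F) :
    ∃ x : ℝ → F, Continuous x ∧ x 0 = x₀ ∧
      ∀ t ∈ Icc (0 : ℝ) 1, HasDerivWithinAt x (b t (x t)) (Icc 0 1) t := by
  obtain ⟨x, hx, hx'⟩ := exists_caratheodory_solution (T := 1) zero_le_one K b
    (fun x hx => (hb.comp (continuous_id.prodMk hx)).intervalIntegrable _ _)
    (Eventually.of_forall fun t _ x y => by
      simpa [dist_eq_norm] using (hlip t).dist_le_mul x y) x₀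
  have hc : Continuous fun t => b t (x t) := hb.comp (continuous_id.prodMk hx)
  refine ⟨x, hx, by simpa using hx' 0 ⟨le_rfl, zero_le_one⟩, fun t ht => ?_⟩
  have h1 : HasDerivWithinAt (fun t => x₀ + ∫ s in (0 : ℝ)..t, b s (x s)) (b t (x t))
      (Icc 0 1) t :=
    ((intervalIntegral.integral_hasDerivAt_right (hc.intervalIntegrable _ _)
      hc.stronglyMeasurable.stronglyMeasurableAtFilter hc.continuousAt).const_add
        x₀).hasDerivWithinAt
  exact h1.congr hx' (hx' t ht)

/-- Grönwall's inequality on `[0,1]` with a time-independent bound. -/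
theorem norm_le_of_norm_hasDerivWithinAt_le {F : Type*} [NormedAddCommGroup F] [NormedSpace ℝ F]
    {K ε : ℝ} (hK : 0 ≤ K) (hε : 0 ≤ ε) {x x' : ℝ → F}
    (hx : ∀ t ∈ Icc (0 : ℝ) 1, HasDerivWithinAt x (x' t) (Icc 0 1) t)
    (hb : ∀ t ∈ Icc (0 : ℝ) 1, ‖x' t‖ ≤ K * ‖x t‖ + ε) :
    ∀ t ∈ Icc (0 : ℝ) 1, ‖x t‖ ≤ (‖x 0‖ + ε) * Real.exp (K + 1) := by
  intro t ht
  have key := norm_le_gronwallBound_of_norm_deriv_right_le (f := x) (f' := x') (δ := ‖x 0‖)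
    (K := K + 1) (ε := ε) (a := 0) (b := 1) (fun s hs => (hx s hs).continuousWithinAt)
    (fun s hs => (hx s (Ico_subset_Icc_self hs)).mono_of_mem_nhdsWithin
      (Filter.mem_of_superset (Icc_mem_nhdsGE hs.2) (Icc_subset_Icc_left hs.1)))
    le_rfl (fun s hs => (hb s (Ico_subset_Icc_self hs)).trans
      (by nlinarith [norm_nonneg (x s)])) t ht
  refine key.trans ?_
  rw [gronwallBound_of_K_ne_0 (by positivity), sub_zero]
  have h1 : Real.exp ((K + 1) * t) ≤ Real.exp (K + 1) :=
    Real.exp_le_exp.2 (by nlinarith [ht.2])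
  have h2 : ε / (K + 1) ≤ ε := div_le_self hε (by linarith)
  have h3 : 1 ≤ Real.exp ((K + 1) * t) := Real.one_le_exp (by nlinarith [ht.1])
  calc ‖x 0‖ * Real.exp ((K + 1) * t) + ε / (K + 1) * (Real.exp ((K + 1) * t) - 1)
      ≤ ‖x 0‖ * Real.exp (K + 1) + ε * Real.exp (K + 1) := by
        gcongr
        linarith
    _ = _ := by ring

/-- The reversal of time on `[0,1]`. -/
theorem hasDerivWithinAt_comp_one_sub {F : Type*} [NormedAddCommGroup F] [NormedSpace ℝ F]
    {x x' : ℝ → F} (hx : ∀ t ∈ Icc (0 : ℝ) 1, HasDerivWithinAt x (x' t) (Icc 0 1) t) :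
    ∀ t ∈ Icc (0 : ℝ) 1, HasDerivWithinAt (fun s => x (1 - s)) (-x' (1 - t)) (Icc 0 1) t := by
  intro t ht
  have h1 : HasDerivWithinAt (fun s : ℝ => 1 - s) (-1) (Icc 0 1) t := by
    simpa using ((hasDerivAt_id t).const_sub 1).hasDerivWithinAt
  have h2 := (hx (1 - t) ⟨by linarith [ht.2], by linarith [ht.1]⟩).scomp t h1
    (fun s hs => ⟨by linarith [hs.2], by linarith [hs.1]⟩)
  rw [neg_one_smul] at h2
  exact h2

/-- Quadratic Taylor estimate for a map with Lipschitz derivative. -/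
theorem norm_sub_sub_le_sq {F : Type*} [NormedAddCommGroup F] [NormedSpace ℝ F]
    {L : ℝ≥0} {V : F → F} {V' : F → F →L[ℝ] F} (hV : ∀ p, HasFDerivAt V (V' p) p)
    (hL : LipschitzWith L V') (p q : F) : ‖V q - V p - V' p (q - p)‖ ≤ L * ‖q - p‖ ^ 2 := by
  have := (convex_segment p q).norm_image_sub_le_of_norm_hasFDerivWithin_le' (f := V) (f' := V')
    (φ := V' p) (C := L * ‖q - p‖) (fun x _ => (hV x).hasFDerivWithinAt) (fun x hx => by
      refine (by simpa [dist_eq_norm] using hL.dist_le_mul x p :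
        ‖V' x - V' p‖ ≤ L * ‖x - p‖).trans ?_
      gcongr
      obtain ⟨a, b, ha, hb, hab, rfl⟩ := hx
      have : a • p + b • q - p = b • (q - p) := by
        rw [show a = 1 - b by linarith]; module
      rw [this, norm_smul, Real.norm_of_nonneg hb]
      exact mul_le_of_le_one_left (norm_nonneg _) (by linarith))
    (left_mem_segment ℝ p q) (right_mem_segment ℝ p q)
  simpa [sq, mul_assoc] using this

/-- A vector field whose derivative is bounded and Lipschitz has a flow on `[0,1]`; its time-one map
is bi-Lipschitz, and differentiable with a Lipschitz derivative, given by the solution `W` of the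
linearized equation. -/
theorem exists_flow {F : Type*} [NormedAddCommGroup F] [NormedSpace ℝ F] [CompleteSpace F]
    {K L : ℝ≥0} {V : F → F} {V' : F → F →L[ℝ] F} (hV : ∀ p, HasFDerivAt V (V' p) p)
    (hK : ∀ p, ‖V' p‖ ≤ K) (hL : LipschitzWith L V') :
    ∃ (X : F → ℝ → F) (W : F → ℝ → F →L[ℝ] F) (C : ℝ),
      (∀ p, X p 0 = p ∧ ∀ t ∈ Icc (0 : ℝ) 1, HasDerivWithinAt (X p) (V (X p t)) (Icc 0 1) t) ∧
      (∀ p, W p 0 = ContinuousLinearMap.id ℝ F ∧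
        ∀ t ∈ Icc (0 : ℝ) 1, HasDerivWithinAt (W p) (V' (X p t) ∘L W p t) (Icc 0 1) t) ∧
      (∀ p, ‖W p 1‖ ≤ C) ∧
      (∀ p q, ‖X q 1 - X p 1‖ ≤ C * ‖q - p‖) ∧
      (∀ p q, ‖q - p‖ ≤ C * ‖X q 1 - X p 1‖) ∧
      (∀ p q, ‖W q 1 - W p 1‖ ≤ C * ‖q - p‖) ∧
      ∀ p q, ‖X q 1 - X p 1 - W p 1 (q - p)‖ ≤ C * ‖q - p‖ ^ 2 := by
  have hVlip : ∀ p q, ‖V q - V p‖ ≤ K * ‖q - p‖ := fun p q =>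
    convex_univ.norm_image_sub_le_of_norm_hasFDerivWithin_le
      (fun x _ => (hV x).hasFDerivWithinAt) (fun x _ => hK x) (mem_univ p) (mem_univ q)
  have hVl : LipschitzWith K V := LipschitzWith.of_dist_le_mul fun p q => by
    simpa [dist_eq_norm] using hVlip q p
  have hV'lip : ∀ p q, ‖V' q - V' p‖ ≤ L * ‖q - p‖ := fun p q => by
    simpa [dist_eq_norm] using hL.dist_le_mul q p
  choose X hXc hX0 hX using fun p => exists_hasDerivAt_of_lipschitz K (fun _ => V)
    (hVl.continuous.comp continuous_snd) (fun _ => hVl) p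
  have hWex : ∀ p, ∃ W : ℝ → F →L[ℝ] F, Continuous W ∧ W 0 = ContinuousLinearMap.id ℝ F ∧
      ∀ t ∈ Icc (0 : ℝ) 1, HasDerivWithinAt W (V' (X p t) ∘L W t) (Icc 0 1) t := fun p =>
    exists_hasDerivAt_of_lipschitz K (fun t Z => V' (X p t) ∘L Z)
      (by
        have : Continuous fun q : ℝ × (F →L[ℝ] F) => V' (X p q.1) :=
          hL.continuous.comp ((hXc p).comp continuous_fst)
        exact this.clm_comp continuous_snd)
      (fun t => LipschitzWith.of_dist_le_mul fun Z Z' => by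
        rw [dist_eq_norm, dist_eq_norm, ← ContinuousLinearMap.comp_sub]
        exact (ContinuousLinearMap.opNorm_comp_le _ _).trans
          (mul_le_mul_of_nonneg_right (hK _) (norm_nonneg _))) _
  choose W hWc hW0 hW using hWex
  set e := Real.exp (K + 1) with he
  have he0 : 1 ≤ e := Real.one_le_exp (by positivity)
  have h1mem : (1 : ℝ) ∈ Icc (0 : ℝ) 1 := ⟨zero_le_one, le_rfl⟩
  -- forward Lipschitz dependence
  have hXX : ∀ p q, ∀ t ∈ Icc (0 : ℝ) 1, ‖X q t - X p t‖ ≤ ‖q - p‖ * e := by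
    intro p q t ht
    have := norm_le_of_norm_hasDerivWithinAt_le (K := K) (ε := 0) K.2 le_rfl
      (x := fun t => X q t - X p t) (fun t ht => (hX q t ht).sub (hX p t ht))
      (fun t _ => by simpa using hVlip (X p t) (X q t)) t ht
    simpa [hX0] using this
  have hWb : ∀ p, ∀ t ∈ Icc (0 : ℝ) 1, ‖W p t‖ ≤ e := by
    intro p t ht
    have := norm_le_of_norm_hasDerivWithinAt_le (K := K) (ε := 0) K.2 le_rfl (hW p)
      (fun t _ => by
        rw [add_zero]
        exact (ContinuousLinearMap.opNorm_comp_le _ _).trans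
          (mul_le_mul_of_nonneg_right (hK _) (norm_nonneg _))) t ht
    rw [hW0, add_zero] at this
    exact this.trans (mul_le_of_le_one_left (by positivity) ContinuousLinearMap.norm_id_le)
  refine ⟨X, W, e + L * e ^ 3, fun p => ⟨hX0 p, hX p⟩, fun p => ⟨hW0 p, hW p⟩, fun p => ?_,
    fun p q => ?_, fun p q => ?_, fun p q => ?_, fun p q => ?_⟩
  · exact (hWb p 1 h1mem).trans (le_add_of_nonneg_right (by positivity))
  · refine (hXX p q 1 h1mem).trans ?_
    rw [mul_comm]
    gcongr
    exact le_add_of_nonneg_right (by positivity)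
  · have := norm_le_of_norm_hasDerivWithinAt_le (K := K) (ε := 0) K.2 le_rfl
      (hasDerivWithinAt_comp_one_sub (x := fun t => X q t - X p t)
        (fun t ht => (hX q t ht).sub (hX p t ht)))
      (fun t _ => by simpa [norm_sub_rev] using hVlip (X p (1 - t)) (X q (1 - t))) 1 h1mem
    simp only [sub_self, hX0, sub_zero, add_zero] at this
    refine this.trans ?_
    rw [mul_comm]
    gcongr
    exact le_add_of_nonneg_right (by positivity)
  · have := norm_le_of_norm_hasDerivWithinAt_le (K := K) (ε := L * (‖q - p‖ * e) * e) K.2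
      (by positivity) (x := fun t => W q t - W p t) (fun t ht => (hW q t ht).sub (hW p t ht))
      (fun t ht => by
        have : V' (X q t) ∘L W q t - V' (X p t) ∘L W p t
            = V' (X q t) ∘L (W q t - W p t) + (V' (X q t) - V' (X p t)) ∘L W p t := by
          rw [ContinuousLinearMap.comp_sub, ContinuousLinearMap.sub_comp]; abel
        rw [this]
        refine (norm_add_le _ _).trans (add_le_add ?_ ?_)
        · exact (ContinuousLinearMap.opNorm_comp_le _ _).trans
            (mul_le_mul_of_nonneg_right (hK _) (norm_nonneg _))
        · refine (ContinuousLinearMap.opNorm_comp_le _ _).trans ?_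
          have h1 := (hV'lip (X p t) (X q t)).trans
            (mul_le_mul_of_nonneg_left (hXX p q t ht) L.2)
          exact mul_le_mul h1 (hWb p t ht) (norm_nonneg _) (by positivity)) 1 h1mem
    simp only [hW0, sub_self, norm_zero, zero_add] at this
    refine this.trans ?_
    rw [← he]
    nlinarith [norm_nonneg (q - p)]
  · have := norm_le_of_norm_hasDerivWithinAt_le (K := K) (ε := L * (‖q - p‖ * e) ^ 2) K.2
      (by positivity) (x := fun t => X q t - X p t - W p t (q - p))
      (fun t ht => ((hX q t ht).sub (hX p t ht)).sub
        ((hW p t ht).clm_apply (hasDerivWithinAt_const t _ (q - p))))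
      (fun t ht => by
        have : V (X q t) - V (X p t) - ((V' (X p t) ∘L W p t) (q - p) + W p t 0)
            = V' (X p t) (X q t - X p t - W p t (q - p))
              + (V (X q t) - V (X p t) - V' (X p t) (X q t - X p t)) := by
          simp only [ContinuousLinearMap.comp_apply, map_sub, map_zero]; abel
        rw [this]
        refine (norm_add_le _ _).trans (add_le_add ?_ ?_)
        · exact ((V' (X p t)).le_opNorm _).trans
            (mul_le_mul_of_nonneg_right (hK _) (norm_nonneg _))
        · refine (norm_sub_sub_le_sq hV hL _ _).trans ?_
          gcongr
          exact hXX p q t ht) 1 h1mem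
    simp only [hX0, hW0, ContinuousLinearMap.id_apply, sub_self, norm_zero, zero_add] at this
    refine this.trans ?_
    rw [← he]
    nlinarith [mul_nonneg (sq_nonneg ‖q - p‖) (zero_le_one.trans he0)]

/-! ### The radial coordinate -/

/-- The autonomous form of the radial system. A point `(y, v, z)` consists of a state `y`, a control
`v` moving from `z` to `0` along the segment `[0,z]`, and the fixed end point `z`. -/
noncomputable def radialField {n m : ℕ} (g : Fin m → E n → E m → E n) :
    E n × E m × E m → E n × E m × E m :=
  fun p => (-∑ i, p.2.2 i • g i p.1 p.2.1, -p.2.2, 0)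

/-- `Γ` is the integral curve of the radial field on `[0,1]` issuing from `(x, z, z)`. -/
def IsRadialCurve {n m : ℕ} (g : Fin m → E n → E m → E n) (x : E n) (z : E m)
    (Γ : ℝ → E n × E m × E m) : Prop :=
  Γ 0 = (x, z, z) ∧ ∀ s ∈ Icc (0 : ℝ) 1, HasDerivWithinAt Γ (radialField g (Γ s)) (Icc 0 1) s

open Classical in
/-- The radial coordinate of `(x, z)`: the state reached from `x` when the control moves from `z` to
`0` along a segment and the drift is switched off. -/
noncomputable def radialCoordinate {n m : ℕ} (g : Fin m → E n → E m → E n) (x : E n) (z : E m) :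
    E n :=
  if h : ∃ Γ, IsRadialCurve g x z Γ then (h.choose 1).1 else 0

/-- The control components of a curve along which the control moves with velocity `-z`. -/
theorem snd_eq_of_hasDerivWithinAt {n m : ℕ} {x : E n} {z : E m} {Γ : ℝ → E n × E m × E m}
    {w : ℝ → E n} (h0 : Γ 0 = (x, z, z))
    (hΓ : ∀ s ∈ Icc (0 : ℝ) 1, HasDerivWithinAt Γ (w s, -(Γ s).2.2, 0) (Icc 0 1) s) :
    ∀ s ∈ Icc (0 : ℝ) 1, (Γ s).2 = ((1 - s) • z, z) := by
  intro s hs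
  have hd : ∀ s ∈ Icc (0 : ℝ) 1, HasDerivWithinAt (fun s => (Γ s).2 - ((1 - s) • z, z))
      ((-(Γ s).2.2, 0) - (-z, 0)) (Icc 0 1) s := by
    intro s hs
    have h1 : HasDerivWithinAt (fun s => (Γ s).2) (-(Γ s).2.2, 0) (Icc 0 1) s :=
      (hasFDerivAt_snd (p := Γ s)).comp_hasDerivWithinAt s (hΓ s hs)
    have h2 : HasDerivAt (fun s : ℝ => (1 - s) • z) (-z) s := by
      simpa using ((hasDerivAt_id s).const_sub 1).smul_const z
    exact h1.sub (h2.hasDerivWithinAt.prodMk (hasDerivWithinAt_const s _ z))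
  have := norm_le_of_norm_hasDerivWithinAt_le (K := 1) (ε := 0) zero_le_one le_rfl hd
    (fun t _ => by
      have h1 : ((-(Γ t).2.2, 0) - (-z, 0) : E m × E m) = (-((Γ t).2.2 - z), 0) := by
        ext <;> simp; ring
      have h2 : ‖(Γ t).2.2 - z‖ ≤ ‖(Γ t).2 - ((1 - t) • z, z)‖ :=
        norm_snd_le ((Γ t).2 - ((1 - t) • z, z))
      rw [h1, Prod.norm_mk, norm_neg, norm_zero, max_eq_left (norm_nonneg _)]
      linarith) s hs
  simp only [h0, sub_zero, one_smul, sub_self, norm_zero, zero_add, zero_mul] at this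
  exact sub_eq_zero.1 (norm_le_zero_iff.1 this)

/-- Linear growth of the radial system, for end points in a bounded set of controls. -/
theorem norm_sum_smul_le {n m : ℕ} {U : Set (E m)} {g : Fin m → E n → E m → E n} {M R : ℝ}
    (hM : 0 < M) (hg : ∀ i, ∀ x : E n, ∀ z ∈ starHull U, ‖g i x z‖ ≤ M * (1 + ‖(x, z)‖))
    {z : E m} (hz : z ∈ U) (hzR : ‖z‖ ≤ R) {s : ℝ} (hs : s ∈ Icc (0 : ℝ) 1) (y : E n) :
    ‖∑ i, z i • g i y ((1 - s) • z)‖ ≤ m * R * M * ‖y‖ + m * R * M * (1 + R) := by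
  have hs' : 1 - s ∈ Icc (0 : ℝ) 1 := ⟨by linarith [hs.2], by linarith [hs.1]⟩
  have hv : ‖(1 - s) • z‖ ≤ R := by
    rw [norm_smul, Real.norm_of_nonneg hs'.1]
    exact (mul_le_of_le_one_left (norm_nonneg _) hs'.2).trans hzR
  have hR : 0 ≤ R := (norm_nonneg _).trans hzR
  calc ‖∑ i, z i • g i y ((1 - s) • z)‖ ≤ ∑ i : Fin m, R * (M * (1 + (‖y‖ + R))) := by
        refine norm_sum_le_of_le _ fun i _ => ?_
        rw [norm_smul]
        refine mul_le_mul ((PiLp.norm_apply_le z i).trans hzR)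
          ((hg i y _ ⟨z, hz, 1 - s, hs', rfl⟩).trans ?_) (norm_nonneg _) hR
        have : ‖(y, (1 - s) • z)‖ ≤ ‖y‖ + R := by
          rw [Prod.norm_mk]
          exact max_le (by linarith) (by linarith [norm_nonneg y])
        gcongr
    _ = _ := by simp; ring

/-- The a priori bound for states along radial curves whose data are bounded by `R`. -/
noncomputable def radialBound (m : ℕ) (M R : ℝ) : ℝ :=
  (R + m * R * M * (1 + R)) * Real.exp (m * R * M + 1)

/-- The compact set that contains the radial curves with data bounded by `R`. -/
def radialTube {m : ℕ} (n : ℕ) (U : Set (E m)) (M R : ℝ) : Set (E n × E m × E m) :=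
  Metric.closedBall 0 (radialBound m M R) ×ˢ
    ((fun q : ℝ × E m => ((1 - q.1) • q.2, q.2)) '' (Icc 0 1 ×ˢ (U ∩ Metric.closedBall 0 R)))

theorem isCompact_radialTube {m n : ℕ} {U : Set (E m)} (hU : IsClosed U) (M R : ℝ) :
    IsCompact (radialTube n U M R) :=
  (isCompact_closedBall _ _).prod ((isCompact_Icc.prod
    ((isCompact_closedBall _ _).inter_left hU)).image (by fun_prop))

/-- A curve driven by a damped radial field stays in the tube. -/
theorem mem_radialTube {n m : ℕ} {U : Set (E m)} {g : Fin m → E n → E m → E n} {M R : ℝ}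
    (hM : 0 < M) (hg : ∀ i, ∀ x : E n, ∀ z ∈ starHull U, ‖g i x z‖ ≤ M * (1 + ‖(x, z)‖))
    {x : E n} {z : E m} (hx : ‖x‖ ≤ R) (hz : z ∈ U) (hzR : ‖z‖ ≤ R)
    {Γ : ℝ → E n × E m × E m} {c : ℝ → ℝ} (hc : ∀ s, |c s| ≤ 1) (h0 : Γ 0 = (x, z, z))
    (hΓ : ∀ s ∈ Icc (0 : ℝ) 1, HasDerivWithinAt Γ
      (c s • (-∑ i, (Γ s).2.2 i • g i (Γ s).1 (Γ s).2.1), -(Γ s).2.2, 0) (Icc 0 1) s) :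
    ∀ s ∈ Icc (0 : ℝ) 1, Γ s ∈ radialTube n U M R := by
  intro s hs
  have hR : 0 ≤ R := (norm_nonneg _).trans hx
  have h2 := snd_eq_of_hasDerivWithinAt h0 hΓ
  have hb := norm_le_of_norm_hasDerivWithinAt_le (K := m * R * M) (ε := m * R * M * (1 + R))
    (by positivity) (by positivity) (x := fun s => (Γ s).1)
    (fun s hs => (hasFDerivAt_fst (p := Γ s)).comp_hasDerivWithinAt s (hΓ s hs))
    (fun s hs => by
      simp only [ContinuousLinearMap.coe_fst', h2 s hs]
      rw [norm_smul, norm_neg]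
      refine (mul_le_of_le_one_left (norm_nonneg _) (hc s)).trans ?_
      exact norm_sum_smul_le hM hg hz hzR hs _) s hs
  refine ⟨?_, (s, z), ⟨hs, hz, by simpa using hzR⟩, (h2 s hs).symm⟩
  rw [mem_closedBall_zero_iff]
  refine hb.trans ?_
  rw [h0, radialBound]
  gcongr

/-- Where the fields are differentiable, the derivative of the radial field. -/
theorem hasFDerivAt_radialField {n m : ℕ} {g : Fin m → E n → E m → E n}
    {p : E n × E m × E m}
    (hg : ∀ i, DifferentiableAt ℝ (fun q : E n × E m => g i q.1 q.2) (p.1, p.2.1)) :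
    ∃ V' : (E n × E m × E m) →L[ℝ] (E n × E m × E m), HasFDerivAt (radialField g) V' p ∧
      ∀ a b c, V' (a, b, c) = (-∑ i, (p.2.2 i •
        fderiv ℝ (fun q : E n × E m => g i q.1 q.2) (p.1, p.2.1) (a, b) +
          c i • g i p.1 p.2.1), -c, 0) := by
  have hz : HasFDerivAt (fun p : E n × E m × E m => p.2.2)
      ((ContinuousLinearMap.snd ℝ (E m) (E m)).comp (ContinuousLinearMap.snd ℝ (E n) _)) p :=
    ((ContinuousLinearMap.snd ℝ (E m) (E m)).comp
      (ContinuousLinearMap.snd ℝ (E n) _)).hasFDerivAt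
  have hzi : ∀ i, HasFDerivAt (fun p : E n × E m × E m => p.2.2 i)
      ((EuclideanSpace.proj (𝕜 := ℝ) i).comp ((ContinuousLinearMap.snd ℝ (E m) (E m)).comp
        (ContinuousLinearMap.snd ℝ (E n) _))) p := fun i =>
    ContinuousLinearMap.hasFDerivAt ((EuclideanSpace.proj (𝕜 := ℝ) i).comp
      ((ContinuousLinearMap.snd ℝ (E m) (E m)).comp (ContinuousLinearMap.snd ℝ (E n) _)))
  have hq : HasFDerivAt (fun p : E n × E m × E m => (p.1, p.2.1))
      ((ContinuousLinearMap.fst ℝ (E n) (E m × E m)).prod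
        ((ContinuousLinearMap.fst ℝ (E m) (E m)).comp (ContinuousLinearMap.snd ℝ (E n) _))) p :=
    ((ContinuousLinearMap.fst ℝ (E n) (E m × E m)).prod
      ((ContinuousLinearMap.fst ℝ (E m) (E m)).comp
        (ContinuousLinearMap.snd ℝ (E n) _))).hasFDerivAt
  have hgi := fun i => (hg i).hasFDerivAt.comp p hq
  refine ⟨_, (HasFDerivAt.fun_sum (u := Finset.univ)
    fun i _ => (hzi i).smul (hgi i)).neg.prodMk (hz.neg.prodMk (hasFDerivAt_const 0 p)), ?_⟩
  intro a b c
  simp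

/-- Commutation of the augmented fields, written for the unaugmented ones. -/
theorem fderiv_apply_comm {n m : ℕ} {g : Fin m → E n → E m → E n} {x : E n} {z : E m}
    (hg : ∀ i, DifferentiableAt ℝ (fun q : E n × E m => g i q.1 q.2) (x, z))
    {i j : Fin m}
    (h : VectorField.lieBracket ℝ (augmentedField g i) (augmentedField g j) (x, z) = 0) :
    fderiv ℝ (fun q : E n × E m => g j q.1 q.2) (x, z) (g i x z, EuclideanSpace.single i 1)
      = fderiv ℝ (fun q : E n × E m => g i q.1 q.2) (x, z)
        (g j x z, EuclideanSpace.single j 1) := by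
  have hd : ∀ i, fderiv ℝ (augmentedField g i) (x, z)
      = (fderiv ℝ (fun q : E n × E m => g i q.1 q.2) (x, z)).prod 0 := fun i =>
    ((hg i).hasFDerivAt.prodMk (hasFDerivAt_const _ _)).fderiv
  rw [VectorField.lieBracket_eq] at h
  have h1 := congrArg Prod.fst h
  simp only [hd] at h1
  simpa [augmentedField, sub_eq_zero] using h1

/-- The variation of a radial curve in the direction `(g_j, e_j, e_j)`: since the fields commute, it
solves the linearized equation, and its state component vanishes at time one. -/
theorem hasDerivWithinAt_radial_variation {n m : ℕ} {U : Set (E m)}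
    {g : Fin m → E n → E m → E n} {x : E n} {z : E m} (hz : z ∈ U)
    (hg : ∀ i, ∀ x : E n, ∀ z ∈ starHull U,
      DifferentiableAt ℝ (fun q : E n × E m => g i q.1 q.2) (x, z))
    (hcomm : ∀ i j, ∀ x : E n, ∀ z ∈ starHull U,
      VectorField.lieBracket ℝ (augmentedField g i) (augmentedField g j) (x, z) = 0)
    {Γ : ℝ → E n × E m × E m} (hΓ : IsRadialCurve g x z Γ)
    {V' : ℝ → (E n × E m × E m) →L[ℝ] (E n × E m × E m)}
    (hV' : ∀ s ∈ Icc (0 : ℝ) 1, HasFDerivAt (radialField g) (V' s) (Γ s)) (j : Fin m) :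
    ∀ s ∈ Icc (0 : ℝ) 1, HasDerivWithinAt
      (fun s => (((1 - s) • g j (Γ s).1 (Γ s).2.1, (1 - s) • EuclideanSpace.single j 1,
        EuclideanSpace.single j 1) : E n × E m × E m))
      (V' s ((1 - s) • g j (Γ s).1 (Γ s).2.1, (1 - s) • EuclideanSpace.single j 1,
        EuclideanSpace.single j 1)) (Icc 0 1) s := by
  intro s hs
  have h2 := snd_eq_of_hasDerivWithinAt hΓ.1 hΓ.2 s hs
  have hmem : (Γ s).2.1 ∈ starHull U := by
    rw [h2]; exact ⟨z, hz, 1 - s, ⟨by linarith [hs.2], by linarith [hs.1]⟩, rfl⟩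
  have hzz : (Γ s).2.2 = z := by rw [h2]
  have hdiff := fun i => hg i (Γ s).1 _ hmem
  obtain ⟨W, hW, hWe⟩ := hasFDerivAt_radialField hdiff
  rw [(hV' s hs).unique hW, hWe]
  have hΓs := hΓ.2 s hs
  have hpair : HasDerivWithinAt (fun s => ((Γ s).1, (Γ s).2.1))
      (-∑ i, (Γ s).2.2 i • g i (Γ s).1 (Γ s).2.1, -(Γ s).2.2) (Icc 0 1) s :=
    ((ContinuousLinearMap.fst ℝ (E n) (E m × E m)).prod
        ((ContinuousLinearMap.fst ℝ (E m) (E m)).comp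
          (ContinuousLinearMap.snd ℝ (E n) _))).hasFDerivAt.comp_hasDerivWithinAt s hΓs
  have hgj := (hdiff j).hasFDerivAt.comp_hasDerivWithinAt
    (f := fun s => ((Γ s).1, (Γ s).2.1)) s hpair
  have hs1 : HasDerivWithinAt (fun s : ℝ => 1 - s) (-1) (Icc 0 1) s := by
    simpa using ((hasDerivAt_id s).const_sub 1).hasDerivWithinAt
  have key := (hs1.smul hgj).prodMk
    ((hs1.smul_const (EuclideanSpace.single j (1 : ℝ) : E m)).prodMk
      (hasDerivWithinAt_const s (Icc (0 : ℝ) 1) (EuclideanSpace.single j (1 : ℝ) : E m)))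
  refine key.congr_deriv ?_
  have hsum : ((-∑ i, (Γ s).2.2 i • g i (Γ s).1 (Γ s).2.1, -(Γ s).2.2) : E n × E m)
      = -∑ i, (Γ s).2.2 i • (g i (Γ s).1 (Γ s).2.1, EuclideanSpace.single i (1 : ℝ)) := by
    refine Prod.ext ?_ ?_
    · simp [Prod.fst_sum]
    · have := (EuclideanSpace.basisFun (Fin m) ℝ).sum_repr (Γ s).2.2
      simp only [EuclideanSpace.basisFun_repr, EuclideanSpace.basisFun_apply] at this
      simp [Prod.snd_sum, this]
  refine Prod.ext ?_ (Prod.ext (by simp) rfl)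
  have e1 : ((1 - s) • g j (Γ s).1 (Γ s).2.1, (1 - s) • EuclideanSpace.single j (1 : ℝ))
      = (1 - s) • ((g j (Γ s).1 (Γ s).2.1, EuclideanSpace.single j (1 : ℝ)) : E n × E m) := rfl
  simp only [hsum, e1, map_neg, map_sum, map_smul, Finset.sum_add_distrib]
  have e2 : ∀ i, fderiv ℝ (fun q : E n × E m => g j q.1 q.2) ((Γ s).1, (Γ s).2.1)
      (g i (Γ s).1 (Γ s).2.1, EuclideanSpace.single i 1) = _ :=
    fun i => fderiv_apply_comm hdiff (hcomm i j (Γ s).1 _ hmem)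
  simp only [e2]
  have e3 : ∑ i, (EuclideanSpace.single j (1 : ℝ) : E m) i • g i (Γ s).1 (Γ s).2.1
      = g j (Γ s).1 (Γ s).2.1 := by
    rw [Finset.sum_eq_single j] <;> simp +contextual
  simp only [e3, smul_comm _ (1 - s), ← Finset.smul_sum, Function.comp_apply]
  module

/-- Damping the radial field away from a compact set `S` on which the fields are of class `C^2` gives
a field with bounded and Lipschitz derivative. Only the state component is damped, so that the
control still moves along a segment. -/
theorem exists_damped_radialField {n m : ℕ} {g : Fin m → E n → E m → E n}
    {S : Set (E n × E m × E m)} (hS : IsCompact S)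
    (hg : ∀ p ∈ S, ∀ i, ContDiffAt ℝ 2 (fun q : E n × E m => g i q.1 q.2) (p.1, p.2.1)) :
    ∃ (c : E n × E m × E m → ℝ) (V : E n × E m × E m → E n × E m × E m)
      (V' : E n × E m × E m → (E n × E m × E m) →L[ℝ] (E n × E m × E m)) (K L : ℝ≥0),
      (∀ p, |c p| ≤ 1) ∧
      (∀ p, V p = (c p • (-∑ i, p.2.2 i • g i p.1 p.2.1), -p.2.2, 0)) ∧
      (∀ p ∈ S, ∀ᶠ q in 𝓝 p, V q = radialField g q) ∧
      (∀ p, HasFDerivAt V (V' p) p) ∧ (∀ p, ‖V' p‖ ≤ K) ∧ LipschitzWith L V' := by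
  set O : Set (E n × E m × E m) :=
    {p | ∀ i, ContDiffAt ℝ 2 (fun q : E n × E m => g i q.1 q.2) (p.1, p.2.1)} with hO
  have hOo : IsOpen O := by
    rw [isOpen_iff_mem_nhds]
    intro p hp
    have hcont : Continuous fun p : E n × E m × E m => (p.1, p.2.1) := by fun_prop
    exact (eventually_all.2 fun i => hcont.continuousAt.eventually ((hp i).eventually (by simp)))
  obtain ⟨Q, hQ, hSQ, hQO⟩ := exists_compact_between hS hOo hg
  obtain ⟨c, hc1, hc0, hc01⟩ := exists_contMDiffMap_one_nhds_of_subset_interior (n := 2)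
    (modelWithCornersSelf ℝ (E n × E m × E m)) hS.isClosed hSQ
  have hcs : ContDiff ℝ 2 c := contMDiff_iff_contDiff.1 c.contMDiff
  set N : E n × E m × E m → E n := fun p => -∑ i, p.2.2 i • g i p.1 p.2.1 with hN
  set B : E n × E m × E m → E n := fun p => c p • N p with hB
  have hBsupp : HasCompactSupport B := HasCompactSupport.intro hQ fun p hp => by
    simp [hB, hc0 p hp]
  have hBs : ContDiff ℝ 2 B := by
    rw [contDiff_iff_contDiffAt]
    intro p
    by_cases hp : p ∈ Q
    · have hpO := hQO hp
      refine hcs.contDiffAt.smul (ContDiffAt.neg (ContDiffAt.sum fun i _ =>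
        ContDiffAt.smul (f := fun p : E n × E m × E m => p.2.2 i)
          (g := fun p : E n × E m × E m => g i p.1 p.2.1) ?_ ?_))
      · exact ((EuclideanSpace.proj (𝕜 := ℝ) i).comp ((ContinuousLinearMap.snd ℝ (E m) (E m)).comp
          (ContinuousLinearMap.snd ℝ (E n) _))).contDiff.contDiffAt
      · exact (hpO i).comp p ((ContinuousLinearMap.fst ℝ (E n) (E m × E m)).prod
          ((ContinuousLinearMap.fst ℝ (E m) (E m)).comp
            (ContinuousLinearMap.snd ℝ (E n) _))).contDiff.contDiffAt
    · refine (contDiffAt_const (c := (0 : E n))).congr_of_eventuallyEq ?_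
      filter_upwards [hQ.isClosed.isOpen_compl.mem_nhds hp] with q hq
      simp [hB, hc0 q hq]
  obtain ⟨K, hK⟩ := (hBsupp.fderiv ℝ).exists_bound_of_continuous
    (hBs.continuous_fderiv (by simp))
  obtain ⟨L, hL⟩ := ContDiff.lipschitzWith_of_hasCompactSupport (𝕂 := ℝ) (n := 1)
    (hBsupp.fderiv ℝ) (hBs.fderiv_right (by norm_num [one_add_one_eq_two])) (by simp)
  let A : (E n × E m × E m) →L[ℝ] (E m × E m) :=
    (-((ContinuousLinearMap.snd ℝ (E m) (E m)).comp (ContinuousLinearMap.snd ℝ (E n) _))).prod 0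
  refine ⟨c, fun p => (B p, A p), fun p => (fderiv ℝ B p).prod A, (K + ‖A‖).toNNReal, L,
    fun p => ?_, fun p => ?_, fun p hp => ?_, fun p => ?_, fun p => ?_, ?_⟩
  · rw [abs_of_nonneg (hc01 p).1]; exact (hc01 p).2
  · simp [hB, hN, A]
  · filter_upwards [Filter.Eventually.filter_mono (nhds_le_nhdsSet hp) hc1] with q hq
    simp [hB, hN, A, radialField, hq]
  · exact ((hBs.differentiable (by simp)) p).hasFDerivAt.prodMk A.hasFDerivAt
  · rw [Real.coe_toNNReal _ (add_nonneg ((norm_nonneg _).trans (hK p)) (norm_nonneg _)),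
      ContinuousLinearMap.opNorm_prod]
    exact max_le ((hK p).trans (by simp)) (le_add_of_nonneg_left ((norm_nonneg _).trans (hK p)))
  · refine LipschitzWith.of_dist_le_mul fun p q => ?_
    have : (fderiv ℝ B p).prod A - (fderiv ℝ B q).prod A
        = (fderiv ℝ B p - fderiv ℝ B q).prod 0 := by
      ext v <;> simp
    rw [dist_eq_norm, this, ContinuousLinearMap.opNorm_prod, Prod.norm_mk]
    simpa [dist_eq_norm] using hL.dist_le_mul p q

/-- The radial coordinate on a bounded set of data, before its derivative is identified. -/
theorem exists_radialCoordinate_estimates {n m l : ℕ} {f : E n → E m → E l → E n}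
    {g : Fin m → E n → E m → E n} {U : Set (E m)} {A : Set (E l)}
    (h : StandingAssumptions f g U A) (R : ℝ) :
    ∃ (P : E n → E m → E n →L[ℝ] E n) (C : ℝ), 0 ≤ C ∧ ∀ x y, ∀ z ∈ U, ∀ z' ∈ U,
      ‖x‖ ≤ R → ‖y‖ ≤ R → ‖z‖ ≤ R → ‖z'‖ ≤ R →
      ‖P x z‖ ≤ C ∧ ‖P y z' - P x z‖ ≤ C * (‖y - x‖ + ‖z' - z‖) ∧
      ‖radialCoordinate g y z' - radialCoordinate g x z‖ ≤ C * (‖y - x‖ + ‖z' - z‖) ∧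
      ‖y - x‖ ≤ C * (‖radialCoordinate g y z' - radialCoordinate g x z‖ + ‖z' - z‖) ∧
      ‖radialCoordinate g y z' - radialCoordinate g x z
        - P x z (y - x - ∑ i, (z' - z) i • g i x z)‖ ≤ C * (‖y - x‖ + ‖z' - z‖) ^ 2 := by
  obtain ⟨M, hM, hgM⟩ := h.g_growth
  have hUc : IsClosed U := by
    obtain ⟨Ω, -, -, rfl⟩ := h.control_set
    exact isClosed_closure
  have htube : ∀ p ∈ radialTube n U M R, p.2.1 ∈ starHull U := by
    rintro ⟨y, v, z⟩ ⟨-, ⟨s, z'⟩, ⟨hs, hz', -⟩, hsz⟩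
    simp only [Prod.mk.injEq] at hsz
    exact ⟨z', hz', 1 - s, ⟨by linarith [hs.2], by linarith [hs.1]⟩, hsz.1.symm⟩
  obtain ⟨c, V, V', K, L, hc, hVeq, hVrad, hV, hK, hL⟩ := exists_damped_radialField (g := g)
    (isCompact_radialTube (n := n) hUc M R) (fun p hp i => h.g_smooth i _ _ (htube p hp))
  have hdiff : ∀ i, ∀ x : E n, ∀ z ∈ starHull U,
      DifferentiableAt ℝ (fun q : E n × E m => g i q.1 q.2) (x, z) := fun i x z hz =>
    (h.g_smooth i x z hz).differentiableAt (by simp)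
  obtain ⟨X, W, C, hX, hW, hWb, hXf, hXb, hWl, hXq⟩ := exists_flow hV hK hL
  have h1mem : (1 : ℝ) ∈ Icc (0 : ℝ) 1 := ⟨zero_le_one, le_rfl⟩
  have hC0 : 0 ≤ C := (norm_nonneg _).trans (hWb 0)
  have hVlip : LipschitzWith K V := lipschitzWith_of_nnnorm_fderiv_le (𝕜 := ℝ)
    (fun p => (hV p).differentiableAt) (fun p => by rw [(hV p).fderiv]; exact_mod_cast hK p)
  -- the damped flow and the radial curves coincide
  have hmem : ∀ x, ∀ z ∈ U, ‖x‖ ≤ R → ‖z‖ ≤ R → ∀ s ∈ Icc (0 : ℝ) 1,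
      X (x, z, z) s ∈ radialTube n U M R := fun x z hz hx hzR =>
    mem_radialTube hM hgM hx hz hzR (c := fun s => c (X (x, z, z) s)) (fun s => hc _) (hX _).1
      (fun s hs => by simpa only [hVeq] using (hX (x, z, z)).2 s hs)
  have hrad : ∀ x, ∀ z ∈ U, ‖x‖ ≤ R → ‖z‖ ≤ R → IsRadialCurve g x z (X (x, z, z)) :=
    fun x z hz hx hzR => ⟨(hX _).1, fun s hs => by
      rw [← (hVrad _ (hmem x z hz hx hzR s hs)).self_of_nhds]
      exact (hX _).2 s hs⟩
  have huniq : ∀ x, ∀ z ∈ U, ‖x‖ ≤ R → ‖z‖ ≤ R → ∀ Γ, IsRadialCurve g x z Γ →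
      Γ 1 = X (x, z, z) 1 := by
    intro x z hz hx hzR Γ hΓ
    have hΓmem := mem_radialTube hM hgM hx hz hzR (c := fun _ => 1) (fun s => by simp) hΓ.1
      (fun s hs => by simpa only [one_smul, radialField] using hΓ.2 s hs)
    have hr : ∀ {Y : ℝ → E n × E m × E m} {Y' : E n × E m × E m} {s : ℝ}, s ∈ Ico (0 : ℝ) 1 →
        HasDerivWithinAt Y Y' (Icc 0 1) s → HasDerivWithinAt Y Y' (Ici s) s := fun hs hY =>
      hY.mono_of_mem_nhdsWithin
        (Filter.mem_of_superset (Icc_mem_nhdsGE hs.2) (Icc_subset_Icc_left hs.1))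
    refine ODE_solution_unique_of_mem_Icc_right (v := fun _ => V) (s := fun _ => univ) (K := K)
      (fun _ _ => hVlip.lipschitzOnWith) (fun s hs => (hΓ.2 s hs).continuousWithinAt)
      (fun s hs => ?_) (fun _ _ => mem_univ _)
      (fun s hs => ((hX (x, z, z)).2 s hs).continuousWithinAt)
      (fun s hs => hr hs ((hX _).2 s (Ico_subset_Icc_self hs))) (fun _ _ => mem_univ _)
      (by rw [hΓ.1, (hX _).1]) h1mem
    have hs' := Ico_subset_Icc_self hs
    rw [(hVrad _ (hΓmem s hs')).self_of_nhds]
    exact hr hs (hΓ.2 s hs')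
  have hφ : ∀ x, ∀ z ∈ U, ‖x‖ ≤ R → ‖z‖ ≤ R →
      X (x, z, z) 1 = (radialCoordinate g x z, 0, z) := by
    intro x z hz hx hzR
    have hr := hrad x z hz hx hzR
    have hex : ∃ Γ, IsRadialCurve g x z Γ := ⟨_, hr⟩
    have h2 := snd_eq_of_hasDerivWithinAt hr.1 hr.2 1 h1mem
    simp only [sub_self, zero_smul] at h2
    rw [radialCoordinate, dif_pos hex, huniq x z hz hx hzR _ hex.choose_spec, ← h2]
  -- the commutation of the fields
  have hcomm : ∀ x, ∀ z ∈ U, ‖x‖ ≤ R → ‖z‖ ≤ R → ∀ j,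
      (W (x, z, z) 1 (g j x z, EuclideanSpace.single j 1, EuclideanSpace.single j 1)).1 = 0 := by
    intro x z hz hx hzR j
    have hr := hrad x z hz hx hzR
    have hvar := hasDerivWithinAt_radial_variation hz hdiff h.g_commute hr
      (V' := fun s => V' (X (x, z, z) s)) (fun s hs => (hV _).congr_of_eventuallyEq
        ((hVrad _ (hmem x z hz hx hzR s hs)).mono fun q hq => hq.symm)) j
    set H : ℝ → E n × E m × E m := fun s => ((1 - s) • g j (X (x, z, z) s).1 (X (x, z, z) s).2.1,
      (1 - s) • EuclideanSpace.single j 1, EuclideanSpace.single j 1) with hH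
    have hH0 : H 0 = (g j x z, EuclideanSpace.single j 1, EuclideanSpace.single j 1) := by
      simp [hH, (hX _).1]
    have := norm_le_of_norm_hasDerivWithinAt_le (K := K) (ε := 0) K.2 le_rfl
      (x := fun s => W (x, z, z) s (H 0) - H s)
      (fun s hs => (((hW (x, z, z)).2 s hs).clm_apply (hasDerivWithinAt_const s _ (H 0))).sub
        (hvar s hs))
      (fun s _ => by
        simp only [map_zero, add_zero, ContinuousLinearMap.comp_apply, ← map_sub]
        exact ((V' _).le_opNorm _).trans (mul_le_mul_of_nonneg_right (hK _) (norm_nonneg _)))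
      1 h1mem
    simp only [(hW _).1, ContinuousLinearMap.id_apply, sub_self, norm_zero, zero_add,
      zero_mul] at this
    have h1 := sub_eq_zero.1 (norm_le_zero_iff.1 this)
    rw [← hH0, h1]
    simp [hH]
  have hnorm : ∀ (x y : E n) (z z' : E m),
      ‖((y, z', z') : E n × E m × E m) - (x, z, z)‖ ≤ ‖y - x‖ + ‖z' - z‖ := by
    intro x y z z'
    simp only [Prod.mk_sub_mk, Prod.norm_mk, max_self]
    exact max_le (by simp) (by simp)
  let P : E n → E m → E n →L[ℝ] E n := fun x z =>
    (ContinuousLinearMap.fst ℝ (E n) (E m × E m)).comp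
      ((W (x, z, z) 1).comp (ContinuousLinearMap.inl ℝ (E n) (E m × E m)))
  have hPn : ∀ D : (E n × E m × E m) →L[ℝ] (E n × E m × E m),
      ‖(ContinuousLinearMap.fst ℝ (E n) (E m × E m)).comp
        (D.comp (ContinuousLinearMap.inl ℝ (E n) (E m × E m)))‖ ≤ ‖D‖ := fun D =>
    ContinuousLinearMap.opNorm_le_bound _ (norm_nonneg _) fun v => by
      refine (norm_fst_le _).trans ((D.le_opNorm _).trans ?_)
      simp [Prod.norm_mk]
  refine ⟨P, C, hC0, fun x y z hz z' hz' hx hy hzR hzR' => ⟨(hPn _).trans (hWb _), ?_, ?_, ?_, ?_⟩⟩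
  · have : P y z' - P x z = (ContinuousLinearMap.fst ℝ (E n) (E m × E m)).comp
        ((W (y, z', z') 1 - W (x, z, z) 1).comp
          (ContinuousLinearMap.inl ℝ (E n) (E m × E m))) := by
      ext v; simp [P]
    rw [this]
    exact (hPn _).trans ((hWl _ _).trans (mul_le_mul_of_nonneg_left (hnorm ..) hC0))
  · have h1 := hXf (x, z, z) (y, z', z')
    rw [hφ x z hz hx hzR, hφ y z' hz' hy hzR'] at h1
    exact (norm_fst_le _).trans (h1.trans (mul_le_mul_of_nonneg_left (hnorm ..) hC0))
  · have h1 := hXb (x, z, z) (y, z', z')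
    rw [hφ x z hz hx hzR, hφ y z' hz' hy hzR'] at h1
    refine (norm_fst_le (((y, z', z') : E n × E m × E m) - (x, z, z))).trans
      (h1.trans (mul_le_mul_of_nonneg_left ?_ hC0))
    simp only [Prod.mk_sub_mk, Prod.norm_mk, sub_self, norm_zero]
    exact max_le (by simp) (max_le (by positivity) (by simp))
  · have h1 := hXq (x, z, z) (y, z', z')
    rw [hφ x z hz hx hzR, hφ y z' hz' hy hzR'] at h1
    have h2 : ((y, z', z') : E n × E m × E m) - (x, z, z)
        = (y - x - ∑ i, (z' - z) i • g i x z, 0, 0) + ∑ i, (z' - z) i •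
          (g i x z, EuclideanSpace.single i 1, EuclideanSpace.single i 1) := by
      have h3 := (EuclideanSpace.basisFun (Fin m) ℝ).sum_repr (z' - z)
      simp only [EuclideanSpace.basisFun_repr, EuclideanSpace.basisFun_apply] at h3
      refine Prod.ext ?_ (Prod.ext ?_ ?_)
      · simp [Prod.fst_sum]
      · simpa [Prod.fst_sum, Prod.snd_sum] using h3.symm
      · simpa [Prod.snd_sum] using h3.symm
    have h4 : (W (x, z, z) 1 (((y, z', z') : E n × E m × E m) - (x, z, z))).1
        = P x z (y - x - ∑ i, (z' - z) i • g i x z) := by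
      rw [h2, map_add, map_sum]
      simp only [map_smul, Prod.fst_add, Prod.fst_sum, Prod.smul_fst, hcomm x z hz hx hzR,
        smul_zero, Finset.sum_const_zero, add_zero]
      rfl
    rw [← h4]
    refine (norm_fst_le (((radialCoordinate g y z', (0 : E m), z') : E n × E m × E m)
      - (radialCoordinate g x z, 0, z)
      - W (x, z, z) 1 (((y, z', z') : E n × E m × E m) - (x, z, z)))).trans (h1.trans ?_)
    have := hnorm x y z z'
    gcongr

/-- The derivative of the radial coordinate in the state. -/
noncomputable def radialDeriv {n m : ℕ} (g : Fin m → E n → E m → E n) (x : E n) (z : E m) :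
    E n →L[ℝ] E n :=
  fderiv ℝ (fun y => radialCoordinate g y z) x

/-- The properties of the radial coordinate `φ` on bounded sets. The last one says that `φ` is
differentiable and constant along the commuting fields: the derivative of `φ` at `(x, z)` maps
`(v, w)` to `D_x φ (v - ∑ w_i g_i)`. -/
theorem radialCoordinate_estimates {n m l : ℕ} {f : E n → E m → E l → E n}
    {g : Fin m → E n → E m → E n} {U : Set (E m)} {A : Set (E l)}
    (h : StandingAssumptions f g U A) (R : ℝ) :
    ∃ C : ℝ, 0 ≤ C ∧ ∀ x y, ∀ z ∈ U, ∀ z' ∈ U,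
      ‖x‖ ≤ R → ‖y‖ ≤ R → ‖z‖ ≤ R → ‖z'‖ ≤ R →
      ‖radialDeriv g x z‖ ≤ C ∧
      ‖radialDeriv g y z' - radialDeriv g x z‖ ≤ C * (‖y - x‖ + ‖z' - z‖) ∧
      ‖radialCoordinate g y z' - radialCoordinate g x z‖ ≤ C * (‖y - x‖ + ‖z' - z‖) ∧
      ‖y - x‖ ≤ C * (‖radialCoordinate g y z' - radialCoordinate g x z‖ + ‖z' - z‖) ∧
      ‖radialCoordinate g y z' - radialCoordinate g x z
        - radialDeriv g x z (y - x - ∑ i, (z' - z) i • g i x z)‖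
          ≤ C * (‖y - x‖ + ‖z' - z‖) ^ 2 := by
  obtain ⟨P, C, hC, hP⟩ := exists_radialCoordinate_estimates h (R + 1)
  have hPd : ∀ x, ∀ z ∈ U, ‖x‖ ≤ R → ‖z‖ ≤ R → radialDeriv g x z = P x z := by
    intro x z hz hx hzR
    refine HasFDerivAt.fderiv (HasFDerivAt.of_isLittleO ?_)
    have hO : (fun y => radialCoordinate g y z - radialCoordinate g x z - P x z (y - x))
        =O[𝓝 x] fun y => ‖y - x‖ ^ 2 := by
      refine Asymptotics.IsBigO.of_bound C ?_
      filter_upwards [Metric.ball_mem_nhds x one_pos] with y hy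
      rw [mem_ball_iff_norm] at hy
      have hyR : ‖y‖ ≤ R + 1 := by
        have := norm_add_le x (y - x)
        rw [add_sub_cancel] at this
        linarith
      have := (hP x y z hz z hz (by linarith) hyR (by linarith) (by linarith)).2.2.2.2
      simpa using this
    refine hO.trans_isLittleO ?_
    have := (Asymptotics.isLittleO_norm_pow_id (E' := E n) one_lt_two).comp_tendsto
      (show Tendsto (fun y => y - x) (𝓝 x) (𝓝 0) by
        have : ContinuousAt (fun y => y - x) x := by fun_prop
        simpa [ContinuousAt] using this)
    exact this
  refine ⟨C, hC, fun x y z hz z' hz' hx hy hzR hzR' => ?_⟩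
  rw [hPd x z hz hx hzR, hPd y z' hz' hy hzR']
  exact hP x y z hz z' hz' (by linarith) (by linarith) (by linarith) (by linarith)

/-! ### The drift in radial coordinates -/

theorem StandingAssumptions.isClosed {n m l : ℕ} {f : E n → E m → E l → E n}
    {g : Fin m → E n → E m → E n} {U : Set (E m)} {A : Set (E l)}
    (h : StandingAssumptions f g U A) : IsClosed U := by
  obtain ⟨Ω, -, -, rfl⟩ := h.control_set
  exact isClosed_closure

theorem subset_starHull {m : ℕ} (U : Set (E m)) : U ⊆ starHull U := fun z hz =>
  ⟨z, hz, 1, ⟨zero_le_one, le_rfl⟩, (one_smul ℝ z).symm⟩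

/-- On bounded sets the drift is bounded and Lipschitz, uniformly in the ordinary control: it is a
locally Lipschitz map with values in the continuous functions on `A`. -/
theorem StandingAssumptions.drift_lipschitz {n m l : ℕ} {f : E n → E m → E l → E n}
    {g : Fin m → E n → E m → E n} {U : Set (E m)} {A : Set (E l)}
    (h : StandingAssumptions f g U A) (R : ℝ) :
    ∃ L : ℝ, 0 ≤ L ∧ ∀ x y, ∀ z ∈ U, ∀ z' ∈ U, ∀ a ∈ A,
      ‖x‖ ≤ R → ‖y‖ ≤ R → ‖z‖ ≤ R → ‖z'‖ ≤ R →
      ‖f x z a‖ ≤ L ∧ ‖f y z' a - f x z a‖ ≤ L * (‖y - x‖ + ‖z' - z‖) := by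
  classical
  have : CompactSpace A := isCompact_iff_compactSpace.1 h.compact_A
  let F : E n × E m → C(A, E n) := fun p =>
    if hp : p.2 ∈ U then ⟨fun a => f p.1 p.2 a, (h.f_continuous p.1 p.2 hp).domRestrict⟩ else 0
  set S : Set (E n × E m) := Metric.closedBall 0 R ×ˢ (U ∩ Metric.closedBall 0 R) with hS
  have hSc : IsCompact S :=
    (isCompact_closedBall _ _).prod ((isCompact_closedBall _ _).inter_left h.isClosed)
  have hF : LocallyLipschitzOn S F := by
    rintro ⟨x, z⟩ ⟨-, hz, -⟩
    obtain ⟨K, s, hs, hK⟩ := h.f_locally_lipschitz x z hz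
    refine ⟨K, s ∩ S, inter_mem (nhdsWithin_mono _ ?_ hs) self_mem_nhdsWithin, ?_⟩
    · exact fun p hp => ⟨mem_univ _, hp.2.1⟩
    · refine LipschitzOnWith.of_dist_le_mul fun p hp q hq => ?_
      rw [ContinuousMap.dist_le (by positivity)]
      intro a
      simp only [F, dif_pos hp.2.2.1, dif_pos hq.2.2.1]
      exact (hK a a.2).dist_le_mul p hp.1 q hq.1
  obtain ⟨K, hK⟩ := hF.exists_lipschitzOnWith_of_compact hSc
  obtain ⟨M, hM, hfM⟩ := h.f_growth
  refine ⟨max K (M * (1 + |R|)), le_max_of_le_left K.2, fun x y z hz z' hz' a ha hx hy hzR hzR' =>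
    ⟨?_, ?_⟩⟩
  · refine (hfM x z hz a ha).trans (le_max_of_le_right ?_)
    have : ‖(x, z)‖ ≤ |R| := by
      rw [Prod.norm_mk]
      exact max_le (hx.trans (le_abs_self _)) (hzR.trans (le_abs_self _))
    gcongr
  · have h1 := hK.dist_le_mul (y, z') ⟨by simpa using hy, hz', by simpa using hzR'⟩
      (x, z) ⟨by simpa using hx, hz, by simpa using hzR⟩
    have h2 : dist (f y z' a) (f x z a) ≤ dist (F (y, z')) (F (x, z)) := by
      have := ContinuousMap.dist_apply_le_dist (f := F (y, z')) (g := F (x, z)) ⟨a, ha⟩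
      simp only [F, dif_pos hz, dif_pos hz'] at this ⊢
      exact this
    rw [← dist_eq_norm]
    refine (h2.trans h1).trans ?_
    rw [dist_eq_norm, Prod.mk_sub_mk, Prod.norm_mk]
    refine mul_le_mul (le_max_left _ _) (max_le ?_ ?_) (by positivity)
      (le_max_of_le_left K.2) <;> simp

/-- The drift expressed in the radial coordinate, as a function of the original variables. -/
noncomputable def transformedDrift {n m l : ℕ} (f : E n → E m → E l → E n)
    (g : Fin m → E n → E m → E n) (x : E n) (z : E m) (a : E l) : E n :=
  radialDeriv g x z (f x z a)

theorem StandingAssumptions.transformedDrift_lipschitz {n m l : ℕ} {f : E n → E m → E l → E n}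
    {g : Fin m → E n → E m → E n} {U : Set (E m)} {A : Set (E l)}
    (h : StandingAssumptions f g U A) (R : ℝ) :
    ∃ L : ℝ, 0 ≤ L ∧ ∀ x y, ∀ z ∈ U, ∀ z' ∈ U, ∀ a ∈ A,
      ‖x‖ ≤ R → ‖y‖ ≤ R → ‖z‖ ≤ R → ‖z'‖ ≤ R →
      ‖transformedDrift f g x z a‖ ≤ L ∧
      ‖transformedDrift f g y z' a - transformedDrift f g x z a‖
        ≤ L * (‖y - x‖ + ‖z' - z‖) := by
  obtain ⟨L, hL, hf⟩ := h.drift_lipschitz R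
  obtain ⟨C, hC, hφ⟩ := radialCoordinate_estimates h R
  refine ⟨2 * (C * L), by positivity, fun x y z hz z' hz' a ha hx hy hzR hzR' => ⟨?_, ?_⟩⟩
  · have h1 := (hφ x y z hz z' hz' hx hy hzR hzR').1
    have h2 := (hf x y z hz z' hz' a ha hx hy hzR hzR').1
    refine (ContinuousLinearMap.le_of_opNorm_le_of_le _ h1 h2).trans ?_
    linarith [mul_nonneg hC hL]
  · have e : transformedDrift f g y z' a - transformedDrift f g x z a
        = radialDeriv g y z' (f y z' a - f x z a)
          + (radialDeriv g y z' - radialDeriv g x z) (f x z a) := by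
      simp [transformedDrift]
    have h1 := ContinuousLinearMap.le_of_opNorm_le_of_le _
      (hφ y y z' hz' z' hz' hy hy hzR' hzR').1 (hf x y z hz z' hz' a ha hx hy hzR hzR').2
    have h2 := ContinuousLinearMap.le_of_opNorm_le_of_le _
      (hφ x y z hz z' hz' hx hy hzR hzR').2.1 (hf x y z hz z' hz' a ha hx hy hzR hzR').1
    rw [e]
    refine (norm_add_le _ _).trans ((add_le_add h1 h2).trans (le_of_eq (by ring)))

/-- A map that is Lipschitz in `(x, z)` on bounded sets, uniformly in `a`, and continuous in `a`, is
continuous. -/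
theorem continuousOn_of_lipschitz_of_continuousOn {n m l : ℕ} {F : E n → E m → E l → E n}
    {U : Set (E m)} {A : Set (E l)}
    (hF : ∀ R : ℝ, ∃ L : ℝ, 0 ≤ L ∧ ∀ x y, ∀ z ∈ U, ∀ z' ∈ U, ∀ a ∈ A,
      ‖x‖ ≤ R → ‖y‖ ≤ R → ‖z‖ ≤ R → ‖z'‖ ≤ R →
      ‖F x z a‖ ≤ L ∧ ‖F y z' a - F x z a‖ ≤ L * (‖y - x‖ + ‖z' - z‖))
    (hFa : ∀ x, ∀ z ∈ U, ContinuousOn (fun a => F x z a) A) :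
    ContinuousOn (fun p : E n × E m × E l => F p.1 p.2.1 p.2.2) (univ ×ˢ U ×ˢ A) := by
  rintro ⟨x, z, a⟩ ⟨-, hz, ha⟩
  obtain ⟨L, hL, hb⟩ := hF (max ‖x‖ ‖z‖ + 1)
  have hc : ContinuousWithinAt (fun p : E n × E m × E l => F x z p.2.2) (univ ×ˢ U ×ˢ A)
      (x, z, a) := (hFa x z hz a ha).comp (f := fun p : E n × E m × E l => p.2.2)
        (by fun_prop) (fun p hp => hp.2.2)
  have h0 : Tendsto (fun p : E n × E m × E l =>
      L * (‖p.1 - x‖ + ‖p.2.1 - z‖) + ‖F x z p.2.2 - F x z a‖)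
      (𝓝[univ ×ˢ U ×ˢ A] (x, z, a)) (𝓝 0) := by
    have h1 : ContinuousWithinAt (fun p : E n × E m × E l => L * (‖p.1 - x‖ + ‖p.2.1 - z‖))
      (univ ×ˢ U ×ˢ A) (x, z, a) := Continuous.continuousWithinAt (by fun_prop)
    have h2 : ContinuousWithinAt (fun p : E n × E m × E l =>
        L * (‖p.1 - x‖ + ‖p.2.1 - z‖) + ‖F x z p.2.2 - F x z a‖) (univ ×ˢ U ×ˢ A) (x, z, a) :=
      h1.add (hc.sub continuousWithinAt_const).norm
    simpa [ContinuousWithinAt] using h2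
  refine tendsto_iff_norm_sub_tendsto_zero.2 (squeeze_zero' (Eventually.of_forall fun _ =>
    norm_nonneg _) ?_ h0)
  have hnear : ∀ᶠ p : E n × E m × E l in 𝓝[univ ×ˢ U ×ˢ A] (x, z, a),
      ‖p.1‖ < ‖x‖ + 1 ∧ ‖p.2.1‖ < ‖z‖ + 1 := by
    refine nhdsWithin_le_nhds (Filter.Eventually.and ?_ ?_)
    · exact (show Continuous fun p : E n × E m × E l => ‖p.1‖ by fun_prop).continuousAt.eventually
        (gt_mem_nhds (by simp))
    · exact (show Continuous fun p : E n × E m × E l => ‖p.2.1‖ by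
        fun_prop).continuousAt.eventually (gt_mem_nhds (by simp))
  filter_upwards [hnear, self_mem_nhdsWithin] with p hp hpm
  have hlx := le_max_left ‖x‖ ‖z‖
  have hlz := le_max_right ‖x‖ ‖z‖
  have := (hb x p.1 z hz p.2.1 hpm.2.1 p.2.2 hpm.2.2 (by linarith) (by linarith) (by linarith)
    (by linarith)).2
  calc ‖F p.1 p.2.1 p.2.2 - F x z a‖
      = ‖(F p.1 p.2.1 p.2.2 - F x z p.2.2) + (F x z p.2.2 - F x z a)‖ := by congr 1; abel
    _ ≤ _ := (norm_add_le _ _).trans (by gcongr)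

theorem StandingAssumptions.continuousOn_drift {n m l : ℕ} {f : E n → E m → E l → E n}
    {g : Fin m → E n → E m → E n} {U : Set (E m)} {A : Set (E l)}
    (h : StandingAssumptions f g U A) :
    ContinuousOn (fun p : E n × E m × E l => f p.1 p.2.1 p.2.2) (univ ×ˢ U ×ˢ A) :=
  continuousOn_of_lipschitz_of_continuousOn h.drift_lipschitz h.f_continuous

theorem StandingAssumptions.continuousOn_transformedDrift {n m l : ℕ}
    {f : E n → E m → E l → E n} {g : Fin m → E n → E m → E n} {U : Set (E m)} {A : Set (E l)}
    (h : StandingAssumptions f g U A) :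
    ContinuousOn (fun p : E n × E m × E l => transformedDrift f g p.1 p.2.1 p.2.2)
      (univ ×ˢ U ×ˢ A) :=
  continuousOn_of_lipschitz_of_continuousOn h.transformedDrift_lipschitz fun x z hz =>
    (radialDeriv g x z).continuous.comp_continuousOn (h.f_continuous x z hz)

/-- Uniform continuity in the ordinary control, in a form that can be integrated against `L^1`
controls. -/
theorem StandingAssumptions.transformedDrift_sub_le {n m l : ℕ}
    {f : E n → E m → E l → E n} {g : Fin m → E n → E m → E n} {U : Set (E m)} {A : Set (E l)}
    (h : StandingAssumptions f g U A) (R : ℝ) {η : ℝ} (hη : 0 < η) :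
    ∃ C : ℝ, 0 ≤ C ∧ ∀ x, ∀ z ∈ U, ‖x‖ ≤ R → ‖z‖ ≤ R → ∀ a ∈ A, ∀ b ∈ A,
      ‖transformedDrift f g x z b - transformedDrift f g x z a‖ ≤ η + C * ‖b - a‖ := by
  obtain ⟨L, hL, hb⟩ := h.transformedDrift_lipschitz R
  set S : Set (E n × E m × E l) :=
    Metric.closedBall 0 R ×ˢ (U ∩ Metric.closedBall 0 R) ×ˢ A with hS
  have hSc : IsCompact S := (isCompact_closedBall _ _).prod
    (((isCompact_closedBall _ _).inter_left h.isClosed).prod h.compact_A)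
  have huc := hSc.uniformContinuousOn_of_continuous
    (h.continuousOn_transformedDrift.mono fun p hp => ⟨mem_univ _, hp.2.1.1, hp.2.2⟩)
  obtain ⟨δ, hδ, hδ'⟩ := Metric.uniformContinuousOn_iff.1 huc η hη
  refine ⟨2 * L / δ, by positivity, fun x z hz hx hzR a ha b hb' => ?_⟩
  rcases lt_or_ge ‖b - a‖ δ with hlt | hge
  · have := hδ' (x, z, b) ⟨by simpa using hx, ⟨hz, by simpa using hzR⟩, hb'⟩
      (x, z, a) ⟨by simpa using hx, ⟨hz, by simpa using hzR⟩, ha⟩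
      (by simpa [Prod.dist_eq, hδ, dist_eq_norm] using hlt)
    rw [dist_eq_norm] at this
    exact this.le.trans (le_add_of_nonneg_right (by positivity))
  · have h1 := (hb x x z hz z hz a ha hx hx hzR hzR).1
    have h2 := (hb x x z hz z hz b hb' hx hx hzR hzR).1
    have h3 : 2 * L ≤ 2 * L / δ * ‖b - a‖ := by
      rw [div_mul_eq_mul_div, le_div_iff₀ hδ]
      gcongr
    linarith [norm_sub_le (transformedDrift f g x z b) (transformedDrift f g x z a)]

/-- Composition of a map that is continuous on a closed set with a measurable curve in that set. -/
theorem ContinuousOn.aestronglyMeasurable_comp_of_isClosed {α X Y : Type*} [MeasurableSpace α]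
    [TopologicalSpace X] [MeasurableSpace X] [BorelSpace X]
    [NormedAddCommGroup Y] [MeasurableSpace Y] [BorelSpace Y] [SecondCountableTopology Y]
    {μ : Measure α} {F : X → Y} {S : Set X} (hF : ContinuousOn F S) (hS : IsClosed S)
    {q : α → X} (hq : AEMeasurable q μ) (hqS : ∀ᵐ t ∂μ, q t ∈ S) :
    AEStronglyMeasurable (fun t => F (q t)) μ := by
  classical
  have hm : Measurable (S.piecewise F fun _ => 0) :=
    hF.measurable_piecewise continuousOn_const hS.measurableSet
  refine ((hm.comp_aemeasurable hq).congr ?_).aestronglyMeasurable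
  filter_upwards [hqS] with t ht
  simp [Set.piecewise, ht]

/-! ### Trajectories in radial coordinates -/

/-- A map whose increments are quadratically small is constant. -/
theorem eq_of_norm_sub_le_sq {F : Type*} [NormedAddCommGroup F] [NormedSpace ℝ F] {T C : ℝ}
    {G : ℝ → F} (hG : ∀ s ∈ Icc 0 T, ∀ t ∈ Icc 0 T, s ≤ t → ‖G t - G s‖ ≤ C * (t - s) ^ 2) :
    ∀ t ∈ Icc 0 T, G t = G 0 := by
  have hG' : ∀ s ∈ Icc 0 T, ∀ t ∈ Icc 0 T, ‖G t - G s‖ ≤ C * ‖t - s‖ ^ 2 := by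
    intro s hs t ht
    rw [Real.norm_eq_abs, sq_abs]
    rcases le_total s t with hst | hst
    · exact hG s hs t ht hst
    · rw [norm_sub_rev, ← neg_sq, neg_sub]
      exact hG t ht s hs hst
  have hd : ∀ s ∈ Icc 0 T, HasDerivWithinAt G 0 (Icc 0 T) s := by
    intro s hs
    rw [hasDerivWithinAt_iff_isLittleO]
    simp only [smul_zero, sub_zero]
    have hO : (fun t => G t - G s) =O[𝓝[Icc 0 T] s] fun t => ‖t - s‖ ^ 2 :=
      Asymptotics.IsBigO.of_bound C (by
        filter_upwards [self_mem_nhdsWithin] with t ht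
        simpa using hG' s hs t ht)
    refine hO.trans_isLittleO ?_
    have ht : Tendsto (fun t => t - s) (𝓝[Icc 0 T] s) (𝓝 0) := by
      have : ContinuousAt (fun t : ℝ => t - s) s := by fun_prop
      simpa [ContinuousAt] using this.tendsto.mono_left nhdsWithin_le_nhds
    exact (Asymptotics.isLittleO_norm_pow_id (E' := ℝ) one_lt_two).comp_tendsto ht
  exact constant_of_has_deriv_right_zero (fun s hs => (hd s hs).continuousWithinAt)
    fun s hs => (hd s (Ico_subset_Icc_self hs)).mono_of_mem_nhdsWithin
      (Filter.mem_of_superset (Icc_mem_nhdsGE hs.2) (Icc_subset_Icc_left hs.1))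

theorem StandingAssumptions.fields_lipschitz {n m l : ℕ} {f : E n → E m → E l → E n}
    {g : Fin m → E n → E m → E n} {U : Set (E m)} {A : Set (E l)}
    (h : StandingAssumptions f g U A) (R : ℝ) :
    ∃ L : ℝ, 0 ≤ L ∧ ∀ i, ∀ x y, ∀ z ∈ U, ∀ z' ∈ U,
      ‖x‖ ≤ R → ‖y‖ ≤ R → ‖z‖ ≤ R → ‖z'‖ ≤ R →
      ‖g i x z‖ ≤ L ∧ ‖g i y z' - g i x z‖ ≤ L * (‖y - x‖ + ‖z' - z‖) := by
  set S : Set (E n × E m) := Metric.closedBall 0 R ×ˢ (U ∩ Metric.closedBall 0 R) with hS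
  have hSc : IsCompact S :=
    (isCompact_closedBall _ _).prod ((isCompact_closedBall _ _).inter_left h.isClosed)
  have hl : ∀ i, ∃ K, LipschitzOnWith K (fun p : E n × E m => g i p.1 p.2) S := fun i => by
    refine LocallyLipschitzOn.exists_lipschitzOnWith_of_compact hSc ?_
    rintro ⟨x, z⟩ ⟨-, hz, -⟩
    obtain ⟨K, s, hs, hK⟩ := ((h.g_smooth i x z (subset_starHull U hz)).of_le
      (by norm_num : (1 : WithTop ℕ∞) ≤ 2)).exists_lipschitzOnWith
    exact ⟨K, s, mem_nhdsWithin_of_mem_nhds hs, hK⟩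
  choose K hK using hl
  obtain ⟨M, hM, hgM⟩ := h.g_growth
  have hKi : ∀ i, (K i : ℝ) ≤ ∑ j, (K j : ℝ) := fun i =>
    Finset.single_le_sum (f := fun j => (K j : ℝ)) (fun j _ => (K j).2) (Finset.mem_univ i)
  refine ⟨max (∑ i, (K i : ℝ)) (M * (1 + |R|)),
    le_max_of_le_left (Finset.sum_nonneg fun i _ => (K i).2),
    fun i x y z hz z' hz' hx hy hzR hzR' => ⟨?_, ?_⟩⟩
  · refine (hgM i x z (subset_starHull U hz)).trans (le_max_of_le_right ?_)
    have : ‖(x, z)‖ ≤ |R| := by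
      rw [Prod.norm_mk]
      exact max_le (hx.trans (le_abs_self _)) (hzR.trans (le_abs_self _))
    gcongr
  · have h1 := (hK i).dist_le_mul (y, z') ⟨by simpa using hy, hz', by simpa using hzR'⟩
      (x, z) ⟨by simpa using hx, hz, by simpa using hzR⟩
    rw [dist_eq_norm, dist_eq_norm, Prod.mk_sub_mk, Prod.norm_mk] at h1
    refine h1.trans (mul_le_mul ((hKi i).trans (le_max_left _ _)) (max_le ?_ ?_) (by positivity)
      (le_max_of_le_left (Finset.sum_nonneg fun i _ => (K i).2))) <;> simp

theorem exists_bound_of_continuousOn_Icc {T : ℝ} {n m : ℕ} {x : ℝ → E n} {u : ℝ → E m}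
    (hx : ContinuousOn x (Icc 0 T)) (hu : ContinuousOn u (Icc 0 T)) :
    ∃ R : ℝ, 0 ≤ R ∧ ∀ t ∈ Icc 0 T, ‖x t‖ ≤ R ∧ ‖u t‖ ≤ R := by
  obtain ⟨R₁, h₁⟩ := isCompact_Icc.exists_bound_of_continuousOn hx
  obtain ⟨R₂, h₂⟩ := isCompact_Icc.exists_bound_of_continuousOn hu
  exact ⟨max 0 (max R₁ R₂), le_max_left _ _, fun t ht =>
    ⟨le_max_of_le_right (le_max_of_le_left (h₁ t ht)),
      le_max_of_le_right (le_max_of_le_right (h₂ t ht))⟩⟩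

theorem StandingAssumptions.aestronglyMeasurable_transformedDrift {n m l : ℕ}
    {f : E n → E m → E l → E n} {g : Fin m → E n → E m → E n} {U : Set (E m)} {A : Set (E l)}
    (h : StandingAssumptions f g U A) {T : ℝ} {x : ℝ → E n} {u : ℝ → E m} {a : ℝ → E l}
    (hx : AEStronglyMeasurable x (volume.restrict (Icc 0 T)))
    (hu : AEStronglyMeasurable u (volume.restrict (Icc 0 T))) (hua : ∀ t ∈ Icc 0 T, u t ∈ U)
    (ha : IsL1Control T A a) :
    AEStronglyMeasurable (fun t => transformedDrift f g (x t) (u t) (a t))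
      (volume.restrict (Icc 0 T)) := by
  refine h.continuousOn_transformedDrift.aestronglyMeasurable_comp_of_isClosed
    (q := fun t => (x t, u t, a t))
    (isClosed_univ.prod (h.isClosed.prod h.compact_A.isClosed))
    (hx.aemeasurable.prodMk (hu.aemeasurable.prodMk ha.1.aestronglyMeasurable.aemeasurable)) ?_
  filter_upwards [ha.2, ae_restrict_mem measurableSet_Icc] with t ht htT
  exact ⟨mem_univ _, hua t htT, ht⟩

/-- Along a classical solution the radial coordinate is driven by the transformed drift alone: the
derivative of the control has disappeared. The trajectory is Lipschitz in time, so both sides have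
increments that agree up to a quadratic error. -/
theorem IsClassicalSolution.radialCoordinate_eq {n m l : ℕ} {T : ℝ} (hT : 0 < T)
    {f : E n → E m → E l → E n} {g : Fin m → E n → E m → E n} {U : Set (E m)} {A : Set (E l)}
    (h : StandingAssumptions f g U A) {x₀ : E n} {u : ℝ → E m} {a : ℝ → E l} {x : ℝ → E n}
    (hu : IsC1Control T U u) (ha : IsL1Control T A a)
    (hx : IsClassicalSolution T f g x₀ u a x) :
    ∀ t ∈ Icc 0 T, radialCoordinate g (x t) (u t) = radialCoordinate g x₀ (u 0) +
      ∫ s in (0 : ℝ)..t, transformedDrift f g (x s) (u s) (a s) := by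
  have hx0 : x 0 = x₀ := by simpa using hx.integral_eq 0 ⟨le_rfl, hT.le⟩
  obtain ⟨R, hR, hb⟩ := exists_bound_of_continuousOn_Icc hx.continuousOn hu.1.continuousOn
  obtain ⟨L, hL, hf⟩ := h.drift_lipschitz R
  obtain ⟨H, hH, hh⟩ := h.transformedDrift_lipschitz R
  obtain ⟨G, hG, hg⟩ := h.fields_lipschitz R
  obtain ⟨C, hC, hφ⟩ := radialCoordinate_estimates h R
  set w := derivWithin u (Icc 0 T) with hw
  have hwc : ContinuousOn w (Icc 0 T) :=
    hu.1.continuousOn_derivWithin (uniqueDiffOn_Icc hT) le_rfl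
  obtain ⟨D', hD'⟩ := isCompact_Icc.exists_bound_of_continuousOn hwc
  set D := max D' 0 with hDdef
  have hD : ∀ t ∈ Icc 0 T, ‖w t‖ ≤ D := fun t ht => (hD' t ht).trans (le_max_left _ _)
  have hD0 : 0 ≤ D := le_max_right _ _
  have haA : ∀ᵐ t, t ∈ Icc 0 T → a t ∈ A := (ae_restrict_iff' measurableSet_Icc).1 ha.2
  have hsub : ∀ {s t}, s ∈ Icc 0 T → t ∈ Icc 0 T → s ≤ t → uIcc s t ⊆ uIcc 0 T :=
    fun hs ht hst => by
      rw [uIcc_of_le hst, uIcc_of_le hT.le]; exact Icc_subset_Icc hs.1 ht.2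
  have hvint : ∀ {s t}, s ∈ Icc 0 T → t ∈ Icc 0 T → s ≤ t →
      IntervalIntegrable (velocity T f g u a x) volume s t :=
    fun hs ht hst => hx.integrable.mono_set (hsub hs ht hst)
  have hhint0 : IntervalIntegrable (fun s => transformedDrift f g (x s) (u s) (a s)) volume 0 T := by
    rw [intervalIntegrable_iff_integrableOn_Icc_of_le hT.le]
    refine Integrable.of_bound (h.aestronglyMeasurable_transformedDrift
      (hx.continuousOn.aestronglyMeasurable measurableSet_Icc)
      (hu.1.continuousOn.aestronglyMeasurable measurableSet_Icc) hu.2 ha) H ?_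
    filter_upwards [ha.2, ae_restrict_mem measurableSet_Icc] with t ht htT
    exact (hh (x t) (x t) (u t) (hu.2 t htT) (u t) (hu.2 t htT) (a t) ht (hb t htT).1
      (hb t htT).1 (hb t htT).2 (hb t htT).2).1
  have hhint : ∀ {s t}, s ∈ Icc 0 T → t ∈ Icc 0 T → s ≤ t →
      IntervalIntegrable (fun s => transformedDrift f g (x s) (u s) (a s)) volume s t :=
    fun hs ht hst => hhint0.mono_set (hsub hs ht hst)
  have hwint : ∀ {s t}, s ∈ Icc 0 T → t ∈ Icc 0 T → s ≤ t → IntervalIntegrable w volume s t :=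
    fun hs ht hst => (hwc.intervalIntegrable_of_Icc hT.le).mono_set (hsub hs ht hst)
  have huint : ∀ {s t}, s ∈ Icc 0 T → t ∈ Icc 0 T → s ≤ t →
      ∫ r in s..t, w r = u t - u s := by
    intro s t hs ht hst
    have hss : Icc s t ⊆ Icc 0 T := Icc_subset_Icc hs.1 ht.2
    refine intervalIntegral.integral_eq_sub_of_hasDeriv_right_of_le hst
      (hu.1.continuousOn.mono hss) (fun r hr => ?_) (hwint hs ht hst)
    have hr' : r ∈ Icc 0 T := hss (Ioo_subset_Icc_self hr)
    exact ((hu.1.differentiableOn (by simp)) r hr').hasDerivWithinAt.mono_of_mem_nhdsWithin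
      (Filter.mem_of_superset (Ioc_mem_nhdsGT (hr.2.trans_le ht.2))
        (fun q hq => ⟨hr'.1.trans hq.1.le, hq.2⟩))
  have hxint : ∀ {s t}, s ∈ Icc 0 T → t ∈ Icc 0 T → s ≤ t →
      ∫ r in s..t, velocity T f g u a x r = x t - x s := by
    intro s t hs ht hst
    have h0 : (0 : ℝ) ∈ Icc 0 T := ⟨le_rfl, hT.le⟩
    rw [hx.integral_eq t ht, hx.integral_eq s hs, add_sub_add_left_eq_sub,
      intervalIntegral.integral_interval_sub_left (hvint h0 ht ht.1) (hvint h0 hs hs.1)]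
  -- the trajectory and the control are Lipschitz in time
  set B := L + m * (D * G) with hBdef
  have hB : 0 ≤ B := by positivity
  have hvb : ∀ᵐ t, t ∈ Icc 0 T → ‖velocity T f g u a x t‖ ≤ B := by
    filter_upwards [haA] with t ht htT
    obtain ⟨hxt, hut⟩ := hb t htT
    have huU := hu.2 t htT
    refine (norm_add_le _ _).trans (add_le_add
      (hf (x t) (x t) (u t) huU (u t) huU (a t) (ht htT) hxt hxt hut hut).1 ?_)
    calc _ ≤ ∑ _i : Fin m, D * G := norm_sum_le_of_le _ fun i _ => by
          rw [norm_smul]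
          exact mul_le_mul ((PiLp.norm_apply_le _ i).trans (hD t htT))
            (hg i (x t) (x t) (u t) huU (u t) huU hxt hxt hut hut).1 (norm_nonneg _) hD0
      _ = _ := by simp
  have hxl : ∀ {s t}, s ∈ Icc 0 T → t ∈ Icc 0 T → s ≤ t → ‖x t - x s‖ ≤ B * (t - s) := by
    intro s t hs ht hst
    rw [← hxint hs ht hst, ← abs_of_nonneg (sub_nonneg.2 hst)]
    refine intervalIntegral.norm_integral_le_of_norm_le_const_ae ?_
    filter_upwards [hvb] with r hr hr'
    rw [uIoc_of_le hst] at hr'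
    exact hr ⟨hs.1.trans hr'.1.le, hr'.2.trans ht.2⟩
  have hul : ∀ {s t}, s ∈ Icc 0 T → t ∈ Icc 0 T → s ≤ t → ‖u t - u s‖ ≤ D * (t - s) := by
    intro s t hs ht hst
    rw [← huint hs ht hst, ← abs_of_nonneg (sub_nonneg.2 hst)]
    refine intervalIntegral.norm_integral_le_of_norm_le_const fun r hr => ?_
    rw [uIoc_of_le hst] at hr
    exact hD r ⟨hs.1.trans hr.1.le, hr.2.trans ht.2⟩
  set Q := C * ((B + D) * L) + C * (m * (D * (G * (B + D)))) with hQ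
  have key := eq_of_norm_sub_le_sq (T := T) (C := C * (B + D) ^ 2 + Q)
    (G := fun t => radialCoordinate g (x t) (u t)
      - ∫ s in (0 : ℝ)..t, transformedDrift f g (x s) (u s) (a s)) ?_
  · intro t ht
    have := key t ht
    rw [intervalIntegral.integral_same, sub_zero, hx0] at this
    exact sub_eq_iff_eq_add.1 this
  intro s hs t ht hst
  have h0 : (0 : ℝ) ∈ Icc 0 T := ⟨le_rfl, hT.le⟩
  obtain ⟨hxs, hus⟩ := hb s hs
  obtain ⟨hxt, hut⟩ := hb t ht
  have hquad := (hφ (x s) (x t) (u s) (hu.2 s hs) (u t) (hu.2 t ht) hxs hxt hus hut).2.2.2.2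
  have hsum : ∑ i, (u t - u s) i • g i (x s) (u s)
      = ∫ r in s..t, ∑ i, w r i • g i (x s) (u s) := by
    let Λ : E m →L[ℝ] E n := ∑ i, (EuclideanSpace.proj (𝕜 := ℝ) i).smulRight (g i (x s) (u s))
    have hΛ : ∀ v, Λ v = ∑ i, v i • g i (x s) (u s) := fun v => by
      simp [Λ]
    simp only [← hΛ]
    rw [← huint hs ht hst, ContinuousLinearMap.intervalIntegral_comp_comm _ (hwint hs ht hst)]
  have hsint : IntervalIntegrable (fun r => ∑ i, w r i • g i (x s) (u s)) volume s t := by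
    refine ContinuousOn.intervalIntegrable_of_Icc hst (continuousOn_finsetSum _ fun i _ => ?_)
    exact (((EuclideanSpace.proj (𝕜 := ℝ) i).continuous.comp_continuousOn
      (hwc.mono (Icc_subset_Icc hs.1 ht.2))).smul continuousOn_const)
  set P := radialDeriv g (x s) (u s) with hP
  have hint : P (x t - x s - ∑ i, (u t - u s) i • g i (x s) (u s))
      - ∫ r in s..t, transformedDrift f g (x r) (u r) (a r)
      = ∫ r in s..t, (P (velocity T f g u a x r - ∑ i, w r i • g i (x s) (u s))
        - transformedDrift f g (x r) (u r) (a r)) := by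
    have hi := (hvint hs ht hst).sub hsint
    rw [intervalIntegral.integral_sub ⟨P.integrable_comp hi.1, P.integrable_comp hi.2⟩ (hhint hs ht hst)]
    rw [P.intervalIntegral_comp_comm hi,
      intervalIntegral.integral_sub (hvint hs ht hst) hsint, hsum, hxint hs ht hst]
  have hbound : ‖∫ r in s..t, (P (velocity T f g u a x r - ∑ i, w r i • g i (x s) (u s))
        - transformedDrift f g (x r) (u r) (a r))‖ ≤ Q * (t - s) * |t - s| := by
    refine intervalIntegral.norm_integral_le_of_norm_le_const_ae ?_
    filter_upwards [haA] with r hrA hr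
    rw [uIoc_of_le hst] at hr
    have hrT : r ∈ Icc 0 T := ⟨hs.1.trans hr.1.le, hr.2.trans ht.2⟩
    obtain ⟨hxr, hur⟩ := hb r hrT
    have hds : ‖x r - x s‖ + ‖u r - u s‖ ≤ (B + D) * (t - s) := by
      have h1 := hxl hs hrT hr.1.le
      have h2 := hul hs hrT hr.1.le
      have h3 : (B + D) * (r - s) ≤ (B + D) * (t - s) := by gcongr; exact hr.2
      linarith
    have e : P (velocity T f g u a x r - ∑ i, w r i • g i (x s) (u s))
        - transformedDrift f g (x r) (u r) (a r)
        = P (∑ i, w r i • (g i (x r) (u r) - g i (x s) (u s)))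
          - (radialDeriv g (x r) (u r) - P) (f (x r) (u r) (a r)) := by
      simp only [velocity, transformedDrift, smul_sub, Finset.sum_sub_distrib, map_sub, map_add,
        sub_apply, ← hw]
      abel
    rw [e]
    have hest := hφ (x s) (x r) (u s) (hu.2 s hs) (u r) (hu.2 r hrT) hxs hxr hus hur
    have h1 := ContinuousLinearMap.le_of_opNorm_le_of_le _ hest.2.1
      (hf (x r) (x r) (u r) (hu.2 r hrT) (u r) (hu.2 r hrT) (a r) (hrA hrT) hxr hxr hur hur).1
    have h2 : ‖∑ i, w r i • (g i (x r) (u r) - g i (x s) (u s))‖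
        ≤ m * (D * (G * ((B + D) * (t - s)))) := by
      calc _ ≤ ∑ _i : Fin m, D * (G * ((B + D) * (t - s))) := norm_sum_le_of_le _ fun i _ => by
            rw [norm_smul]
            exact mul_le_mul ((PiLp.norm_apply_le _ i).trans (hD r hrT))
              ((hg i (x s) (x r) (u s) (hu.2 s hs) (u r) (hu.2 r hrT) hxs hxr hus hur).2.trans
                (mul_le_mul_of_nonneg_left hds hG)) (norm_nonneg _) hD0
        _ = _ := by simp
    have h3 := ContinuousLinearMap.le_of_opNorm_le_of_le _ hest.1 h2
    refine (norm_sub_le _ _).trans ((add_le_add h3 (h1.trans (mul_le_mul_of_nonneg_right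
      (mul_le_mul_of_nonneg_left hds hC) hL))).trans (le_of_eq ?_))
    rw [hQ]; ring
  have hsq : C * (‖x t - x s‖ + ‖u t - u s‖) ^ 2 ≤ C * ((B + D) * (t - s)) ^ 2 := by
    have h1 := hxl hs ht hst
    have h2 := hul hs ht hst
    gcongr
    linarith
  have hsplit : (radialCoordinate g (x t) (u t)
      - ∫ s in (0 : ℝ)..t, transformedDrift f g (x s) (u s) (a s))
      - (radialCoordinate g (x s) (u s)
      - ∫ r in (0 : ℝ)..s, transformedDrift f g (x r) (u r) (a r))
      = (radialCoordinate g (x t) (u t) - radialCoordinate g (x s) (u s)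
        - P (x t - x s - ∑ i, (u t - u s) i • g i (x s) (u s)))
      + (P (x t - x s - ∑ i, (u t - u s) i • g i (x s) (u s))
        - ∫ r in s..t, transformedDrift f g (x r) (u r) (a r)) := by
    rw [← intervalIntegral.integral_interval_sub_left (hhint h0 ht ht.1) (hhint h0 hs hs.1)]
    abel
  simp only [hsplit]
  refine (norm_add_le _ _).trans ?_
  rw [hint]
  refine (add_le_add (hquad.trans hsq) hbound).trans (le_of_eq ?_)
  rw [abs_of_nonneg (sub_nonneg.2 hst)]
  ring

/-! ### The Lipschitz estimate -/

/-- A pair `(x, u)` with values bounded by `R` that satisfies the equation for the radial coordinate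
on `[0,T]`. This notion makes sense for discontinuous `x` and `u`; it covers classical as well as
generalized solutions. -/
structure IsTransformedSolution {n m l : ℕ} (T R : ℝ) (f : E n → E m → E l → E n)
    (g : Fin m → E n → E m → E n) (U : Set (E m)) (x₀ : E n) (u : ℝ → E m) (a : ℝ → E l)
    (x : ℝ → E n) : Prop where
  measurable_state : AEStronglyMeasurable x (volume.restrict (Icc 0 T))
  measurable_control : AEStronglyMeasurable u (volume.restrict (Icc 0 T))
  bound : ∀ t ∈ Icc 0 T, ‖x t‖ ≤ R ∧ ‖u t‖ ≤ R
  control_mem : ∀ t ∈ Icc 0 T, u t ∈ U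
  init : x 0 = x₀
  eq : ∀ t ∈ Icc 0 T, radialCoordinate g (x t) (u t) = radialCoordinate g x₀ (u 0) +
    ∫ s in (0 : ℝ)..t, transformedDrift f g (x s) (u s) (a s)

theorem IsL1Control.mono {l : ℕ} {T T' : ℝ} {A : Set (E l)} {a : ℝ → E l}
    (ha : IsL1Control T A a) (hT : T' ≤ T) : IsL1Control T' A a :=
  ⟨ha.1.mono_set (Icc_subset_Icc_right hT),
    ae_restrict_of_ae_restrict_of_subset (Icc_subset_Icc_right hT) ha.2⟩

theorem IsClassicalSolution.apply_zero {n m l : ℕ} {T : ℝ} (hT : 0 < T)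
    {f : E n → E m → E l → E n} {g : Fin m → E n → E m → E n} {x₀ : E n} {u : ℝ → E m}
    {a : ℝ → E l} {x : ℝ → E n} (hx : IsClassicalSolution T f g x₀ u a x) : x 0 = x₀ := by
  simpa using hx.integral_eq 0 ⟨le_rfl, hT.le⟩

theorem IsClassicalSolution.isTransformedSolution {n m l : ℕ} {T T' R : ℝ} (hT : 0 < T)
    (hT' : T' ≤ T) {f : E n → E m → E l → E n} {g : Fin m → E n → E m → E n} {U : Set (E m)}
    {A : Set (E l)} (h : StandingAssumptions f g U A) {x₀ : E n} {u : ℝ → E m} {a : ℝ → E l}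
    {x : ℝ → E n} (hu : IsC1Control T U u) (ha : IsL1Control T A a)
    (hx : IsClassicalSolution T f g x₀ u a x)
    (hb : ∀ t ∈ Icc 0 T', ‖x t‖ ≤ R ∧ ‖u t‖ ≤ R) :
    IsTransformedSolution T' R f g U x₀ u a x where
  measurable_state := (hx.continuousOn.mono (Icc_subset_Icc_right hT')).aestronglyMeasurable
    measurableSet_Icc
  measurable_control := (hu.1.continuousOn.mono (Icc_subset_Icc_right hT')).aestronglyMeasurable
    measurableSet_Icc
  bound := hb
  control_mem t ht := hu.2 t (Icc_subset_Icc_right hT' ht)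
  init := hx.apply_zero hT
  eq t ht := hx.radialCoordinate_eq hT h hu ha t (Icc_subset_Icc_right hT' ht)

namespace IsTransformedSolution

variable {n m l : ℕ} {T R : ℝ} {f : E n → E m → E l → E n} {g : Fin m → E n → E m → E n}
  {U : Set (E m)} {A : Set (E l)} {x₀ : E n} {u : ℝ → E m} {a : ℝ → E l} {x : ℝ → E n}

theorem integrableOn_state (hx : IsTransformedSolution T R f g U x₀ u a x) :
    IntegrableOn x (Icc 0 T) :=
  Integrable.of_bound hx.measurable_state R (by
    filter_upwards [ae_restrict_mem measurableSet_Icc] with t ht using (hx.bound t ht).1)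

theorem integrableOn_control (hx : IsTransformedSolution T R f g U x₀ u a x) :
    IntegrableOn u (Icc 0 T) :=
  Integrable.of_bound hx.measurable_control R (by
    filter_upwards [ae_restrict_mem measurableSet_Icc] with t ht using (hx.bound t ht).2)

theorem intervalIntegrable (hT : 0 ≤ T) (h : StandingAssumptions f g U A)
    (ha : IsL1Control T A a) (hx : IsTransformedSolution T R f g U x₀ u a x) :
    IntervalIntegrable (fun s => transformedDrift f g (x s) (u s) (a s)) volume 0 T := by
  obtain ⟨H, -, hh⟩ := h.transformedDrift_lipschitz R
  rw [intervalIntegrable_iff_integrableOn_Icc_of_le hT]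
  refine Integrable.of_bound (h.aestronglyMeasurable_transformedDrift hx.measurable_state
    hx.measurable_control hx.control_mem ha) H ?_
  filter_upwards [ha.2, ae_restrict_mem measurableSet_Icc] with t ht htT
  obtain ⟨hb1, hb2⟩ := hx.bound t htT
  exact (hh (x t) (x t) (u t) (hx.control_mem t htT) (u t) (hx.control_mem t htT) (a t) ht
    hb1 hb1 hb2 hb2).1

end IsTransformedSolution

theorem intervalIntegral_eq_integral_Icc {T : ℝ} (hT : 0 ≤ T) (k : ℝ → ℝ) :
    ∫ t in (0 : ℝ)..T, k t = ∫ t in Icc 0 T, k t := by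
  rw [intervalIntegral.integral_of_le hT, integral_Icc_eq_integral_Ioc]

/-- The basic estimate: Grönwall's inequality for the difference of two radial coordinates. The term
`η + C ∫ ‖a - a'‖` accounts for a change of the ordinary control; the constant `M` depends neither on
`η` nor on the horizon `T' ≤ T`. -/
theorem exists_transformed_estimate {n m l : ℕ} {f : E n → E m → E l → E n}
    {g : Fin m → E n → E m → E n} {U : Set (E m)} {A : Set (E l)}
    (h : StandingAssumptions f g U A) {T : ℝ} (hT : 0 ≤ T) (R : ℝ) :
    ∃ M > 0, ∀ η > 0, ∃ C : ℝ, 0 ≤ C ∧ ∀ T' ∈ Icc 0 T, ∀ x₀ u a x x₀' u' a' x',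
      IsL1Control T' A a → IsL1Control T' A a' →
      IsTransformedSolution T' R f g U x₀ u a x → IsTransformedSolution T' R f g U x₀' u' a' x' →
      ∀ τ ∈ Icc 0 T', ‖x τ - x' τ‖ + ∫ t in Icc 0 T', ‖x t - x' t‖ ≤
        M * (‖x₀ - x₀'‖ + ‖u 0 - u' 0‖ + ‖u τ - u' τ‖ + (∫ t in Icc 0 T', ‖u t - u' t‖)
          + (η + C * ∫ t in Icc 0 T', ‖a t - a' t‖)) := by
  obtain ⟨L, hL, hφ⟩ := radialCoordinate_estimates h R
  obtain ⟨H, hH, hh⟩ := h.transformedDrift_lipschitz R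
  set B := (L + H * (L + 1) + T + 1) * Real.exp (H * L * T) with hB
  have hB0 : 0 ≤ B := by positivity
  refine ⟨L * (B + B * T + 1) + 1, by positivity, fun η hη => ?_⟩
  obtain ⟨C, hC, hCa⟩ := h.transformedDrift_sub_le R hη
  refine ⟨C, hC, fun T' hT' x₀ u a x x₀' u' a' x' ha ha' hx hx' τ hτ => ?_⟩
  have hT'0 : 0 ≤ T' := hT'.1
  have h0 : (0 : ℝ) ∈ Icc 0 T' := ⟨le_rfl, hT'0⟩
  have hφt := fun t (ht : t ∈ Icc 0 T') => hφ (x' t) (x t) (u' t) (hx'.control_mem t ht) (u t)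
    (hx.control_mem t ht) (hx'.bound t ht).1 (hx.bound t ht).1 (hx'.bound t ht).2 (hx.bound t ht).2
  set δ : ℝ → E n := fun t => radialCoordinate g (x t) (u t) - radialCoordinate g (x' t) (u' t)
    with hδ
  have hdu : IntegrableOn (fun t => ‖u t - u' t‖) (Icc 0 T') :=
    (hx.integrableOn_control.sub hx'.integrableOn_control).norm
  have hda : IntegrableOn (fun t => ‖a t - a' t‖) (Icc 0 T') := (ha.1.sub ha'.1).norm
  set Iu := ∫ t in Icc 0 T', ‖u t - u' t‖ with hIu
  set Ia := ∫ t in Icc 0 T', ‖a t - a' t‖ with hIa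
  have hIu0 : 0 ≤ Iu := integral_nonneg fun t => norm_nonneg _
  have hIa0 : 0 ≤ Ia := integral_nonneg fun t => norm_nonneg _
  set d₀ := ‖x₀ - x₀'‖ + ‖u 0 - u' 0‖ with hd₀
  have hd₀0 : 0 ≤ d₀ := by positivity
  set S := d₀ + Iu + (η + C * Ia) with hS
  have hS0 : 0 ≤ S := by positivity
  have hint := hx.intervalIntegrable hT'0 h ha
  have hint' := hx'.intervalIntegrable hT'0 h ha'
  have hsub : ∀ {t}, t ∈ Icc 0 T' → uIcc 0 t ⊆ uIcc 0 T' := fun ht => by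
    rw [uIcc_of_le ht.1, uIcc_of_le hT'0]; exact Icc_subset_Icc_right ht.2
  have hδeq : ∀ t ∈ Icc 0 T', δ t = radialCoordinate g x₀ (u 0) - radialCoordinate g x₀' (u' 0)
      + ∫ s in (0 : ℝ)..t, (transformedDrift f g (x s) (u s) (a s)
        - transformedDrift f g (x' s) (u' s) (a' s)) := by
    intro t ht
    rw [intervalIntegral.integral_sub (hint.mono_set (hsub ht)) (hint'.mono_set (hsub ht))]
    simp only [hδ, hx.eq t ht, hx'.eq t ht]
    abel
  have hδc : ContinuousOn δ (Icc 0 T') := by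
    have := intervalIntegral.continuousOn_primitive_interval' (μ := volume) (a := 0)
      (hint.sub hint') left_mem_uIcc
    rw [uIcc_of_le hT'0] at this
    exact (continuousOn_const.add this).congr hδeq
  have hxδ : ∀ t ∈ Icc 0 T', ‖x t - x' t‖ ≤ L * (‖δ t‖ + ‖u t - u' t‖) := fun t ht =>
    (hφt t ht).2.2.2.1
  -- the integrand of the Grönwall inequality, apart from the radial coordinates
  set k : ℝ → ℝ := fun t => H * (L + 1) * ‖u t - u' t‖ + (η + C * ‖a t - a' t‖) with hk
  have hki : IntegrableOn k (Icc 0 T') :=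
    (hdu.const_mul _).add ((integrable_const η).add (hda.const_mul C))
  have hk0 : ∀ t, 0 ≤ k t := fun t => by positivity
  have hkint : ∫ t in Icc 0 T', k t = H * (L + 1) * Iu + (η * T' + C * Ia) := by
    have hη' : Integrable (fun t => η + C * ‖a t - a' t‖) (volume.restrict (Icc 0 T')) :=
      (integrable_const η).add (hda.const_mul C)
    rw [hk, integral_add (hdu.const_mul _) hη', integral_add (integrable_const η) (hda.const_mul C),
      integral_const_mul, integral_const_mul, ← hIu, ← hIa]
    simp [hT'0, mul_comm]
  have hae : ∀ᵐ s, s ∈ Icc 0 T' → a s ∈ A ∧ a' s ∈ A :=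
    (ae_restrict_iff' measurableSet_Icc).1 (ha.2.and ha'.2)
  have hgr : ∀ t ∈ Icc 0 T', ‖δ t‖ ≤ (L * d₀ + ∫ s in Icc 0 T', k s)
      + H * L * ∫ s in (0 : ℝ)..t, ‖δ s‖ := by
    intro t ht
    have hδi : IntervalIntegrable (fun s => ‖δ s‖) volume 0 t :=
      (hδc.norm.intervalIntegrable_of_Icc hT'0).mono_set (hsub ht)
    have hkt : IntervalIntegrable k volume 0 t :=
      ((intervalIntegrable_iff_integrableOn_Icc_of_le hT'0).2 hki).mono_set (hsub ht)
    have h1 : ‖radialCoordinate g x₀ (u 0) - radialCoordinate g x₀' (u' 0)‖ ≤ L * d₀ := by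
      have := (hφt 0 h0).2.2.1
      rwa [hx.init, hx'.init] at this
    have h2 : ‖∫ s in (0 : ℝ)..t, (transformedDrift f g (x s) (u s) (a s)
        - transformedDrift f g (x' s) (u' s) (a' s))‖
        ≤ ∫ s in (0 : ℝ)..t, (H * L * ‖δ s‖ + k s) := by
      refine intervalIntegral.norm_integral_le_of_norm_le ht.1 ?_ ((hδi.const_mul _).add hkt)
      filter_upwards [hae] with s hs hst
      have hsT : s ∈ Icc 0 T' := ⟨hst.1.le, hst.2.trans ht.2⟩
      obtain ⟨hsa, hsa'⟩ := hs hsT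
      have e1 := (hh (x' s) (x s) (u' s) (hx'.control_mem s hsT) (u s) (hx.control_mem s hsT)
        (a s) hsa (hx'.bound s hsT).1 (hx.bound s hsT).1 (hx'.bound s hsT).2 (hx.bound s hsT).2).2
      have e2 := hCa (x' s) (u' s) (hx'.control_mem s hsT) (hx'.bound s hsT).1 (hx'.bound s hsT).2
        (a' s) hsa' (a s) hsa
      have e3 : H * (‖x s - x' s‖ + ‖u s - u' s‖)
          ≤ H * (L * (‖δ s‖ + ‖u s - u' s‖) + ‖u s - u' s‖) := by
        gcongr
        exact hxδ s hsT
      calc _ = ‖(transformedDrift f g (x s) (u s) (a s) - transformedDrift f g (x' s) (u' s) (a s))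
            + (transformedDrift f g (x' s) (u' s) (a s)
              - transformedDrift f g (x' s) (u' s) (a' s))‖ := by congr 1; abel
        _ ≤ H * (L * (‖δ s‖ + ‖u s - u' s‖) + ‖u s - u' s‖) + (η + C * ‖a s - a' s‖) :=
          (norm_add_le _ _).trans (add_le_add (e1.trans e3) e2)
        _ = _ := by rw [hk]; ring
    have h3 : ∫ s in (0 : ℝ)..t, k s ≤ ∫ s in Icc 0 T', k s := by
      rw [intervalIntegral_eq_integral_Icc ht.1]
      exact setIntegral_mono_set hki (Eventually.of_forall hk0)
        (Icc_subset_Icc_right ht.2).eventuallyLE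
    rw [intervalIntegral.integral_add (hδi.const_mul _) hkt,
      intervalIntegral.integral_const_mul] at h2
    rw [hδeq t ht]
    refine (norm_add_le _ _).trans ((add_le_add h1 h2).trans ?_)
    linarith
  have hc : L * d₀ + ∫ s in Icc 0 T', k s ≤ (L + H * (L + 1) + T + 1) * S := by
    rw [hkint, hS]
    have e1 : η * T' ≤ η * T := by gcongr; exact hT'.2
    have e2 : 0 ≤ H * (L + 1) * d₀ := by positivity
    have e3 : 0 ≤ L * Iu := by positivity
    have e4 : 0 ≤ (L + H * (L + 1)) * (η + C * Ia) := by positivity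
    have e5 : 0 ≤ (T + 1) * (d₀ + Iu) := by positivity
    have e6 : 0 ≤ T * (C * Ia) := by positivity
    linarith
  have hδb : ∀ t ∈ Icc 0 T', ‖δ t‖ ≤ B * S := by
    intro t ht
    refine (le_mul_exp_of_le_add_integral (by positivity) hδc.norm (fun _ _ => norm_nonneg _)
      hgr t ht).trans ?_
    have : H * L * t ≤ H * L * T := by gcongr; exact ht.2.trans hT'.2
    calc _ ≤ (L + H * (L + 1) + T + 1) * S * Real.exp (H * L * T) := by gcongr
      _ = B * S := by rw [hB]; ring
  have hxb : ∀ t ∈ Icc 0 T', ‖x t - x' t‖ ≤ L * (B * S) + L * ‖u t - u' t‖ := fun t ht =>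
    (hxδ t ht).trans (by rw [← mul_add]; gcongr; exact hδb t ht)
  have hI : ∫ t in Icc 0 T', ‖x t - x' t‖ ≤ L * (B * S) * T' + L * Iu := by
    have h1 : ∫ t in Icc 0 T', ‖x t - x' t‖
        ≤ ∫ t in Icc 0 T', (L * (B * S) + L * ‖u t - u' t‖) :=
      setIntegral_mono_on (hx.integrableOn_state.sub hx'.integrableOn_state).norm
        ((integrable_const _).add (hdu.const_mul L)) measurableSet_Icc hxb
    rw [integral_add (integrable_const _) (hdu.const_mul L),
      integral_const_mul L (fun t => ‖u t - u' t‖)] at h1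
    simp only [integral_const, measureReal_restrict_apply_univ, Real.volume_real_Icc, sub_zero,
      max_eq_left hT'0, smul_eq_mul] at h1
    linarith
  have h1 := hxb τ hτ
  have h2 : L * (B * S) * T' ≤ L * (B * S) * T := by gcongr; exact hT'.2
  have h3 : L * Iu ≤ L * S := by
    gcongr
    rw [hS]
    have : 0 ≤ C * Ia := by positivity
    linarith
  have h4 : 0 ≤ ‖u τ - u' τ‖ := norm_nonneg _
  have h5 : d₀ + ‖u τ - u' τ‖ + Iu + (η + C * Ia) = S + ‖u τ - u' τ‖ := by rw [hS]; ring
  rw [h5]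
  have h6 : 0 ≤ L * (B + B * T) * ‖u τ - u' τ‖ := by positivity
  linarith

/-- The basic estimate for a common ordinary control. -/
theorem exists_transformed_estimate_same {n m l : ℕ} {f : E n → E m → E l → E n}
    {g : Fin m → E n → E m → E n} {U : Set (E m)} {A : Set (E l)}
    (h : StandingAssumptions f g U A) {T : ℝ} (hT : 0 ≤ T) (R : ℝ) :
    ∃ M > 0, ∀ x₀ u x x₀' u' x' a, IsL1Control T A a →
      IsTransformedSolution T R f g U x₀ u a x → IsTransformedSolution T R f g U x₀' u' a x' →
      ∀ τ ∈ Icc 0 T, ‖x τ - x' τ‖ + ∫ t in Icc 0 T, ‖x t - x' t‖ ≤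
        M * (‖x₀ - x₀'‖ + ‖u 0 - u' 0‖ + ‖u τ - u' τ‖ + ∫ t in Icc 0 T, ‖u t - u' t‖) := by
  obtain ⟨M, hM, hest⟩ := exists_transformed_estimate h hT R
  refine ⟨M, hM, fun x₀ u x x₀' u' x' a ha hx hx' τ hτ => le_of_forall_pos_le_add fun ε hε => ?_⟩
  obtain ⟨C, -, hC⟩ := hest (ε / M) (by positivity)
  have := hC T ⟨hT, le_rfl⟩ x₀ u a x x₀' u' a x' ha ha hx hx' τ hτ
  simp only [sub_self, norm_zero, integral_zero, mul_zero, add_zero] at this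
  refine this.trans (le_of_eq ?_)
  field_simp

/-- Classical solutions for one impulsive control and two nearby ordinary controls are uniformly
close, and only the first solution has to be bounded beforehand: the second one cannot leave the unit
tube around it, because up to the first exit time the basic estimate gives a smaller distance. -/
theorem exists_delta_classical {n m l : ℕ} {f : E n → E m → E l → E n}
    {g : Fin m → E n → E m → E n} {U : Set (E m)} {A : Set (E l)}
    (h : StandingAssumptions f g U A) {T : ℝ} (hT : 0 < T) (R : ℝ) {ε : ℝ} (hε : 0 < ε) :
    ∃ δ > 0, ∀ x₀ u a b x y, IsC1Control T U u → IsL1Control T A a → IsL1Control T A b →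
      IsClassicalSolution T f g x₀ u a x → IsClassicalSolution T f g x₀ u b y →
      (∀ t ∈ Icc 0 T, ‖x t‖ ≤ R ∧ ‖u t‖ ≤ R) → ∫ t in Icc 0 T, ‖b t - a t‖ < δ →
      (∀ t ∈ Icc 0 T, ‖y t - x t‖ ≤ 1) ∧ ∫ t in Icc 0 T, ‖y t - x t‖ < ε := by
  obtain ⟨M, hM, hest⟩ := exists_transformed_estimate h hT.le (R + 1)
  set ε' := min ε 1 with hε'
  have hε'0 : 0 < ε' := lt_min hε one_pos
  obtain ⟨C, hC, hest⟩ := hest (ε' / (4 * M)) (by positivity)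
  refine ⟨ε' / (4 * M * (C + 1)), by positivity,
    fun x₀ u a b x y hu ha hb hx hy hbd hab => ?_⟩
  -- the estimate up to a time before which the second solution stays in the tube
  have step : ∀ T' ∈ Icc 0 T, (∀ t ∈ Icc 0 T', ‖y t - x t‖ ≤ 1) → ∀ τ ∈ Icc 0 T',
      ‖y τ - x τ‖ + ∫ t in Icc 0 T', ‖y t - x t‖ ≤ ε' / 2 := by
    intro T' hT' hT1 τ hτ
    have hss : Icc 0 T' ⊆ Icc 0 T := Icc_subset_Icc_right hT'.2
    have := hest T' hT' x₀ u b y x₀ u a x (hb.mono hT'.2) (ha.mono hT'.2)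
      (hy.isTransformedSolution hT hT'.2 h hu hb fun t ht => by
        obtain ⟨h1, h2⟩ := hbd t (hss ht)
        have h3 := hT1 t ht
        have h4 := norm_add_le (y t - x t) (x t)
        rw [sub_add_cancel] at h4
        exact ⟨by linarith, by linarith⟩)
      (hx.isTransformedSolution hT hT'.2 h hu ha fun t ht => by
        obtain ⟨h1, h2⟩ := hbd t (hss ht)
        exact ⟨by linarith, by linarith⟩) τ hτ
    simp only [sub_self, norm_zero, integral_zero, zero_add] at this
    refine this.trans ?_
    have h1 : ∫ t in Icc 0 T', ‖b t - a t‖ ≤ ε' / (4 * M * (C + 1)) :=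
      (setIntegral_mono_set (hb.1.sub ha.1).norm (Eventually.of_forall fun _ => norm_nonneg _)
        hss.eventuallyLE).trans hab.le
    have h2 : C * ∫ t in Icc 0 T', ‖b t - a t‖ ≤ ε' / (4 * M) :=
      calc C * ∫ t in Icc 0 T', ‖b t - a t‖ ≤ (C + 1) * (ε' / (4 * M * (C + 1))) := by
            gcongr
            linarith
        _ = ε' / (4 * M) := by field_simp
    calc M * (ε' / (4 * M) + C * ∫ t in Icc 0 T', ‖b t - a t‖)
        ≤ M * (ε' / (4 * M) + ε' / (4 * M)) := by gcongr
      _ = ε' / 2 := by field_simp; norm_num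
  have hd : ContinuousOn (fun t => ‖y t - x t‖) (Icc 0 T) :=
    (hy.continuousOn.sub hx.continuousOn).norm
  have hall : ∀ t ∈ Icc 0 T, ‖y t - x t‖ ≤ 1 := by
    by_contra! hcon
    obtain ⟨t₁, ht₁, h₁⟩ := hcon
    -- the first time at which the boundary of the tube is reached
    set Z := Icc 0 T ∩ (fun t => ‖y t - x t‖) ⁻¹' Ici 1 with hZ
    have hZc : IsCompact Z :=
      isCompact_Icc.of_isClosed_subset (hd.preimage_isClosed_of_isClosed isClosed_Icc isClosed_Ici)
        inter_subset_left
    obtain ⟨σ, hσZ, hσ⟩ := hZc.exists_isLeast ⟨t₁, ht₁, h₁.le⟩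
    have hlt : ∀ t ∈ Icc 0 T, t < σ → ‖y t - x t‖ < 1 := fun t ht htσ => by
      by_contra! hge
      exact absurd (hσ ⟨ht, hge⟩) (not_le.2 htσ)
    have hσpos : 0 < σ := by
      refine lt_of_le_of_ne hσZ.1.1 fun hσ0 => ?_
      have := hσZ.2
      rw [← hσ0, mem_preimage, mem_Ici, hx.apply_zero hT, hy.apply_zero hT] at this
      norm_num at this
    have hσle : ‖y σ - x σ‖ ≤ 1 := by
      have hcl : σ ∈ closure (Ico 0 σ) := by
        rw [closure_Ico hσpos.ne]; exact ⟨hσpos.le, le_rfl⟩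
      have hcw : ContinuousWithinAt (fun t => ‖y t - x t‖) (Ico 0 σ) σ :=
        (hd σ hσZ.1).mono fun t ht => ⟨ht.1, ht.2.le.trans hσZ.1.2⟩
      have himg : (fun t => ‖y t - x t‖) '' Ico 0 σ ⊆ Iic 1 := by
        rintro _ ⟨t, ht, rfl⟩
        exact (hlt t ⟨ht.1, ht.2.le.trans hσZ.1.2⟩ ht.2).le
      exact closure_minimal himg isClosed_Iic (hcw.mem_closure_image hcl)
    have hIcc : ∀ t ∈ Icc 0 σ, ‖y t - x t‖ ≤ 1 := fun t ht => by
      rcases ht.2.lt_or_eq with hlt' | rfl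
      · exact (hlt t ⟨ht.1, ht.2.trans hσZ.1.2⟩ hlt').le
      · exact hσle
    have := step σ hσZ.1 hIcc σ ⟨hσpos.le, le_rfl⟩
    have h2 : (0 : ℝ) ≤ ∫ t in Icc 0 σ, ‖y t - x t‖ := integral_nonneg fun _ => norm_nonneg _
    have h3 : (1 : ℝ) ≤ ‖y σ - x σ‖ := hσZ.2
    have h4 : ε' ≤ 1 := min_le_right _ _
    linarith
  refine ⟨hall, ?_⟩
  have := step T ⟨hT.le, le_rfl⟩ hall 0 ⟨le_rfl, hT.le⟩
  have h1 : ε' ≤ ε := min_le_left _ _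
  have h2 := norm_nonneg (y 0 - x 0)
  linarith

/-! ### Classical solutions -/

/-- The damping of a locally Lipschitz map outside a ball is globally Lipschitz. -/
theorem norm_damped_sub_le {F G : Type*} [NormedAddCommGroup F] [NormedAddCommGroup G]
    [NormedSpace ℝ G] {ρ B L : ℝ} (hB : 0 ≤ B) (hL : 0 ≤ L) {b : F → G}
    (hb : ∀ x, ‖x‖ ≤ ρ + 1 → ‖b x‖ ≤ B)
    (hl : ∀ x y, ‖x‖ ≤ ρ + 1 → ‖y‖ ≤ ρ + 1 → ‖b x - b y‖ ≤ L * ‖x - y‖) (x y : F) :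
    ‖max 0 (min 1 (ρ + 1 - ‖x‖)) • b x - max 0 (min 1 (ρ + 1 - ‖y‖)) • b y‖
      ≤ (B + L) * ‖x - y‖ := by
  set c : F → ℝ := fun x => max 0 (min 1 (ρ + 1 - ‖x‖)) with hc
  have hc0 : ∀ x, 0 ≤ c x := fun x => le_max_left _ _
  have hc1 : ∀ x, c x ≤ 1 := fun x => max_le zero_le_one (min_le_left _ _)
  have hcl : ∀ x y, |c x - c y| ≤ ‖x - y‖ := fun x y => by
    refine (abs_max_sub_max_le_max _ _ _ _).trans (max_le (by simp) ?_)
    refine (abs_min_sub_min_le_max _ _ _ _).trans (max_le (by simp) ?_)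
    rw [sub_sub_sub_cancel_left, norm_sub_rev]
    exact abs_norm_sub_norm_le _ _
  have hc_out : ∀ x, ρ + 1 < ‖x‖ → c x = 0 := fun x hx =>
    max_eq_left ((min_le_right _ _).trans (by linarith))
  change ‖c x • b x - c y • b y‖ ≤ _
  -- the case of a point in the ball and an arbitrary point
  have key : ∀ x y, ‖x‖ ≤ ρ + 1 → ‖c x • b x - c y • b y‖ ≤ (B + L) * ‖x - y‖ := by
    intro x y hx
    have h1 : ‖(c x - c y) • b x‖ ≤ ‖x - y‖ * B := by
      rw [norm_smul]
      exact mul_le_mul (hcl x y) (hb x hx) (norm_nonneg _) (norm_nonneg _)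
    have h2 : ‖c y • (b x - b y)‖ ≤ L * ‖x - y‖ := by
      rcases le_or_gt ‖y‖ (ρ + 1) with hy | hy
      · rw [norm_smul, Real.norm_of_nonneg (hc0 y)]
        exact (mul_le_of_le_one_left (norm_nonneg _) (hc1 y)).trans (hl x y hx hy)
      · rw [hc_out y hy, zero_smul, norm_zero]; positivity
    calc ‖c x • b x - c y • b y‖ = ‖(c x - c y) • b x + c y • (b x - b y)‖ := by
          congr 1; module
      _ ≤ _ := (norm_add_le _ _).trans ((add_le_add h1 h2).trans (le_of_eq (by ring)))
  rcases le_or_gt ‖x‖ (ρ + 1) with hx | hx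
  · exact key x y hx
  rcases le_or_gt ‖y‖ (ρ + 1) with hy | hy
  · rw [norm_sub_rev, norm_sub_rev x y]; exact key y x hy
  · rw [hc_out x hx, hc_out y hy, zero_smul, zero_smul, sub_self, norm_zero]; positivity

/-- Global existence of classical solutions: the right-hand side has linear growth, hence damping it
far away changes nothing along the solution. -/
theorem StandingAssumptions.exists_isClassicalSolution {n m l : ℕ} {T : ℝ} (hT : 0 < T)
    {f : E n → E m → E l → E n} {g : Fin m → E n → E m → E n} {U : Set (E m)} {A : Set (E l)}
    (h : StandingAssumptions f g U A) (x₀ : E n) {u : ℝ → E m} {a : ℝ → E l}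
    (hu : IsC1Control T U u) (ha : IsL1Control T A a) :
    ∃ x, IsClassicalSolution T f g x₀ u a x := by
  obtain ⟨R, hR, hb⟩ := exists_bound_of_continuousOn_Icc hu.1.continuousOn hu.1.continuousOn
  obtain ⟨Mf, hMf, hf⟩ := h.f_growth
  obtain ⟨Mg, hMg, hg⟩ := h.g_growth
  set w := derivWithin u (Icc 0 T) with hw
  have hwc : ContinuousOn w (Icc 0 T) :=
    hu.1.continuousOn_derivWithin (uniqueDiffOn_Icc hT) le_rfl
  obtain ⟨D', hD'⟩ := isCompact_Icc.exists_bound_of_continuousOn hwc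
  set D := max D' 0 with hDdef
  have hD : ∀ t ∈ Icc 0 T, ‖w t‖ ≤ D := fun t ht => (hD' t ht).trans (le_max_left _ _)
  have hD0 : 0 ≤ D := le_max_right _ _
  have haA : ∀ᵐ t, t ∈ Icc 0 T → a t ∈ A := (ae_restrict_iff' measurableSet_Icc).1 ha.2
  set b : ℝ → E n → E n := fun t x => f x (u t) (a t) + ∑ i, w t i • g i x (u t) with hbdef
  set c := Mf + m * (D * Mg) with hcdef
  have hc : 0 ≤ c := by positivity
  have hgrow : ∀ t ∈ Icc 0 T, a t ∈ A → ∀ x, ‖b t x‖ ≤ c * (1 + R) + c * ‖x‖ := by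
    intro t ht hat x
    have hn : ‖(x, u t)‖ ≤ R + ‖x‖ := by
      rw [Prod.norm_mk]
      exact max_le (by linarith) (by linarith [(hb t ht).1, norm_nonneg x])
    have h1 : ‖f x (u t) (a t)‖ ≤ Mf * (1 + (R + ‖x‖)) :=
      (hf x (u t) (hu.2 t ht) (a t) hat).trans (by gcongr)
    have h2 : ‖∑ i, w t i • g i x (u t)‖ ≤ m * (D * (Mg * (1 + (R + ‖x‖)))) := by
      calc _ ≤ ∑ _i : Fin m, D * (Mg * (1 + (R + ‖x‖))) := norm_sum_le_of_le _ fun i _ => by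
            rw [norm_smul]
            exact mul_le_mul ((PiLp.norm_apply_le _ i).trans (hD t ht))
              ((hg i x (u t) (subset_starHull U (hu.2 t ht))).trans (by gcongr))
              (norm_nonneg _) hD0
        _ = _ := by simp
    refine (norm_add_le _ _).trans ((add_le_add h1 h2).trans (le_of_eq ?_))
    rw [hcdef]; ring
  -- the a priori bound
  set ρ := (‖x₀‖ + c * (1 + R) * T) * Real.exp (c * T) with hρ
  have hρ0 : 0 ≤ ρ := by positivity
  obtain ⟨L, hL, hfl⟩ := h.drift_lipschitz (max (ρ + 1) R)
  obtain ⟨G, hG, hgl⟩ := h.fields_lipschitz (max (ρ + 1) R)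
  have hRm : R ≤ max (ρ + 1) R := le_max_right _ _
  have hρm : ρ + 1 ≤ max (ρ + 1) R := le_max_left _ _
  set B := c * (1 + R) + c * (ρ + 1) with hB
  set Λ := L + m * (D * G) with hΛ
  have hB0 : 0 ≤ B := by positivity
  have hΛ0 : 0 ≤ Λ := by positivity
  have hbB : ∀ t ∈ Icc 0 T, a t ∈ A → ∀ x, ‖x‖ ≤ ρ + 1 → ‖b t x‖ ≤ B :=
    fun t ht hat x hx => (hgrow t ht hat x).trans (by rw [hB]; gcongr)
  have hbl : ∀ t ∈ Icc 0 T, a t ∈ A → ∀ x y, ‖x‖ ≤ ρ + 1 → ‖y‖ ≤ ρ + 1 →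
      ‖b t x - b t y‖ ≤ Λ * ‖x - y‖ := by
    intro t ht hat x y hx hy
    have huR := (hb t ht).1.trans hRm
    have h1 := (hfl y x (u t) (hu.2 t ht) (u t) (hu.2 t ht) (a t) hat (hy.trans hρm)
      (hx.trans hρm) huR huR).2
    have h2 : ‖∑ i, w t i • (g i x (u t) - g i y (u t))‖ ≤ m * (D * (G * ‖x - y‖)) := by
      calc _ ≤ ∑ _i : Fin m, D * (G * ‖x - y‖) := norm_sum_le_of_le _ fun i _ => by
            rw [norm_smul]
            have h3 := (hgl i y x (u t) (hu.2 t ht) (u t) (hu.2 t ht) (hy.trans hρm)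
              (hx.trans hρm) huR huR).2
            rw [sub_self, norm_zero, add_zero] at h3
            exact mul_le_mul ((PiLp.norm_apply_le _ i).trans (hD t ht)) h3 (norm_nonneg _) hD0
        _ = _ := by simp
    rw [sub_self, norm_zero, add_zero] at h1
    calc ‖b t x - b t y‖ = ‖(f x (u t) (a t) - f y (u t) (a t))
          + ∑ i, w t i • (g i x (u t) - g i y (u t))‖ := by
          simp only [hbdef, smul_sub, Finset.sum_sub_distrib]; congr 1; abel
      _ ≤ _ := (norm_add_le _ _).trans ((add_le_add h1 h2).trans
          (le_of_eq (by rw [hΛ]; ring)))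
  set χ : E n → ℝ := fun x => max 0 (min 1 (ρ + 1 - ‖x‖)) with hχ
  have hχc : Continuous χ := by fun_prop
  have hχ0 : ∀ x, 0 ≤ χ x := fun x => le_max_left _ _
  have hχ1 : ∀ x, χ x ≤ 1 := fun x => max_le zero_le_one (min_le_left _ _)
  have hmeas : ∀ x : ℝ → E n, ContinuousOn x (Icc 0 T) →
      AEStronglyMeasurable (fun t => b t (x t)) (volume.restrict (Icc 0 T)) := by
    intro x hx
    have h1 := h.continuousOn_drift.aestronglyMeasurable_comp_of_isClosed
      (μ := volume.restrict (Icc 0 T)) (q := fun t => (x t, u t, a t))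
      (isClosed_univ.prod (h.isClosed.prod h.compact_A.isClosed))
      ((hx.aestronglyMeasurable measurableSet_Icc).aemeasurable.prodMk
        ((hu.1.continuousOn.aestronglyMeasurable measurableSet_Icc).aemeasurable.prodMk
          ha.1.aestronglyMeasurable.aemeasurable)) (by
      filter_upwards [ha.2, ae_restrict_mem measurableSet_Icc] with t ht htT
      exact ⟨mem_univ _, hu.2 t htT, ht⟩)
    refine h1.add (ContinuousOn.aestronglyMeasurable (continuousOn_finsetSum _ fun i _ => ?_)
      measurableSet_Icc)
    refine ((EuclideanSpace.proj (𝕜 := ℝ) i).continuous.comp_continuousOn hwc).smul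
      (f := fun t => w t i) (g := fun t => g i (x t) (u t)) fun t ht => ?_
    exact (h.g_smooth i (x t) (u t)
      (subset_starHull U (hu.2 t ht))).continuousAt.comp_continuousWithinAt
        (f := fun t => (x t, u t)) ((hx t ht).prodMk (hu.1.continuousOn t ht))
  obtain ⟨x, hx, hxeq⟩ := exists_caratheodory_solution hT.le (B + Λ).toNNReal
    (fun t x => χ x • b t x) (fun x hx => by
      rw [intervalIntegrable_iff_integrableOn_Icc_of_le hT.le]
      refine Integrable.of_bound ((hχc.comp hx).aestronglyMeasurable.smul
        (hmeas x hx.continuousOn)) B ?_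
      filter_upwards [ha.2, ae_restrict_mem measurableSet_Icc] with t ht htT
      change ‖χ (x t) • b t (x t)‖ ≤ B
      rw [norm_smul, Real.norm_of_nonneg (hχ0 _)]
      rcases le_or_gt ‖x t‖ (ρ + 1) with hxt | hxt
      · exact (mul_le_of_le_one_left (norm_nonneg _) (hχ1 _)).trans (hbB t htT ht _ hxt)
      · rw [show χ (x t) = 0 from max_eq_left ((min_le_right _ _).trans (by linarith)), zero_mul]
        exact hB0) (by
      filter_upwards [haA] with t ht htT x y
      rw [Real.coe_toNNReal _ (by positivity)]
      exact norm_damped_sub_le hB0 hΛ0 (hbB t htT (ht htT)) (hbl t htT (ht htT)) x y) x₀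
  have hbound : ∀ t ∈ Icc 0 T, ‖x t‖ ≤ ρ := by
    have hgr : ∀ t ∈ Icc 0 T, ‖x t‖ ≤ (‖x₀‖ + c * (1 + R) * T) + c * ∫ s in (0 : ℝ)..t, ‖x s‖ := by
      intro t ht
      have h1 : ‖∫ s in (0 : ℝ)..t, χ (x s) • b s (x s)‖
          ≤ ∫ s in (0 : ℝ)..t, (c * (1 + R) + c * ‖x s‖) := by
        refine intervalIntegral.norm_integral_le_of_norm_le ht.1 ?_
          (Continuous.intervalIntegrable (by fun_prop) _ _)
        filter_upwards [haA] with s hs hst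
        have hsT : s ∈ Icc 0 T := ⟨hst.1.le, hst.2.trans ht.2⟩
        rw [norm_smul, Real.norm_of_nonneg (hχ0 _)]
        exact (mul_le_of_le_one_left (norm_nonneg _) (hχ1 _)).trans (hgrow s hsT (hs hsT) _)
      rw [intervalIntegral.integral_add (by simp)
        (Continuous.intervalIntegrable (by fun_prop) _ _), intervalIntegral.integral_const,
        intervalIntegral.integral_const_mul c (fun s => ‖x s‖), sub_zero, smul_eq_mul] at h1
      have h2 : t * (c * (1 + R)) ≤ c * (1 + R) * T := by
        rw [mul_comm]; gcongr; exact ht.2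
      rw [hxeq t ht]
      linarith [norm_add_le x₀ (∫ s in (0 : ℝ)..t, χ (x s) • b s (x s))]
    intro t ht
    refine (le_mul_exp_of_le_add_integral hc hx.norm.continuousOn (fun _ _ => norm_nonneg _)
      hgr t ht).trans ?_
    rw [hρ]
    gcongr
    exact ht.2
  have hχx : ∀ t ∈ Icc 0 T, χ (x t) = 1 := fun t ht => by
    have := hbound t ht
    simp only [hχ]
    rw [min_eq_left (by linarith), max_eq_right zero_le_one]
  refine ⟨x, hx.continuousOn, ?_, fun t ht => ?_⟩
  · rw [intervalIntegrable_iff_integrableOn_Icc_of_le hT.le]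
    refine Integrable.of_bound (hmeas x hx.continuousOn) B ?_
    filter_upwards [ha.2, ae_restrict_mem measurableSet_Icc] with t ht htT
    exact hbB t htT ht _ ((hbound t htT).trans (by linarith))
  · rw [hxeq t ht]
    congr 1
    refine intervalIntegral.integral_congr fun s hs => ?_
    rw [uIcc_of_le ht.1] at hs
    simp only [hχx s ⟨hs.1, hs.2.trans ht.2⟩, one_smul]
    rfl

/-! ### Approximations and generalized solutions -/

theorem integral_norm_sub_le_add {d : ℕ} {T : ℝ} {p q r : ℝ → E d} (hp : IntegrableOn p (Icc 0 T))
    (hq : IntegrableOn q (Icc 0 T)) (hr : IntegrableOn r (Icc 0 T)) :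
    ∫ t in Icc 0 T, ‖p t - r t‖
      ≤ (∫ t in Icc 0 T, ‖p t - q t‖) + ∫ t in Icc 0 T, ‖q t - r t‖ := by
  have h1 : IntegrableOn (fun t => ‖p t - q t‖) (Icc 0 T) := (hp.sub hq).norm
  have h2 : IntegrableOn (fun t => ‖q t - r t‖) (Icc 0 T) := (hq.sub hr).norm
  rw [← integral_add h1 h2]
  exact integral_mono (hp.sub hr).norm (h1.add h2)
    fun t => norm_sub_le_norm_sub_add_norm_sub _ _ _

/-- Convergence in `L^1` implies almost everywhere convergence of a subsequence. -/
theorem exists_subseq_tendsto_ae {d : ℕ} {T : ℝ} {w : ℕ → ℝ → E d} {u : ℝ → E d}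
    (hw : ∀ k, IntegrableOn (w k) (Icc 0 T)) (hu : IntegrableOn u (Icc 0 T))
    (h : Tendsto (fun k => ∫ t in Icc 0 T, ‖w k t - u t‖) atTop (𝓝 0)) :
    ∃ φ : ℕ → ℕ, StrictMono φ ∧
      ∀ᵐ t ∂(volume.restrict (Icc 0 T)), Tendsto (fun k => w (φ k) t) atTop (𝓝 (u t)) := by
  have h1 : Tendsto (fun k => eLpNorm (w k - u) 1 (volume.restrict (Icc 0 T))) atTop (𝓝 0) := by
    have := ENNReal.tendsto_ofReal h
    rw [ENNReal.ofReal_zero] at this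
    refine this.congr fun k => ?_
    rw [eLpNorm_one_eq_lintegral_enorm, ← ofReal_integral_norm_eq_lintegral_enorm ((hw k).sub hu)]
    rfl
  exact (tendstoInMeasure_of_tendsto_eLpNorm one_ne_zero (fun k => (hw k).aestronglyMeasurable)
    hu.aestronglyMeasurable h1).exists_seq_tendsto_ae

/-- Bounded almost everywhere convergence on `[0,T]` implies convergence in `L^1`. -/
theorem tendsto_integral_norm_sub_of_bounded {d : ℕ} {T R : ℝ} {w : ℕ → ℝ → E d} {u : ℝ → E d}
    (hw : ∀ k, AEStronglyMeasurable (w k) (volume.restrict (Icc 0 T)))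
    (hu : AEStronglyMeasurable u (volume.restrict (Icc 0 T)))
    (hb : ∀ k, ∀ t ∈ Icc 0 T, ‖w k t‖ ≤ R)
    (h : ∀ᵐ t ∂(volume.restrict (Icc 0 T)), Tendsto (fun k => w k t) atTop (𝓝 (u t))) :
    Tendsto (fun k => ∫ t in Icc 0 T, ‖w k t - u t‖) atTop (𝓝 0) := by
  have := tendsto_integral_of_dominated_convergence (μ := volume.restrict (Icc 0 T))
    (F := fun k t => ‖w k t - u t‖) (f := fun _ => 0) (fun _ => 2 * R)
    (fun k => ((hw k).sub hu).norm) (integrable_const _)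
    (fun k => by
      filter_upwards [h, ae_restrict_mem measurableSet_Icc] with t ht htT
      have hut : ‖u t‖ ≤ R := le_of_tendsto ht.norm (Eventually.of_forall fun k => hb k t htT)
      rw [norm_norm]
      linarith [norm_sub_le (w k t) (u t), hb k t htT])
    (by
      filter_upwards [h] with t ht
      simpa using (ht.sub_const (u t)).norm)
  simpa using this

section

variable {n m l : ℕ} {T : ℝ} {f : E n → E m → E l → E n} {g : Fin m → E n → E m → E n}
  {U : Set (E m)} {A : Set (E l)} {I I' : Set ℝ} {x₀ : E n} {u : ℝ → E m} {a : ℝ → E l}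
  {w w' : ℕ → ℝ → E m} {y y' : ℕ → ℝ → E n}

theorem IsC1Control.integrableOn {v : ℝ → E m} (hv : IsC1Control T U v) :
    IntegrableOn v (Icc 0 T) :=
  hv.1.continuousOn.integrableOn_Icc

theorem IsClassicalSolution.integrableOn {v : ℝ → E m} {x : ℝ → E n}
    (hx : IsClassicalSolution T f g x₀ v a x) : IntegrableOn x (Icc 0 T) :=
  hx.continuousOn.integrableOn_Icc

/-- A subsequence of an approximation is an approximation, at all points where its controls
converge. -/
theorem IsApproximation.comp (hA : IsApproximation T f g U I x₀ u a w y) {φ : ℕ → ℕ}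
    (hφ : StrictMono φ) (hI : ∀ t ∈ I', Tendsto (fun k => w (φ k) t) atTop (𝓝 (u t))) :
    IsApproximation T f g U I' x₀ u a (fun k => w (φ k)) (fun k => y (φ k)) where
  control k := hA.control _
  solution k := hA.solution _
  bounded := by
    obtain ⟨R, hR⟩ := hA.bounded
    exact ⟨R, fun k => hR _⟩
  converges := ⟨hA.converges.1.comp hφ.tendsto_atTop, hI⟩

/-- Two approximations with the same limit control have the same asymptotic behaviour, in `L^1` and
at every point where both sequences of controls converge. -/
theorem IsApproximation.tendsto_sub (hT : 0 < T) (h : StandingAssumptions f g U A)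
    (hu : IsPointwiseL1Control T U u) (ha : IsL1Control T A a)
    (hA : IsApproximation T f g U I x₀ u a w y) (hA' : IsApproximation T f g U I' x₀ u a w' y')
    (h0 : (0 : ℝ) ∈ I) (h0' : (0 : ℝ) ∈ I') {σ : ℝ} (hσ : σ ∈ I) (hσ' : σ ∈ I')
    (hσT : σ ∈ Icc 0 T) :
    Tendsto (fun k => y k σ - y' k σ) atTop (𝓝 0) ∧
      Tendsto (fun k => ∫ t in Icc 0 T, ‖y k t - y' k t‖) atTop (𝓝 0) := by
  obtain ⟨R₁, hR₁⟩ := hA.bounded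
  obtain ⟨R₂, hR₂⟩ := hA'.bounded
  obtain ⟨M, hM, hest⟩ := exists_transformed_estimate_same h hT.le (max R₁ R₂)
  have hb : ∀ k, ‖y k σ - y' k σ‖ + ∫ t in Icc 0 T, ‖y k t - y' k t‖ ≤
      M * (‖w k 0 - w' k 0‖ + ‖w k σ - w' k σ‖
        + ((∫ t in Icc 0 T, ‖w k t - u t‖) + ∫ t in Icc 0 T, ‖w' k t - u t‖)) := by
    intro k
    have h1 := hest x₀ (w k) (y k) x₀ (w' k) (y' k) a ha
      ((hA.solution k).isTransformedSolution hT le_rfl h (hA.control k) ha fun t ht =>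
        ⟨(hR₁ k t ht).2.trans (le_max_left _ _), (hR₁ k t ht).1.trans (le_max_left _ _)⟩)
      ((hA'.solution k).isTransformedSolution hT le_rfl h (hA'.control k) ha fun t ht =>
        ⟨(hR₂ k t ht).2.trans (le_max_right _ _), (hR₂ k t ht).1.trans (le_max_right _ _)⟩) σ hσT
    rw [sub_self, norm_zero, zero_add] at h1
    refine h1.trans ?_
    gcongr
    have h2 := integral_norm_sub_le_add (hA.control k).integrableOn hu.1
      (hA'.control k).integrableOn
    simpa only [norm_sub_rev (u _)] using h2
  have hlim : Tendsto (fun k => M * (‖w k 0 - w' k 0‖ + ‖w k σ - w' k σ‖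
        + ((∫ t in Icc 0 T, ‖w k t - u t‖) + ∫ t in Icc 0 T, ‖w' k t - u t‖))) atTop (𝓝 0) := by
    have e0 := ((hA.converges.2 0 h0).sub (hA'.converges.2 0 h0')).norm
    have eσ := ((hA.converges.2 σ hσ).sub (hA'.converges.2 σ hσ')).norm
    have := ((e0.add eσ).add (hA.converges.1.add hA'.converges.1)).const_mul M
    simpa using this
  have hI : ∀ k, 0 ≤ ∫ t in Icc 0 T, ‖y k t - y' k t‖ := fun k =>
    integral_nonneg fun _ => norm_nonneg _
  refine ⟨squeeze_zero_norm (fun k => ?_) hlim, squeeze_zero hI (fun k => ?_) hlim⟩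
  · linarith [hb k, hI k]
  · linarith [hb k, norm_nonneg (y k σ - y' k σ)]

/-- The states of an approximation converge at the points where its controls do: a subsequence
converges by compactness, and it may be compared with the whole sequence. -/
theorem IsApproximation.exists_tendsto (hT : 0 < T) (h : StandingAssumptions f g U A)
    (hu : IsPointwiseL1Control T U u) (ha : IsL1Control T A a)
    (hA : IsApproximation T f g U I x₀ u a w y) (h0 : (0 : ℝ) ∈ I) {σ : ℝ} (hσ : σ ∈ I)
    (hσT : σ ∈ Icc 0 T) : ∃ v, Tendsto (fun k => y k σ) atTop (𝓝 v) := by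
  obtain ⟨R, hR⟩ := hA.bounded
  obtain ⟨v, -, φ, hφ, hv⟩ := tendsto_subseq_of_bounded (Metric.isBounded_closedBall (x := 0)
    (r := R)) (x := fun k => y k σ) fun k => by simpa using (hR k σ hσT).2
  have hA' : IsApproximation T f g U I x₀ u a (fun k => w (φ k)) (fun k => y (φ k)) :=
    hA.comp hφ fun t ht => (hA.converges.2 t ht).comp hφ.tendsto_atTop
  have h1 := (hA.tendsto_sub hT h hu ha hA' h0 h0 hσ hσ hσT).1
  refine ⟨v, ?_⟩
  simpa using h1.add hv

/-- Existence of the generalized solution, and convergence to it of all approximations. -/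
theorem exists_isGeneralizedSolution_of_approximation (hT : 0 < T)
    (h : StandingAssumptions f g U A) (hu : IsPointwiseL1Control T U u) (ha : IsL1Control T A a)
    (hex : ∀ τ ∈ Icc 0 T, ∃ w y, IsApproximation T f g U {0, τ} x₀ u a w y) :
    ∃ x, IsGeneralizedSolution T f g U x₀ u a x ∧
      ∀ τ ∈ Icc 0 T, ∀ w y, IsApproximation T f g U {0, τ} x₀ u a w y →
        ConvergesL1On T {0, τ} y x := by
  classical
  have hex' : ∀ τ, ∃ w y, τ ∈ Icc 0 T → IsApproximation T f g U {0, τ} x₀ u a w y := fun τ => by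
    by_cases hτ : τ ∈ Icc 0 T
    · obtain ⟨w, y, hwy⟩ := hex τ hτ
      exact ⟨w, y, fun _ => hwy⟩
    · exact ⟨fun _ _ => 0, fun _ _ => 0, fun h => absurd h hτ⟩
  choose W Y hWY using hex'
  have hx' : ∀ τ, ∃ v, τ ∈ Icc 0 T → Tendsto (fun k => Y τ k τ) atTop (𝓝 v) := fun τ => by
    by_cases hτ : τ ∈ Icc 0 T
    · obtain ⟨v, hv⟩ := (hWY τ hτ).exists_tendsto hT h hu ha (by simp) (σ := τ) (by simp) hτ
      exact ⟨v, fun _ => hv⟩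
    · exact ⟨0, fun h => absurd h hτ⟩
  choose x hx using hx'
  have h0T : (0 : ℝ) ∈ Icc 0 T := ⟨le_rfl, hT.le⟩
  -- one approximation determines the solution almost everywhere
  obtain ⟨φ, hφ, hφae⟩ := exists_subseq_tendsto_ae (fun k => ((hWY 0 h0T).control k).integrableOn)
    hu.1 (hWY 0 h0T).converges.1
  have hYae : ∀ᵐ t ∂(volume.restrict (Icc 0 T)),
      Tendsto (fun k => Y 0 (φ k) t) atTop (𝓝 (x t)) := by
    filter_upwards [hφae, ae_restrict_mem measurableSet_Icc] with t ht htT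
    have hsub : IsApproximation T f g U {0, t} x₀ u a (fun k => W 0 (φ k)) (fun k => Y 0 (φ k)) :=
      (hWY 0 h0T).comp hφ fun s hs => by
        rcases hs with rfl | rfl
        · exact ((hWY 0 h0T).converges.2 0 (by simp)).comp hφ.tendsto_atTop
        · exact ht
    have h1 := (hsub.tendsto_sub hT h hu ha (hWY t htT) (by simp) (by simp) (σ := t) (by simp)
      (by simp) htT).1
    simpa using h1.add (hx t htT)
  obtain ⟨R, hR⟩ := (hWY 0 h0T).bounded
  have hYint : ∀ k, IntegrableOn (Y 0 (φ k)) (Icc 0 T) := fun k =>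
    ((hWY 0 h0T).solution (φ k)).integrableOn
  have hxm : AEStronglyMeasurable x (volume.restrict (Icc 0 T)) :=
    aestronglyMeasurable_of_tendsto_ae _ (fun k => (hYint k).aestronglyMeasurable) hYae
  have hxb : ∀ᵐ t ∂(volume.restrict (Icc 0 T)), ‖x t‖ ≤ R := by
    filter_upwards [hYae, ae_restrict_mem measurableSet_Icc] with t ht htT
    exact le_of_tendsto ht.norm (Eventually.of_forall fun k => (hR _ t htT).2)
  have hxint : IntegrableOn x (Icc 0 T) := Integrable.of_bound hxm R hxb
  have hYL1 : Tendsto (fun k => ∫ t in Icc 0 T, ‖Y 0 (φ k) t - x t‖) atTop (𝓝 0) :=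
    tendsto_integral_norm_sub_of_bounded (fun k => (hYint k).aestronglyMeasurable) hxm
      (fun k t ht => (hR (φ k) t ht).2) hYae
  have hconv : ∀ τ ∈ Icc 0 T, ∀ w y, IsApproximation T f g U {0, τ} x₀ u a w y →
      ConvergesL1On T {0, τ} y x := by
    intro τ hτ w y hwy
    have hsub : IsApproximation T f g U {0} x₀ u a (fun k => W 0 (φ k)) (fun k => Y 0 (φ k)) :=
      (hWY 0 h0T).comp hφ fun s hs => by
        rw [mem_singleton_iff] at hs
        subst hs
        exact ((hWY 0 h0T).converges.2 0 (by simp)).comp hφ.tendsto_atTop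
    refine ⟨?_, fun t ht => ?_⟩
    · have h1 := (hwy.tendsto_sub hT h hu ha hsub (by simp) (by simp) (σ := 0) (by simp)
        (by simp) h0T).2
      have h2 := h1.add hYL1
      rw [add_zero] at h2
      exact squeeze_zero (fun k => integral_nonneg fun _ => norm_nonneg _)
        (fun k => integral_norm_sub_le_add (hwy.solution k).integrableOn (hYint k) hxint) h2
    · have htT : t ∈ Icc 0 T := by rcases ht with rfl | rfl <;> assumption
      have h1 := (hwy.tendsto_sub hT h hu ha (hWY t htT) (by simp) (by simp) ht (by simp) htT).1
      simpa using h1.add (hx t htT)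
  exact ⟨x, fun τ hτ => ⟨hxint, W τ, Y τ, hWY τ hτ, hconv τ hτ _ _ (hWY τ hτ)⟩, hconv⟩

theorem uniqueTrajectories_generalized (hT : 0 < T) (h : StandingAssumptions f g U A) :
    UniqueTrajectories T A {u | IsPointwiseL1Control T U u} (IsGeneralizedSolution T f g U) := by
  intro x₀ u hu a ha x x' hx hx' τ hτ
  obtain ⟨-, w, y, hA, hc⟩ := hx τ hτ
  obtain ⟨-, w', y', hA', hc'⟩ := hx' τ hτ
  have h1 := (hA.tendsto_sub hT h hu ha hA' (by simp) (by simp) (σ := τ) (by simp) (by simp) hτ).1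
  have h2 := (hc.2 τ (by simp)).sub (hc'.2 τ (by simp))
  exact (sub_eq_zero.1 (tendsto_nhds_unique h2 h1))

/-- A bounded generalized solution satisfies the equation for the radial coordinate, with the bounds
of the solution itself in place of those of its approximations. -/
theorem IsGeneralizedSolution.isTransformedSolution (hT : 0 < T) (h : StandingAssumptions f g U A)
    {R : ℝ} {x : ℝ → E n} (hu : IsPointwiseL1Control T U u) (ha : IsL1Control T A a)
    (hx : IsGeneralizedSolution T f g U x₀ u a x) (hb : ∀ t ∈ Icc 0 T, ‖x t‖ ≤ R ∧ ‖u t‖ ≤ R) :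
    IsTransformedSolution T R f g U x₀ u a x := by
  have h0T : (0 : ℝ) ∈ Icc 0 T := ⟨le_rfl, hT.le⟩
  have hxint := (hx 0 h0T).1
  refine ⟨hxint.aestronglyMeasurable, hu.1.aestronglyMeasurable, hb, hu.2, ?_, fun τ hτ => ?_⟩
  · obtain ⟨-, w, y, hA, hc⟩ := hx 0 h0T
    have h1 := hc.2 0 (by simp)
    simp only [fun k => (hA.solution k).apply_zero hT] at h1
    exact tendsto_nhds_unique h1 tendsto_const_nhds
  obtain ⟨-, w, y, hA, hc⟩ := hx τ hτ
  -- along a subsequence, controls and states converge almost everywhere as well as at `0` and `τ`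
  obtain ⟨φ, hφ, hφae⟩ := exists_subseq_tendsto_ae (fun k => (hA.control k).integrableOn)
    hu.1 hA.converges.1
  obtain ⟨ψ, hψ, hψae⟩ := exists_subseq_tendsto_ae (fun k => (hA.solution (φ k)).integrableOn)
    hxint (hc.1.comp hφ.tendsto_atTop)
  set κ := fun k => φ (ψ k) with hκ
  have hκt : Tendsto κ atTop atTop := hφ.tendsto_atTop.comp hψ.tendsto_atTop
  obtain ⟨R', hR'⟩ := hA.bounded
  set ρ := max R R' with hρ
  have hbρ : ∀ t ∈ Icc 0 T, ‖x t‖ ≤ ρ ∧ ‖u t‖ ≤ ρ := fun t ht =>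
    ⟨(hb t ht).1.trans (le_max_left _ _), (hb t ht).2.trans (le_max_left _ _)⟩
  have hRρ : ∀ k, ∀ t ∈ Icc 0 T, ‖y k t‖ ≤ ρ ∧ ‖w k t‖ ≤ ρ := fun k t ht =>
    ⟨(hR' k t ht).2.trans (le_max_right _ _), (hR' k t ht).1.trans (le_max_right _ _)⟩
  obtain ⟨L, hL, hφL⟩ := radialCoordinate_estimates h ρ
  obtain ⟨H, hH, hh⟩ := h.transformedDrift_lipschitz ρ
  have hlimφ : ∀ t ∈ Icc 0 T, ∀ z : ℕ → E n, ∀ z' : E n, (∀ k, ‖z k‖ ≤ ρ) → ‖z'‖ ≤ ρ →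
      Tendsto z atTop (𝓝 z') → Tendsto (fun k => w (κ k) t) atTop (𝓝 (u t)) →
      Tendsto (fun k => radialCoordinate g (z k) (w (κ k) t)) atTop
        (𝓝 (radialCoordinate g z' (u t))) := by
    intro t ht z z' hz hz' hzl hwl
    rw [tendsto_iff_norm_sub_tendsto_zero] at hzl hwl ⊢
    refine squeeze_zero (fun _ => norm_nonneg _) (fun k => (hφL z' (z k) (u t) (hu.2 t ht)
      (w (κ k) t) ((hA.control _).2 t ht) hz' (hz k) (hbρ t ht).2 (hRρ _ t ht).2).2.2.1) ?_
    simpa using (hzl.add hwl).const_mul L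
  have hx₀ : ‖x₀‖ ≤ ρ := by
    have := (hRρ 0 0 h0T).1
    rwa [(hA.solution 0).apply_zero hT] at this
  have e1 := hlimφ τ hτ (fun k => y (κ k) τ) (x τ) (fun k => (hRρ _ τ hτ).1) (hbρ τ hτ).1
    ((hc.2 τ (by simp)).comp hκt) ((hA.converges.2 τ (by simp)).comp hκt)
  have e2 := hlimφ 0 h0T (fun _ => x₀) x₀ (fun _ => hx₀) hx₀ tendsto_const_nhds
    ((hA.converges.2 0 (by simp)).comp hκt)
  have hsub : ∀ᵐ t, t ∈ Icc 0 T → a t ∈ A ∧ Tendsto (fun k => w (κ k) t) atTop (𝓝 (u t)) ∧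
      Tendsto (fun k => y (κ k) t) atTop (𝓝 (x t)) := by
    rw [← ae_restrict_iff' measurableSet_Icc]
    filter_upwards [ha.2, hφae, hψae] with t h1 h2 h3
    exact ⟨h1, h2.comp hψ.tendsto_atTop, h3⟩
  have hIoc : uIoc 0 τ ⊆ Icc 0 T := by
    rw [uIoc_of_le hτ.1]
    exact fun t ht => ⟨ht.1.le, ht.2.trans hτ.2⟩
  have e3 : Tendsto (fun k => ∫ s in (0 : ℝ)..τ,
      transformedDrift f g (y (κ k) s) (w (κ k) s) (a s)) atTop
      (𝓝 (∫ s in (0 : ℝ)..τ, transformedDrift f g (x s) (u s) (a s))) := by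
    refine intervalIntegral.tendsto_integral_filter_of_dominated_convergence (fun _ => H)
      (Eventually.of_forall fun k => ?_) (Eventually.of_forall fun k => ?_) (by simp) ?_
    · exact (h.aestronglyMeasurable_transformedDrift
        (hA.solution (κ k)).integrableOn.aestronglyMeasurable
        (hA.control (κ k)).integrableOn.aestronglyMeasurable (hA.control (κ k)).2 ha).mono_measure
          (Measure.restrict_mono hIoc le_rfl)
    · filter_upwards [hsub] with s hs hsτ
      obtain ⟨h1, h2⟩ := hRρ (κ k) s (hIoc hsτ)
      have hm := (hA.control (κ k)).2 s (hIoc hsτ)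
      exact (hh _ (y (κ k) s) _ hm _ hm _ (hs (hIoc hsτ)).1 h1 h1 h2 h2).1
    · filter_upwards [hsub] with s hs hsτ
      obtain ⟨hsa, hsw, hsy⟩ := hs (hIoc hsτ)
      rw [tendsto_iff_norm_sub_tendsto_zero] at hsw hsy ⊢
      refine squeeze_zero (fun _ => norm_nonneg _) (fun k => (hh (x s) (y (κ k) s) (u s)
        (hu.2 s (hIoc hsτ)) (w (κ k) s) ((hA.control _).2 s (hIoc hsτ)) (a s) hsa (hbρ s (hIoc hsτ)).1
        (hRρ _ s (hIoc hsτ)).1 (hbρ s (hIoc hsτ)).2 (hRρ _ s (hIoc hsτ)).2).2) ?_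
      simpa using (hsy.add hsw).const_mul H
  refine tendsto_nhds_unique e1 ((e2.add e3).congr fun k => ?_)
  exact ((hA.solution (κ k)).radialCoordinate_eq hT h (hA.control _) ha τ hτ).symm

/-- The Lipschitz estimate holds for every notion of solution whose bounded solutions satisfy the
equation for the radial coordinate. -/
theorem lipschitzEstimate_of_isTransformedSolution (hT : 0 < T) (h : StandingAssumptions f g U A)
    {𝒰 : Set (ℝ → E m)} {Sol : E n → (ℝ → E m) → (ℝ → E l) → (ℝ → E n) → Prop}
    (hSol : ∀ R x₀ u a x, u ∈ 𝒰 → IsL1Control T A a → Sol x₀ u a x →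
      (∀ t ∈ Icc 0 T, ‖x t‖ ≤ R ∧ ‖u t‖ ≤ R) → IsTransformedSolution T R f g U x₀ u a x) :
    LipschitzEstimate T A 𝒰 Sol := by
  intro r _ 𝒲 h𝒲 hbd K' hK' hKsol
  obtain ⟨R₁, hR₁⟩ := hbd
  obtain ⟨R₂, hR₂⟩ := hK'.exists_norm_le
  obtain ⟨M, hM, hest⟩ := exists_transformed_estimate_same h hT.le (max R₁ R₂)
  refine ⟨M, hM, fun x₀ hx₀ x₀' hx₀' u hu u' hu' a ha x x' hx hx' τ hτ =>
    hest x₀ u x x₀' u' x' a ha (hSol _ _ _ _ _ (h𝒲 hu) ha hx fun t ht => ?_)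
      (hSol _ _ _ _ _ (h𝒲 hu') ha hx' fun t ht => ?_) τ hτ⟩
  · exact ⟨(hR₂ _ (hKsol x₀ hx₀ u hu a x ha hx t ht)).trans (le_max_right _ _),
      (hR₁ u hu t ht).trans (le_max_left _ _)⟩
  · exact ⟨(hR₂ _ (hKsol x₀' hx₀' u' hu' a x' ha hx' t ht)).trans (le_max_right _ _),
      (hR₁ u' hu' t ht).trans (le_max_left _ _)⟩

theorem uniqueTrajectories_classical (hT : 0 < T) (h : StandingAssumptions f g U A) :
    UniqueTrajectories T A {u | IsC1Control T U u} (IsClassicalSolution T f g) := by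
  intro x₀ u hu a ha x x' hx hx' τ hτ
  obtain ⟨R₁, -, hR₁⟩ := exists_bound_of_continuousOn_Icc hx.continuousOn hu.1.continuousOn
  obtain ⟨R₂, -, hR₂⟩ := exists_bound_of_continuousOn_Icc hx'.continuousOn hu.1.continuousOn
  obtain ⟨M, hM, hest⟩ := exists_transformed_estimate_same h hT.le (max R₁ R₂)
  have h1 := hest x₀ u x x₀ u x' a ha
    (hx.isTransformedSolution hT le_rfl h hu ha fun t ht =>
      ⟨(hR₁ t ht).1.trans (le_max_left _ _), (hR₁ t ht).2.trans (le_max_left _ _)⟩)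
    (hx'.isTransformedSolution hT le_rfl h hu ha fun t ht =>
      ⟨(hR₂ t ht).1.trans (le_max_right _ _), (hR₂ t ht).2.trans (le_max_right _ _)⟩) τ hτ
  simp only [sub_self, norm_zero, integral_zero, add_zero, mul_zero] at h1
  have h2 : (0 : ℝ) ≤ ∫ t in Icc 0 T, ‖x t - x' t‖ := integral_nonneg fun _ => norm_nonneg _
  exact sub_eq_zero.1 (norm_le_zero_iff.1 (by linarith))

theorem continuousInOrdinaryControl_classical (hT : 0 < T) (h : StandingAssumptions f g U A) :
    ContinuousInOrdinaryControl T A {u | IsC1Control T U u} (IsClassicalSolution T f g) := by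
  intro x₀ u hu a x ha hx ε hε
  obtain ⟨R, -, hR⟩ := exists_bound_of_continuousOn_Icc hx.continuousOn hu.1.continuousOn
  obtain ⟨δ, hδ, hest⟩ := exists_delta_classical h hT R hε
  exact ⟨δ, hδ, fun b y hb hy hab => (hest x₀ u a b x y hu ha hb hx hy hR hab).2⟩

/-- Continuity in the ordinary control of generalized solutions. The controls of one approximation
for `a` also serve for a nearby `b`: the classical solutions for `b` are then uniformly bounded and
converge to the generalized solution for `b`. -/
theorem continuousInOrdinaryControl_generalized (hT : 0 < T) (h : StandingAssumptions f g U A) :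
    ContinuousInOrdinaryControl T A {u | IsPointwiseL1Control T U u}
      (IsGeneralizedSolution T f g U) := by
  intro x₀ u hu a x ha hx ε hε
  have h0T : (0 : ℝ) ∈ Icc 0 T := ⟨le_rfl, hT.le⟩
  obtain ⟨hxint, w, y, hA, hc⟩ := hx 0 h0T
  obtain ⟨R, hR⟩ := hA.bounded
  obtain ⟨δ, hδ, hest⟩ := exists_delta_classical h hT R (half_pos hε)
  refine ⟨δ, hδ, fun b x' hb hx' hab => ?_⟩
  choose y' hy' using fun k => h.exists_isClassicalSolution hT x₀ (hA.control k) hb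
  have hclose := fun k => hest x₀ (w k) a b (y k) (y' k) (hA.control k) ha hb (hA.solution k)
    (hy' k) (fun t ht => ⟨(hR k t ht).2, (hR k t ht).1⟩) hab
  have hA' : IsApproximation T f g U {0, 0} x₀ u b w y' :=
    ⟨hA.control, hy', ⟨R + 1, fun k t ht => ⟨by linarith [(hR k t ht).1], by
      have h1 := norm_add_le (y' k t - y k t) (y k t)
      rw [sub_add_cancel] at h1
      linarith [(hR k t ht).2, (hclose k).1 t ht]⟩⟩, hA.converges⟩
  obtain ⟨hx'int, w'', y'', hA'', hc''⟩ := hx' 0 h0T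
  have hlim := (hA''.tendsto_sub hT h hu hb hA' (by simp) (by simp) (σ := 0) (by simp) (by simp)
    h0T).2
  have hle : ∀ k, ∫ t in Icc 0 T, ‖x' t - x t‖ ≤ (∫ t in Icc 0 T, ‖y'' k t - x' t‖)
      + ((∫ t in Icc 0 T, ‖y'' k t - y' k t‖)
        + (ε / 2 + ∫ t in Icc 0 T, ‖y k t - x t‖)) := by
    intro k
    have i := (hA.solution k).integrableOn
    have i' := (hy' k).integrableOn
    have i'' := (hA''.solution k).integrableOn
    have h1 := integral_norm_sub_le_add hx'int i'' hxint
    have h2 := integral_norm_sub_le_add i'' i' hxint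
    have h3 := integral_norm_sub_le_add i' i hxint
    simp only [norm_sub_rev (x' _) (y'' k _)] at h1
    linarith [(hclose k).2]
  have hlim' := hc''.1.add (hlim.add (hc.1.const_add (ε / 2)))
  simp only [add_zero, zero_add] at hlim'
  exact (ge_of_tendsto' hlim' hle).trans_lt (half_lt_self hε)

end

/-! ### Density of smooth controls -/

/-- Two points of a connected open set are joined by a smooth curve that stays in the set and is
constant before time `0` and after time `1`. With this normalization two curves with a common end
point `q` are concatenated by adding them and subtracting `q`. -/
theorem IsConnected.exists_contDiff_curve {d : ℕ} {Ω : Set (E d)} (hΩ : IsOpen Ω)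
    (hc : IsConnected Ω) {p q : E d} (hp : p ∈ Ω) (hq : q ∈ Ω) :
    ∃ γ : ℝ → E d, ContDiff ℝ 1 γ ∧ (∀ t, γ t ∈ Ω) ∧ (∀ t ≤ 0, γ t = p) ∧ ∀ t ≥ 1, γ t = q := by
  refine hc.isPreconnected.induction₂ (fun p q => ∃ γ : ℝ → E d, ContDiff ℝ 1 γ ∧ (∀ t, γ t ∈ Ω) ∧
    (∀ t ≤ 0, γ t = p) ∧ ∀ t ≥ 1, γ t = q) ?_ ?_ ?_ hp hq
  · intro p hp
    obtain ⟨ε, hε, hball⟩ := Metric.isOpen_iff.1 hΩ p hp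
    filter_upwards [nhdsWithin_le_nhds (Metric.ball_mem_nhds p hε)] with q hq
    refine ⟨fun t => p + Real.smoothTransition t • (q - p),
      contDiff_const.add (Real.smoothTransition.contDiff.smul contDiff_const), fun t => ?_,
      fun t ht => ?_, fun t ht => ?_⟩
    · refine hball ((convex_ball p ε).segment_subset (Metric.mem_ball_self hε) hq ?_)
      rw [segment_eq_image']
      exact ⟨_, ⟨Real.smoothTransition.nonneg t, Real.smoothTransition.le_one t⟩, rfl⟩
    · simp [Real.smoothTransition.zero_of_nonpos ht]
    · simp [Real.smoothTransition.one_of_one_le ht]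
  · rintro p q r - - - ⟨γ, hγ, hγΩ, hγ0, hγ1⟩ ⟨σ, hσ, hσΩ, hσ0, hσ1⟩
    refine ⟨fun t => γ (2 * t) + σ (2 * t - 1) - q,
      ((hγ.comp (contDiff_const.mul contDiff_id)).add
        (hσ.comp ((contDiff_const.mul contDiff_id).sub contDiff_const))).sub contDiff_const,
      fun t => ?_, fun t ht => ?_, fun t ht => ?_⟩
    · change γ (2 * t) + σ (2 * t - 1) - q ∈ Ω
      rcases le_total (2 * t) 1 with h | h
      · rw [hσ0 (2 * t - 1) (by linarith), add_sub_cancel_right]; exact hγΩ _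
      · rw [hγ1 (2 * t) h, add_sub_cancel_left]; exact hσΩ _
    · simp only
      rw [hσ0 (2 * t - 1) (by linarith), hγ0 (2 * t) (by linarith), add_sub_cancel_right]
    · simp only
      rw [hσ1 (2 * t - 1) (by linarith), hγ1 (2 * t) (by linarith), add_sub_cancel_left]
  · rintro p q - - ⟨γ, hγ, hγΩ, hγ0, hγ1⟩
    exact ⟨fun t => γ (1 - t), hγ.comp (contDiff_const.sub contDiff_id), fun t => hγΩ _,
      fun t ht => hγ1 _ (by linarith), fun t ht => hγ0 _ (by linarith)⟩

/-- A smooth curve in a connected open set that visits finitely many points at integer times. -/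
theorem IsConnected.exists_contDiff_curve_through {d : ℕ} {Ω : Set (E d)} (hΩ : IsOpen Ω)
    (hc : IsConnected Ω) {p : ℕ → E d} (hp : ∀ i, p i ∈ Ω) (N : ℕ) :
    ∃ γ : ℝ → E d, ContDiff ℝ 1 γ ∧ (∀ t, γ t ∈ Ω) ∧ (∀ i ≤ N, γ i = p i) ∧
      ∀ t : ℝ, N ≤ t → γ t = p N := by
  induction N with
  | zero =>
    refine ⟨fun _ => p 0, contDiff_const, fun _ => hp 0, fun i hi => ?_, fun _ _ => rfl⟩
    rw [Nat.le_zero.1 hi]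
  | succ N ih =>
    obtain ⟨γ, hγ, hγΩ, hγi, hγN⟩ := ih
    obtain ⟨σ, hσ, hσΩ, hσ0, hσ1⟩ := hc.exists_contDiff_curve hΩ (hp N) (hp (N + 1))
    have hle : ∀ t : ℝ, t ≤ N → γ t + σ (t - N) - p N = γ t := fun t ht => by
      rw [hσ0 (t - N) (by linarith), add_sub_cancel_right]
    have hge : ∀ t : ℝ, N ≤ t → γ t + σ (t - N) - p N = σ (t - N) := fun t ht => by
      rw [hγN t ht, add_sub_cancel_left]
    refine ⟨fun t => γ t + σ (t - N) - p N,
      (hγ.add (hσ.comp (contDiff_id.sub contDiff_const))).sub contDiff_const,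
      fun t => ?_, fun i hi => ?_, fun t ht => ?_⟩
    · rcases le_total t N with h | h
      · simp only [hle t h]; exact hγΩ t
      · simp only [hge t h]; exact hσΩ _
    · rcases Nat.le_succ_iff.1 hi with h | rfl
      · simp only [hle i (by exact_mod_cast h)]; exact hγi i h
      · simp only [hge ((N + 1 : ℕ) : ℝ) (by push_cast; linarith)]
        exact hσ1 _ (by push_cast; linarith)
    · push_cast at ht
      simp only [hge t (by linarith)]
      exact hσ1 _ (by linarith)

/-- Bump functions at `c` with supports shrinking to `c`. -/
noncomputable def shrinkingBump (c : ℝ) (k : ℕ) : ContDiffBump c where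
  rIn := 1 / (2 * ((k : ℝ) + 1))
  rOut := 1 / ((k : ℝ) + 1)
  rIn_pos := by positivity
  rIn_lt_rOut := one_div_lt_one_div_of_lt (by positivity) (by linarith [k.cast_nonneg (α := ℝ)])

/-- Prescribing the value at one point does not change the limits at the other points. -/
theorem exists_contDiff_correction (θ : ℝ → ℝ) {q : ℕ → ℝ → ℝ} (hq : ∀ k, ContDiff ℝ 1 (q k))
    (c : ℝ) : ∃ q' : ℕ → ℝ → ℝ, (∀ k, ContDiff ℝ 1 (q' k)) ∧ (∀ k, q' k c = θ c) ∧
      ∀ t ≠ c, Tendsto (fun k => q k t) atTop (𝓝 (θ t)) →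
        Tendsto (fun k => q' k t) atTop (𝓝 (θ t)) := by
  refine ⟨fun k t => q k t + shrinkingBump c k t * (θ c - q k c),
    fun k => (hq k).add ((shrinkingBump c k).contDiff.mul contDiff_const), fun k => ?_,
    fun t ht hlim => ?_⟩
  · simp [(shrinkingBump c k).one_of_mem_closedBall
      (Metric.mem_closedBall_self (shrinkingBump c k).rIn_pos.le)]
  · refine hlim.congr' ?_
    have h1 := tendsto_one_div_add_atTop_nhds_zero_nat (𝕜 := ℝ)
    filter_upwards [h1.eventually (ge_mem_nhds (dist_pos.2 ht))] with k hk
    simp [(shrinkingBump c k).zero_of_le_dist hk]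

/-- A locally integrable function is the almost everywhere limit of smooth functions, which may be
chosen to converge at two given points as well. -/
theorem exists_contDiff_tendsto_ae {θ : ℝ → ℝ} (hθ : LocallyIntegrable θ volume) (τ : ℝ) :
    ∃ q : ℕ → ℝ → ℝ, (∀ k, ContDiff ℝ 1 (q k)) ∧
      (∀ᵐ t, Tendsto (fun k => q k t) atTop (𝓝 (θ t))) ∧
      Tendsto (fun k => q k 0) atTop (𝓝 (θ 0)) ∧ Tendsto (fun k => q k τ) atTop (𝓝 (θ τ)) := by
  have hae := ContDiffBump.ae_convolution_tendsto_right_of_locallyIntegrable (μ := volume)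
    (φ := fun k => shrinkingBump 0 k) (l := atTop) (K := 2)
    (tendsto_one_div_add_atTop_nhds_zero_nat (𝕜 := ℝ))
    (Eventually.of_forall fun k => by
      simp only [shrinkingBump]
      rw [one_div, one_div, mul_inv, ← mul_assoc, mul_inv_cancel₀ two_ne_zero, one_mul]) hθ
  obtain ⟨q₁, hq₁, hq₁0, hq₁t⟩ := exists_contDiff_correction θ
    (q := fun k => convolution ((shrinkingBump 0 k).normed volume) θ
      (ContinuousLinearMap.lsmul ℝ ℝ) volume)
    (fun k => (shrinkingBump 0 k).hasCompactSupport_normed.contDiff_convolution_left _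
      (shrinkingBump 0 k).contDiff_normed hθ) 0
  obtain ⟨q, hq, hqτ, hqt⟩ := exists_contDiff_correction θ hq₁ τ
  refine ⟨q, hq, ?_, ?_, by simp [hqτ]⟩
  · filter_upwards [hae, compl_mem_ae_iff.2 (measure_singleton 0),
      compl_mem_ae_iff.2 (measure_singleton τ)] with t ht ht0 htτ
    exact hqt t htτ (hq₁t t ht0 ht)
  · rcases eq_or_ne 0 τ with rfl | h
    · simp [hqτ]
    · exact hqt 0 h (by simp [hq₁0])

/-- Density of smooth controls: with respect to convergence in `L^1` and at two points, a control
with values in the bounded closure of a connected open set is approximated by smooth controls. The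
control is first replaced by one with finitely many values; these are visited by a smooth curve in
the open set, along which the approximation is that of a scalar function. -/
theorem IsPointwiseL1Control.exists_isC1Control {d : ℕ} {T : ℝ} {V Ω : Set (E d)}
    (hΩ : IsOpen Ω) (hc : IsConnected Ω) (hV : V = closure Ω) (hVb : Bornology.IsBounded V)
    {u : ℝ → E d} (hu : IsPointwiseL1Control T V u) (h0 : (0 : ℝ) ∈ Icc 0 T) {τ : ℝ}
    (hτ : τ ∈ Icc 0 T) {ε : ℝ} (hε : 0 < ε) :
    ∃ w, IsC1Control T V w ∧ ∫ t in Icc 0 T, ‖w t - u t‖ < ε ∧ ‖w 0 - u 0‖ < ε ∧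
      ‖w τ - u τ‖ < ε := by
  obtain ⟨R, hR⟩ := hVb.exists_norm_le
  have hΩV : Ω ⊆ V := hV ▸ subset_closure
  have : Nonempty Ω := hc.nonempty.to_subtype
  set p : ℕ → E d := fun i => (TopologicalSpace.denseSeq Ω i : E d) with hp
  have hpΩ : ∀ i, p i ∈ Ω := fun i => (TopologicalSpace.denseSeq Ω i).2
  have hpd : V ⊆ closure (range p) := by
    rw [hV]
    refine closure_minimal (fun x hx => ?_) isClosed_closure
    have h1 := TopologicalSpace.denseRange_denseSeq Ω ⟨x, hx⟩
    have h2 := mem_closure_image (f := (Subtype.val : Ω → E d))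
      continuous_subtype_val.continuousAt h1
    rwa [← range_comp] at h2
  have hum : AEMeasurable u (volume.restrict (Icc 0 T)) := hu.1.aestronglyMeasurable.aemeasurable
  -- finitely many values
  have hN : Tendsto (fun N => ∫ t in Icc 0 T, ‖SimpleFunc.nearestPt p N (u t) - u t‖)
      atTop (𝓝 0) := by
    refine tendsto_integral_norm_sub_of_bounded (R := R)
      (fun N => ((SimpleFunc.nearestPt p N).measurable.comp_aemeasurable hum).aestronglyMeasurable)
      hu.1.aestronglyMeasurable (fun N t _ => hR _ (hΩV (hpΩ _))) ?_
    filter_upwards [ae_restrict_mem measurableSet_Icc] with t ht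
    exact SimpleFunc.tendsto_nearestPt (hpd (hu.2 t ht))
  have hNt : ∀ t ∈ Icc 0 T, ∀ᶠ N in atTop, ‖SimpleFunc.nearestPt p N (u t) - u t‖ < ε / 2 :=
    fun t ht => (tendsto_iff_norm_sub_tendsto_zero.1
      (SimpleFunc.tendsto_nearestPt (hpd (hu.2 t ht)))).eventually (gt_mem_nhds (half_pos hε))
  obtain ⟨N, hN1, hN0, hNτ⟩ := ((hN.eventually (gt_mem_nhds (half_pos hε))).and
    ((hNt 0 h0).and (hNt τ hτ))).exists
  obtain ⟨γ, hγ, hγΩ, hγi, -⟩ := hc.exists_contDiff_curve_through hΩ hpΩ N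
  set v : ℝ → E d := fun t => SimpleFunc.nearestPt p N (u t) with hv
  -- the scalar function along the curve
  set θ : ℝ → ℝ := (Icc 0 T).indicator fun t => (SimpleFunc.nearestPtInd p N (u t) : ℝ) with hθ
  have hγθ : ∀ t ∈ Icc 0 T, γ (θ t) = v t := fun t ht => by
    rw [hθ, indicator_of_mem ht, hγi _ (SimpleFunc.nearestPtInd_le p N _)]
    rfl
  have hvm : AEStronglyMeasurable v (volume.restrict (Icc 0 T)) :=
    ((SimpleFunc.nearestPt p N).measurable.comp_aemeasurable hum).aestronglyMeasurable
  have hθi : LocallyIntegrable θ volume := by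
    have hm : AEStronglyMeasurable (fun t => (SimpleFunc.nearestPtInd p N (u t) : ℝ))
        (volume.restrict (Icc 0 T)) :=
      ((measurable_from_nat (f := fun k : ℕ => (k : ℝ))).comp_aemeasurable
        ((SimpleFunc.nearestPtInd p N).measurable.comp_aemeasurable hum)).aestronglyMeasurable
    have hi : IntegrableOn (fun t => (SimpleFunc.nearestPtInd p N (u t) : ℝ)) (Icc 0 T) := by
      refine Integrable.of_bound hm (N : ℝ) (Eventually.of_forall fun t => ?_)
      rw [Real.norm_of_nonneg (Nat.cast_nonneg _)]
      exact_mod_cast SimpleFunc.nearestPtInd_le p N (u t)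
    exact ((integrable_indicator_iff measurableSet_Icc).2 hi).locallyIntegrable
  obtain ⟨q, hq, hqae, hq0, hqτ⟩ := exists_contDiff_tendsto_ae hθi τ
  have hw : ∀ k, IsC1Control T V (fun t => γ (q k t)) := fun k =>
    ⟨(hγ.comp (hq k)).contDiffOn, fun t _ => hΩV (hγΩ _)⟩
  have hlim : ∀ t ∈ Icc 0 T, Tendsto (fun k => q k t) atTop (𝓝 (θ t)) →
      Tendsto (fun k => γ (q k t)) atTop (𝓝 (v t)) := fun t ht h => by
    rw [← hγθ t ht]
    exact (hγ.continuous.tendsto _).comp h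
  have hL1 : Tendsto (fun k => ∫ t in Icc 0 T, ‖γ (q k t) - v t‖) atTop (𝓝 0) := by
    refine tendsto_integral_norm_sub_of_bounded (R := R)
      (fun k => (hw k).integrableOn.aestronglyMeasurable) hvm
      (fun k t _ => hR _ (hΩV (hγΩ _))) ?_
    filter_upwards [ae_restrict_of_ae hqae, ae_restrict_mem measurableSet_Icc] with t ht htT
    exact hlim t htT ht
  have hpt : ∀ t ∈ Icc 0 T, Tendsto (fun k => q k t) atTop (𝓝 (θ t)) →
      ∀ᶠ k in atTop, ‖γ (q k t) - v t‖ < ε / 2 := fun t ht h =>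
    (tendsto_iff_norm_sub_tendsto_zero.1 (hlim t ht h)).eventually (gt_mem_nhds (half_pos hε))
  obtain ⟨k, hk1, hk0, hkτ⟩ := ((hL1.eventually (gt_mem_nhds (half_pos hε))).and
    ((hpt 0 h0 hq0).and (hpt τ hτ hqτ))).exists
  have hvi : IntegrableOn v (Icc 0 T) :=
    Integrable.of_bound hvm R (Eventually.of_forall fun t => hR _ (hΩV (hpΩ _)))
  refine ⟨_, hw k, ?_, ?_, ?_⟩
  · have := integral_norm_sub_le_add (hw k).integrableOn hvi hu.1
    linarith
  · linarith [norm_sub_le_norm_sub_add_norm_sub (γ (q k 0)) (v 0) (u 0)]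
  · linarith [norm_sub_le_norm_sub_add_norm_sub (γ (q k τ)) (v τ) (u τ)]

/-- Uniformly bounded trajectories provide approximations at every time. -/
theorem BoundedTrajectories.exists_isApproximation {n m l : ℕ} {T : ℝ} (hT : 0 < T)
    {f : E n → E m → E l → E n} {g : Fin m → E n → E m → E n} {U V : Set (E m)} {A : Set (E l)}
    (h : StandingAssumptions f g U A) {x₀ : E n} {u : ℝ → E m} {a : ℝ → E l}
    (hu : IsPointwiseL1Control T V u) (ha : IsL1Control T A a)
    (hV : BoundedTrajectories T f g U x₀ a V) {τ : ℝ} (hτ : τ ∈ Icc 0 T) :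
    ∃ w y, IsApproximation T f g U {0, τ} x₀ u a w y := by
  obtain ⟨hVU, hVb, ⟨Ω, hΩ, hc, hVΩ⟩, N, hN⟩ := hV
  obtain ⟨R, hR⟩ := hVb.exists_norm_le
  have hε : ∀ k : ℕ, (0 : ℝ) < 1 / (k + 1) := fun k => by positivity
  choose w hw hw1 hw0 hwτ using fun k => hu.exists_isC1Control hΩ hc hVΩ hVb ⟨le_rfl, hT.le⟩ hτ
    (hε k)
  have hwU : ∀ k, IsC1Control T U (w k) := fun k => ⟨(hw k).1, fun t ht => hVU ((hw k).2 t ht)⟩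
  choose y hy using fun k => h.exists_isClassicalSolution hT x₀ (hwU k) ha
  have hlim := tendsto_one_div_add_atTop_nhds_zero_nat (𝕜 := ℝ)
  refine ⟨w, y, hwU, hy, ⟨max R N, fun k t ht =>
    ⟨(hR _ ((hw k).2 t ht)).trans (le_max_left _ _),
      (hN _ _ (hw k) (hy k) t ht).trans (le_max_right _ _)⟩⟩,
    squeeze_zero (fun k => integral_nonneg fun _ => norm_nonneg _) (fun k => (hw1 k).le) hlim, ?_⟩
  rintro t (rfl | rfl)
  · exact tendsto_iff_norm_sub_tendsto_zero.2
      (squeeze_zero (fun k => norm_nonneg _) (fun k => (hw0 k).le) hlim)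
  · exact tendsto_iff_norm_sub_tendsto_zero.2
      (squeeze_zero (fun k => norm_nonneg _) (fun k => (hwτ k).le) hlim)

/-! ### The robustness theorem -/

theorem mainTheorem5 {n m l : ℕ} (T : ℝ) (hT : 0 < T)
    (f : E n → E m → E l → E n) (g : Fin m → E n → E m → E n)
    (U : Set (E m)) (A : Set (E l)) (h : StandingAssumptions f g U A) :
    -- controls `u` of class `C^1`
    ((∀ x₀ u a, IsC1Control T U u → IsL1Control T A a →
        ∃ x, IsClassicalSolution T f g x₀ u a x) ∧
      UniqueTrajectories T A {u | IsC1Control T U u} (IsClassicalSolution T f g) ∧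
      ContinuousInOrdinaryControl T A {u | IsC1Control T U u} (IsClassicalSolution T f g) ∧
      LipschitzEstimate T A {u | IsC1Control T U u} (IsClassicalSolution T f g)) ∧
    -- controls `u` in `L^1`, pointwise defined on `[0,T]`
    ((∀ x₀ u a V, IsPointwiseL1Control T V u → IsL1Control T A a →
        BoundedTrajectories T f g U x₀ a V →
        ∃ x, IsGeneralizedSolution T f g U x₀ u a x) ∧
      (∀ x₀ u a, IsPointwiseL1Control T U u → IsL1Control T A a →
        (∀ τ ∈ Icc 0 T, ∃ w y, IsApproximation T f g U {0, τ} x₀ u a w y) →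
        ∃ x, IsGeneralizedSolution T f g U x₀ u a x ∧
          ∀ τ ∈ Icc 0 T, ∀ w y, IsApproximation T f g U {0, τ} x₀ u a w y →
            ConvergesL1On T {0, τ} y x) ∧
      UniqueTrajectories T A {u | IsPointwiseL1Control T U u} (IsGeneralizedSolution T f g U) ∧
      ContinuousInOrdinaryControl T A {u | IsPointwiseL1Control T U u}
        (IsGeneralizedSolution T f g U) ∧
      LipschitzEstimate T A {u | IsPointwiseL1Control T U u}
        (IsGeneralizedSolution T f g U)) := by
  refine ⟨⟨fun x₀ u a hu ha => h.exists_isClassicalSolution hT x₀ hu ha,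
      uniqueTrajectories_classical hT h, continuousInOrdinaryControl_classical hT h,
      lipschitzEstimate_of_isTransformedSolution hT h fun R x₀ u a x hu ha hx hb =>
        hx.isTransformedSolution hT le_rfl h hu ha hb⟩,
    ⟨fun x₀ u a V hu ha hV => ?_,
      fun x₀ u a hu ha hex => exists_isGeneralizedSolution_of_approximation hT h hu ha hex,
      uniqueTrajectories_generalized hT h, continuousInOrdinaryControl_generalized hT h,
      lipschitzEstimate_of_isTransformedSolution hT h fun R x₀ u a x hu ha hx hb =>
        hx.isTransformedSolution hT h hu ha hb⟩⟩
  have huU : IsPointwiseL1Control T U u := ⟨hu.1, fun t ht => hV.1 (hu.2 t ht)⟩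
  obtain ⟨x, hx, -⟩ := exists_isGeneralizedSolution_of_approximation hT h huU ha
    fun τ hτ => hV.exists_isApproximation hT h hu ha hτ
  exact ⟨x, hx⟩
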